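/- Let $n\ge 2$. Balls are Euclidean balls $B=B(x,t)\subset\mathbb R^n$, $x\in\mathbb R^n$, $t>0$, and $\lambda B=B(x,\lambda t)$. For a measure $\mu$ on $\mathbb R^n$, a weight is a $\mu$-locally integrable function $v$ with $v>0$ $\mu$-a.e.; we write $⨍_B g\,d\mu=\mu(B)^{-1}\int_B g\,d\mu$. We say $v\in A_p(\mu)$, $1<p<\infty$, if $\sup_B \big(⨍_B v\,d\mu\big)\big(⨍_B v^{1-p'}d\mu\big)^{p-1}<\infty$; $v\in A_1(\mu)$ if $\sup_B \big(⨍_B v\,d\mu\big)\big(\operatorname{ess\,sup}_B v^{-1}\big)<\infty$; $A_\infty(\mu)=\bigcup_{1\le p<\infty}A_p(\mu)$; and $v\in RH_s(\mu)$, $1<s<\infty$, if $\sup_B \big(⨍_B v\,d\mu\big)^{-1}\big(⨍_B v^s d\mu\big)^{1/s}<\infty$. Here $p'=p/(p-1)$. Write $A_p$ for $\mu=dx$, and $A_p(w)$, $RH_s(w)$ for $d\mu=w\,dx$; also $w(E)=\int_E w\,dx$, and $L^p(w)$, $L^p(v\,dw)$ refer to the measures $w\,dx$ and $vw\,dx$.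 For $w\in A_\infty$, $v\in A_\infty(w)$ and $0\le p_0<q_0\le\infty$ let $$\mathcal W_v^w(p_0,q_0)=\Big\{p\in(p_0,q_0):\ v\in A_{p/p_0}(w)\cap RH_{(q_0/p)'}(w)\Big\},$$ where the $A$-condition is dropped if $p_0=0$ and the $RH$-condition is dropped if $q_0=\infty$. Let $w\in A_\infty$, $v\in A_\infty(w)$ and $0<p_0<2<q_0<\infty$. Let $\{T_t\}_{t>0}$ be a family of sublinear operators, that is, for all $f,g$ in a common domain (a complex vector space of functions $\mathbb R^n\to\mathbb C$) and all $a\in\mathbb C$, $|T_t(f+g)|\le|T_tf|+|T_tg|$ and $|T_t(af)|=|a||T_tf|$ a.e. Let $F:\mathbb R^{n+1}_+\to\mathbb C$ be measurable, with every $F(\cdot,t)$ in this domain, and write $T_sF(y,t)=T_s(F(\cdot,t))(y)$; assume that $(y,t)\mapsto T_{t^2}F(y,t)$ is measurable on $\mathbb R^{n+1}_+$. Put $$\mathcal VF(x)=\Big(\int_0^\infty|T_{t^2}F(x,t)|^2\frac{dt}{t}\Big)^{1/2},\qquad \mathcal SF(x)=\Big(\int_0^\infty\!\!\int_{B(x,t)}|T_{t^2}F(y,t)|^2\frac{dw(y)\,dt}{t\,w(B(y,t))}\Big)^{1/2}.$$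 Consider the following conditions, for given constants $M<\infty$, $c>0$ and $\kappa(\lambda)>0$ ($\lambda>0$), where in (ii) and (iii) $B=B(x,t)$, $F$ stands for $F(\cdot,t)$, and the bounds are required for all $x\in\mathbb R^n$ and $t>0$: (i) $F(y,\lambda t)=\kappa(\lambda)F(y,t)$ for all $\lambda,t>0$ and $y\in\mathbb R^n$; (ii) $w(B)^{-1/2}\|\chi_BT_{t^2}F\|_{L^2(w)}\le M\sum_{j\ge1}e^{-c4^j}w(2^{j+1}B)^{-1/p_0}\|\chi_{2^{j+1}B}T_{t^2/2}F\|_{L^{p_0}(w)}$; (iii) $w(B)^{-1/q_0}\|\chi_BT_{t^2}F\|_{L^{q_0}(w)}\le M\sum_{j\ge1}e^{-c4^j}w(2^{j+1}B)^{-1/2}\|\chi_{2^{j+1}B}T_{t^2/2}F\|_{L^2(w)}$. Then, as inequalities in $[0,\infty]$ and with constants $C<\infty$ that depend only on $n,w,v,p,p_0,q_0,M,c,\kappa$ (and not otherwise on $F$, $\{T_t\}$ or its domain): (a) if (i) and (ii) hold, then $\|\mathcal SF\|_{L^p(v\,dw)}\le C\|\mathcal VF\|_{L^p(v\,dw)}$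 for all $p\in\mathcal W_v^w(p_0,\infty)$; (b) if (i) and (iii) hold, then $\|\mathcal VF\|_{L^p(v\,dw)}\le C\|\mathcal SF\|_{L^p(v\,dw)}$ for all $p\in\mathcal W_v^w(0,q_0)$. In particular, if (i), (ii) and (iii) hold, then both inequalities hold, that is, $\|\mathcal VF\|_{L^p(v\,dw)}\approx\|\mathcal SF\|_{L^p(v\,dw)}$, for all $p\in\mathcal W_v^w(p_0,q_0)$. -/

import Mathlib

open MeasureTheory Set
open scoped ENNReal NNReal

noncomputable section

namespace SquareFn

/-- `ℝⁿ` with its Euclidean norm. -/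
abbrev Rn (n : ℕ) : Type := EuclideanSpace ℝ (Fin n)

/-- A weight with respect to `μ`: a locally integrable function that is positive almost everywhere. -/
structure IsWeight {n : ℕ} (μ : Measure (Rn n)) (v : Rn n → ℝ) : Prop where
  locallyIntegrable : LocallyIntegrable v μ
  pos : ∀ᵐ x ∂μ, 0 < v x

/-- The measure `v dμ`. -/
def weighted {n : ℕ} (μ : Measure (Rn n)) (v : Rn n → ℝ) : Measure (Rn n) :=
  μ.withDensity fun x => ENNReal.ofReal (v x)

/-- The Muckenhoupt constant `[v]_{A_p(μ)}`, as a supremum over all balls. -/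
def apConst {n : ℕ} (μ : Measure (Rn n)) (p : ℝ) (v : Rn n → ℝ) : ℝ≥0∞ :=
  if p = 1 then
    ⨆ (x : Rn n) (r : ℝ) (_ : 0 < r),
      (⨍⁻ y in Metric.ball x r, ENNReal.ofReal (v y) ∂μ) *
        essSup (fun y => (ENNReal.ofReal (v y))⁻¹) (μ.restrict (Metric.ball x r))
  else
    ⨆ (x : Rn n) (r : ℝ) (_ : 0 < r),
      (⨍⁻ y in Metric.ball x r, ENNReal.ofReal (v y) ∂μ) *
        (⨍⁻ y in Metric.ball x r, ENNReal.ofReal (v y) ^ (1 - p.conjExponent) ∂μ) ^ (p - 1)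

/-- `v ∈ A_p(μ)`, `1 ≤ p < ∞`. -/
def MemAp {n : ℕ} (μ : Measure (Rn n)) (p : ℝ) (v : Rn n → ℝ) : Prop :=
  1 ≤ p ∧ IsWeight μ v ∧ apConst μ p v < ∞

/-- `v ∈ A_∞(μ)`, the union of the classes `A_p(μ)`, `1 ≤ p < ∞`. -/
def MemAinfty {n : ℕ} (μ : Measure (Rn n)) (v : Rn n → ℝ) : Prop :=
  ∃ p : ℝ, MemAp μ p v

/-- The reverse Hölder constant `[v]_{RH_s(μ)}`, `1 < s < ∞`. -/
def rhConst {n : ℕ} (μ : Measure (Rn n)) (s : ℝ) (v : Rn n → ℝ) : ℝ≥0∞ :=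
  ⨆ (x : Rn n) (r : ℝ) (_ : 0 < r),
    (⨍⁻ y in Metric.ball x r, ENNReal.ofReal (v y) ∂μ)⁻¹ *
      (⨍⁻ y in Metric.ball x r, ENNReal.ofReal (v y) ^ s ∂μ) ^ (1 / s)

/-- `v ∈ RH_s(μ)`, `1 < s < ∞`. -/
def MemRH {n : ℕ} (μ : Measure (Rn n)) (s : ℝ) (v : Rn n → ℝ) : Prop :=
  1 < s ∧ IsWeight μ v ∧ rhConst μ s v < ∞

/-- `𝒲_v^w(p₀, q₀)` for `0 ≤ p₀ < q₀ ≤ ∞`: the `p ∈ (p₀, q₀)` with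
`v ∈ A_{p/p₀}(w) ∩ RH_{(q₀/p)'}(w)`, where the first condition is void for `p₀ = 0` and the second
one for `q₀ = ∞`. -/
def exponents {n : ℕ} (w v : Rn n → ℝ) (p₀ : ℝ) (q₀ : ℝ≥0∞) : Set ℝ :=
  {p | p₀ < p ∧ ENNReal.ofReal p < q₀ ∧
    (p₀ ≠ 0 → MemAp (weighted volume w) (p / p₀) v) ∧
    (q₀ ≠ ∞ → MemRH (weighted volume w) (q₀.toReal / p).conjExponent v)}

/-- `S` is sublinear on the vector space `D` of functions: `|S(f + g)| ≤ |Sf| + |Sg|` and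
`|S(af)| = |a| |Sf|` almost everywhere. -/
structure IsSublinearOn {n : ℕ} (D : Submodule ℂ (Rn n → ℂ))
    (S : (Rn n → ℂ) → (Rn n → ℂ)) : Prop where
  add_le : ∀ f ∈ D, ∀ g ∈ D, ∀ᵐ x ∂(volume : Measure (Rn n)), ‖S (f + g) x‖ ≤ ‖S f x‖ + ‖S g x‖
  smul_eq : ∀ (a : ℂ), ∀ f ∈ D, ∀ᵐ x ∂(volume : Measure (Rn n)), ‖S (a • f) x‖ = ‖a‖ * ‖S f x‖

/-- Lebesgue measure on the upper half-space `ℝ^{n+1}_+`. -/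
def halfSpace (n : ℕ) : Measure (Rn n × ℝ) :=
  (volume : Measure (Rn n × ℝ)).restrict (univ ×ˢ Ioi 0)

/-- `{T_t}_{t>0}` is a family of sublinear operators on a common domain containing all the slices
`F(·, t)`, and `F(y, t)` and `T_{t²}F(y, t) = T_{t²}(F(·, t))(y)` are measurable on the upper
half-space. -/
structure Admissible {n : ℕ} (D : Submodule ℂ (Rn n → ℂ))
    (T : ℝ → (Rn n → ℂ) → (Rn n → ℂ)) (F : Rn n → ℝ → ℂ) : Prop where
  sublinear : ∀ t : ℝ, 0 < t → IsSublinearOn D (T t)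
  mem_domain : ∀ t : ℝ, 0 < t → (fun y => F y t) ∈ D
  measurable_F : AEStronglyMeasurable (fun z : Rn n × ℝ => F z.1 z.2) (halfSpace n)
  measurable_TF : AEStronglyMeasurable
    (fun z : Rn n × ℝ => T (z.2 ^ 2) (fun y => F y z.2) z.1) (halfSpace n)

/-- The vertical square function `𝒱F(x) = (∫₀^∞ |T_{t²}F(x,t)|² dt/t)^{1/2}`. -/
def vertical {n : ℕ} (T : ℝ → (Rn n → ℂ) → (Rn n → ℂ)) (F : Rn n → ℝ → ℂ) (x : Rn n) : ℝ≥0∞ :=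
  (∫⁻ t in Ioi (0 : ℝ), ‖T (t ^ 2) (fun y => F y t) x‖ₑ ^ 2 / ENNReal.ofReal t) ^ (1 / 2 : ℝ)

/-- The conical square function
`𝒮F(x) = (∫₀^∞ ∫_{B(x,t)} |T_{t²}F(y,t)|² dw(y) dt / (t w(B(y,t))))^{1/2}`. -/
def conical {n : ℕ} (w : Rn n → ℝ) (T : ℝ → (Rn n → ℂ) → (Rn n → ℂ)) (F : Rn n → ℝ → ℂ)
    (x : Rn n) : ℝ≥0∞ :=
  (∫⁻ t in Ioi (0 : ℝ), ∫⁻ y in Metric.ball x t,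
    ‖T (t ^ 2) (fun z => F z t) y‖ₑ ^ 2 /
      (ENNReal.ofReal t * weighted volume w (Metric.ball y t)) ∂(weighted volume w)) ^ (1 / 2 : ℝ)

/-- `F(y, ct) = κ(c) F(y, t)` with positive constants `κ(c)`, for all `c > 0`. -/
def IsScaleHomogeneous {n : ℕ} (κ : ℝ → ℝ) (F : Rn n → ℝ → ℂ) : Prop :=
  ∀ c : ℝ, 0 < c → 0 < κ c ∧ ∀ (y : Rn n) (t : ℝ), 0 < t → F y (c * t) = (κ c : ℂ) * F y t

/-- The local `L^r → L^s` off-diagonal bound with constants `M` and `c`: for all balls `B = B(x,t)`,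
`w(B)^{-1/s} ‖χ_B T_{t²}F‖_{L^s(w)}
  ≤ M ∑_{j ≥ 1} e^{-c4^j} w(2^{j+1}B)^{-1/r} ‖χ_{2^{j+1}B} T_{t²/2}F‖_{L^r(w)}`,
where `F` stands for `F(·, t)`. The index `j` below is shifted by one. -/
def OffDiagonal {n : ℕ} (w : Rn n → ℝ) (r s : ℝ) (M : ℝ≥0) (c : ℝ)
    (T : ℝ → (Rn n → ℂ) → (Rn n → ℂ)) (F : Rn n → ℝ → ℂ) : Prop :=
  ∀ (x : Rn n) (t : ℝ), 0 < t →
    weighted volume w (Metric.ball x t) ^ (-(1 / s)) *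
        eLpNorm ((Metric.ball x t).indicator (T (t ^ 2) fun y => F y t))
          (ENNReal.ofReal s) (weighted volume w) ≤
      M * ∑' j : ℕ, ENNReal.ofReal (Real.exp (-(c * 4 ^ (j + 1)))) *
        (weighted volume w (Metric.ball x (2 ^ (j + 2) * t)) ^ (-(1 / r)) *
          eLpNorm ((Metric.ball x (2 ^ (j + 2) * t)).indicator (T (t ^ 2 / 2) fun y => F y t))
            (ENNReal.ofReal r) (weighted volume w))

/-- The quasi-norm `‖g‖_{L^p(v dw)}` of a function with values in `[0, ∞]`. -/
def normLp {n : ℕ} (w v : Rn n → ℝ) (p : ℝ) (g : Rn n → ℝ≥0∞) : ℝ≥0∞ :=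
  eLpNorm g (ENNReal.ofReal p) (weighted (weighted volume w) v)

end SquareFn

end

noncomputable section

namespace SquareFn

/-! ### Integral inequalities -/

section Inequalities

variable {α : Type*} [MeasurableSpace α]

/-! Put μ = w dx, g(y,t) = |T_{t²}F(y,t)| and V = ∫ g² dt/t, the square of the vertical function.
Homogeneity with λ = √2 replaces |T_{t²/2}F(·,t)| by κ(√2) g(·,t/√2). Conditions (ii) and (iii) thus
compare averages of g at scale t with averages over dilated balls at scale at, a = 1/√2, and dt/t
does not see the factor a. Since w is in A_∞, μ is doubling. The rest is harmonic analysis on a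
doubling metric measure space.

(a) Let θ = p₀/2 and r = p/p₀. The factorization g^{p₀} = (g²V^{θ-1})^θ (V^θ)^{1-θ}, Hölder on each
ball and (ii) give the pointwise bound S² ≤ C M(V^θ)^{1/θ-1} Θ. Here Θ is a rapidly convergent sum
of conical averages of g²V^{θ-1}, a quantity whose dt/t-integral is at most V^θ. Muckenhoupt's
theorem bounds M(V^θ) in L^r(v dμ). Pairing Θ with φv moves the averages onto φv, so Θ is controlled
by V^θ tested against M(φv), and the dual weight in A_{r'} finishes. A last Hölder inequality with
exponents 1-θ and θ recombines the two factors. No extrapolation is needed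
(`ScaleOffDiagonal.conicalSq_le`, `lintegral_conicalSq_rpow_le`).

(b) First p = 2, for every W that is doubling and satisfies the reverse Hölder inequality with
exponent s = (q₀/2)' (`lintegral_verticalSq_mul_le`). By Tonelli, ∫ S² W dμ is the vertical
expression with W replaced by its averages at scale t. Hölder with 2/q₀ + 1/s = 1, condition (iii)
and the reverse Hölder inequality lead from ∫ g² W dμ to such averages. The doubling constants grow
geometrically in j and are beaten by e^{-c4^j}. Then extrapolation from L² to L^p. With u = (q₀/p)',
the hypotheses on v put v^u into some A_P(μ). For A in A₁(v^u dμ), the weights (A v^u)^{1/s} and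
A^{-η} v^{u/s} are admissible for the L² bound with constants independent of A. The first type
serves p > 2 by duality, the second p < 2 by Hölder, and A = 1 serves p = 2. The functions A come
from the Rubio de Francia iteration.

The maximal theorem is proved by a Vitali covering, and Muckenhoupt's theorem follows from it by
Lerner's argument, so no self-improvement of A_p weights is used. -/

theorem rpow_lintegral_le {μ : Measure α} {f : α → ℝ≥0∞} (hf : AEMeasurable f μ) {ρ : ℝ}
    (hρ : 1 ≤ ρ) : (∫⁻ x, f x ∂μ) ^ ρ ≤ μ univ ^ (ρ - 1) * ∫⁻ x, f x ^ ρ ∂μ := by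
  have hρ0 : 0 < ρ := by linarith
  have h := ENNReal.lintegral_mul_norm_pow_le (μ := μ) (f := fun x => f x ^ ρ) (g := fun _ => 1)
    (hf.pow_const _) aemeasurable_const (p := 1 / ρ) (q := 1 - 1 / ρ) (by positivity)
    (by rw [sub_nonneg, div_le_one hρ0]; exact hρ) (by ring)
  have e : ∀ x, (f x ^ ρ) ^ (1 / ρ) * (1 : ℝ≥0∞) ^ (1 - 1 / ρ) = f x := fun x => by
    rw [← ENNReal.rpow_mul, mul_one_div_cancel hρ0.ne', ENNReal.one_rpow, mul_one,
      ENNReal.rpow_one]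
  simp only [e, lintegral_one] at h
  calc (∫⁻ x, f x ∂μ) ^ ρ
      ≤ ((∫⁻ x, f x ^ ρ ∂μ) ^ (1 / ρ) * μ univ ^ (1 - 1 / ρ)) ^ ρ := by gcongr
    _ = μ univ ^ (ρ - 1) * ∫⁻ x, f x ^ ρ ∂μ := by
      rw [ENNReal.mul_rpow_of_nonneg _ _ hρ0.le, ← ENNReal.rpow_mul, ← ENNReal.rpow_mul,
        one_div_mul_cancel hρ0.ne', ENNReal.rpow_one, mul_comm]
      congr 2
      field_simp

theorem rpow_setLIntegral_le {μ : Measure α} {f : α → ℝ≥0∞} (hf : AEMeasurable f μ) {ρ : ℝ}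
    (hρ : 1 ≤ ρ) (s : Set α) :
    (∫⁻ x in s, f x ∂μ) ^ ρ ≤ μ s ^ (ρ - 1) * ∫⁻ x in s, f x ^ ρ ∂μ := by
  simpa using rpow_lintegral_le (μ := μ.restrict s) hf.restrict hρ

theorem rpow_tsum_mul_le (e a : ℕ → ℝ≥0∞) {ρ : ℝ} (hρ : 1 ≤ ρ) :
    (∑' j, e j * a j) ^ ρ ≤ (∑' j, e j) ^ (ρ - 1) * ∑' j, e j * a j ^ ρ := by
  have hρ0 : 0 < ρ := by linarith
  have key : ∑' j, e j * a j ≤ (∑' j, e j) ^ (1 - ρ⁻¹) * (∑' j, e j * a j ^ ρ) ^ ρ⁻¹ := by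
    rw [ENNReal.tsum_eq_iSup_sum]
    refine iSup_le fun s => (ENNReal.inner_le_weight_mul_Lp_of_nonneg s hρ e a).trans ?_
    have h1 : 0 ≤ 1 - ρ⁻¹ := by
      rw [sub_nonneg]; exact inv_le_one_of_one_le₀ hρ
    gcongr
    · exact ENNReal.sum_le_tsum s
    · exact ENNReal.sum_le_tsum s
  calc (∑' j, e j * a j) ^ ρ
      ≤ ((∑' j, e j) ^ (1 - ρ⁻¹) * (∑' j, e j * a j ^ ρ) ^ ρ⁻¹) ^ ρ := by gcongr
    _ = _ := by
      rw [ENNReal.mul_rpow_of_nonneg _ _ hρ0.le, ← ENNReal.rpow_mul, ← ENNReal.rpow_mul,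
        inv_mul_cancel₀ hρ0.ne', ENNReal.rpow_one]
      congr 2
      field_simp

/-- A bound for the pairings with all test functions of finite `L^{r'}` norm is a bound for the
`L^r` norm. -/
theorem lintegral_rpow_le_of_forall_lintegral_mul_le {ν : Measure α} [SigmaFinite ν] {r r' : ℝ}
    (hr : r.HolderConjugate r') {g : α → ℝ≥0∞} (hg : Measurable g) {K : ℝ≥0∞}
    (H : ∀ φ : α → ℝ≥0∞, Measurable φ → ∫⁻ x, φ x ^ r' ∂ν ≠ 0 → ∫⁻ x, φ x ^ r' ∂ν ≠ ∞ →
      ∫⁻ x, g x * φ x ∂ν ≤ K * (∫⁻ x, φ x ^ r' ∂ν) ^ (1 / r')) :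
    ∫⁻ x, g x ^ r ∂ν ≤ K ^ r := by
  have hr0 := hr.pos
  have hr'0 := hr.symm.pos
  let S := spanningSets ν
  -- The extremal test function is g^{r-1}, and its norm must be divided out. Truncating in height
  -- and to sets of finite measure makes that norm finite; monotone convergence restores g.
  let G : ℕ → α → ℝ≥0∞ := fun N x => (S N).indicator (fun y => min (g y) N) x
  have hGm : ∀ N, Measurable (G N) := fun N =>
    (hg.min measurable_const).indicator (measurableSet_spanningSets ν N)
  have hGmono : Monotone G := by
    intro a b hab x
    refine (indicator_le_indicator_of_subset (monotone_spanningSets ν hab)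
      (fun _ => zero_le) x).trans (indicator_le_indicator ?_)
    gcongr
  have hGlt : ∀ N x, G N x ≤ N := fun N x => by
    by_cases h : x ∈ S N <;> simp [G, h]
  have hGle : ∀ N x, G N x ≤ g x := fun N x => by
    by_cases h : x ∈ S N <;> simp [G, h]
  have hGsup : ∀ x, ⨆ N, G N x = g x := by
    intro x
    refine le_antisymm (iSup_le fun N => hGle N x) (le_of_forall_lt fun c hc => ?_)
    obtain ⟨k, hk⟩ : ∃ k, x ∈ S k := by
      have : x ∈ ⋃ i, S i := by simp [S, iUnion_spanningSets]
      simpa using this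
    obtain ⟨m, hm⟩ := ENNReal.exists_nat_gt (ne_top_of_lt hc)
    refine lt_of_lt_of_le ?_ (le_iSup (fun N => G N x) (max k m))
    have hx : x ∈ S (max k m) := monotone_spanningSets ν (le_max_left k m) hk
    simp only [G, indicator_of_mem hx, lt_min_iff]
    exact ⟨hc, hm.trans_le (by exact_mod_cast le_max_right k m)⟩
  have hX : ∀ N, ∫⁻ x, G N x ^ r ∂ν ≤ K ^ r := by
    intro N
    set X := ∫⁻ x, G N x ^ r ∂ν with hXdef
    have hXtop : X ≠ ∞ := by
      have : X ≤ ∫⁻ x in S N, (N : ℝ≥0∞) ^ r ∂ν := by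
        rw [← lintegral_indicator (measurableSet_spanningSets ν N)]
        refine lintegral_mono fun x => ?_
        by_cases h : x ∈ S N
        · rw [indicator_of_mem h]
          gcongr
          exact hGlt N x
        · simp [G, h, hr0]
      refine ne_top_of_le_ne_top ?_ this
      rw [setLIntegral_const]
      exact ENNReal.mul_ne_top (ENNReal.rpow_ne_top_of_nonneg hr0.le (by simp))
        (measure_spanningSets_lt_top ν N).ne
    by_cases hX0 : X = 0
    · rw [hX0]; exact zero_le
    have e1 : ∀ x, (G N x ^ (r - 1)) ^ r' = G N x ^ r := fun x => by
      rw [← ENNReal.rpow_mul, hr.sub_one_mul_conj]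
    have e2 : ∀ x, G N x * G N x ^ (r - 1) = G N x ^ r := fun x => by
      have := ENNReal.rpow_add_of_nonneg (x := G N x) 1 (r - 1) zero_le_one (by linarith [hr.lt])
      rw [add_sub_cancel, ENNReal.rpow_one] at this
      exact this.symm
    have h := H (fun x => G N x ^ (r - 1)) ((hGm N).pow_const _) (by simpa only [e1] using hX0)
      (by simpa only [e1] using hXtop)
    simp only [e1] at h
    have h2 : X ≤ K * X ^ (1 / r') := by
      refine le_trans ?_ h
      refine lintegral_mono fun x => ?_
      rw [← e2]
      gcongr
      exact hGle N x
    have h3 : X ^ (1 / r) ≤ K := by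
      have : X ^ (1 / r) * X ^ (1 / r') = X := by
        rw [← ENNReal.rpow_add _ _ hX0 hXtop, one_div, one_div, hr.inv_add_inv_eq_one,
          ENNReal.rpow_one]
      have hne : X ^ (1 / r') ≠ 0 := by simp [hX0, hXtop]
      have hne' : X ^ (1 / r') ≠ ∞ := ENNReal.rpow_ne_top_of_nonneg (by positivity) hXtop
      exact (ENNReal.mul_le_mul_iff_left hne hne').1 (this.le.trans h2)
    calc X = (X ^ (1 / r)) ^ r := by
          rw [← ENNReal.rpow_mul, one_div_mul_cancel hr0.ne', ENNReal.rpow_one]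
      _ ≤ K ^ r := by gcongr
  have hlim : ∫⁻ x, g x ^ r ∂ν = ⨆ N, ∫⁻ x, G N x ^ r ∂ν := by
    rw [← lintegral_iSup (fun N => (hGm N).pow_const _)]
    · refine lintegral_congr fun x => ?_
      rw [← hGsup x]
      exact (ENNReal.monotone_rpow_of_nonneg hr0.le).map_iSup_of_continuousAt
        (ENNReal.continuous_rpow_const.continuousAt) (by simp [hr0])
    · intro a b hab x
      simp only
      gcongr
      exact hGmono hab x
  rw [hlim]
  exact iSup_le hX

/-- Doubly exponential decay beats geometric growth. In the application K is a product of doubling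
constants, one factor for each dilation by 2. -/
theorem tsum_exp_four_pow_mul_pow_ne_top {c : ℝ} (hc : 0 < c) {K : ℝ≥0∞} (hK : K ≠ ∞) :
    ∑' j : ℕ, ENNReal.ofReal (Real.exp (-(c * 4 ^ (j + 1)))) * K ^ j ≠ ∞ := by
  lift K to ℝ≥0 using hK
  -- The bound e^x ≥ x^N/N! turns the exponential into decay of order 4^{-Nj}, so this N leaves a
  -- geometric series of ratio 1/2.
  obtain ⟨N, hN⟩ : ∃ N : ℕ, 2 * (K : ℝ) < 4 ^ N := pow_unbounded_of_one_lt _ (by norm_num)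
  have hb : ∀ j : ℕ, Real.exp (-(c * 4 ^ (j + 1))) * (K : ℝ) ^ j
      ≤ (N.factorial / (c * 4) ^ N) * (1 / 2) ^ j := by
    intro j
    have hx : 0 < c * 4 ^ (j + 1) := by positivity
    have h1 : (c * 4 ^ (j + 1)) ^ N / N.factorial ≤ Real.exp (c * 4 ^ (j + 1)) :=
      Real.pow_div_factorial_le_exp _ hx.le N
    rw [Real.exp_neg]
    have h2 : (Real.exp (c * 4 ^ (j + 1)))⁻¹ ≤ ((c * 4 ^ (j + 1)) ^ N / N.factorial)⁻¹ := by
      apply inv_anti₀ (by positivity) h1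
    have h3 : (K : ℝ) ^ j ≤ ((4 ^ N) / 2) ^ j := by
      gcongr
      linarith
    calc _ ≤ ((c * 4 ^ (j + 1)) ^ N / N.factorial)⁻¹ * ((4 ^ N) / 2) ^ j := by gcongr
      _ = _ := by
        have e : (c * 4 ^ (j + 1)) ^ N = (c * 4) ^ N * (4 ^ N) ^ j := by
          rw [← pow_mul, mul_comm N j, pow_mul, ← mul_pow]; ring
        rw [e, div_pow]
        field_simp
        rw [← mul_pow]; norm_num
  have hs : Summable fun j : ℕ => (N.factorial / (c * 4) ^ N : ℝ) * (1 / 2) ^ j :=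
    (summable_geometric_of_lt_one (by norm_num) (by norm_num)).mul_left _
  have hs2 : Summable fun j : ℕ => Real.exp (-(c * 4 ^ (j + 1))) * (K : ℝ) ^ j :=
    Summable.of_nonneg_of_le (fun j => by positivity) hb hs
  have e : ∀ j : ℕ, ENNReal.ofReal (Real.exp (-(c * 4 ^ (j + 1)))) * (K : ℝ≥0∞) ^ j
      = ENNReal.ofReal (Real.exp (-(c * 4 ^ (j + 1))) * (K : ℝ) ^ j) := fun j => by
    rw [ENNReal.ofReal_mul (by positivity), ENNReal.ofReal_pow (by positivity),
      ENNReal.ofReal_coe_nnreal]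
  simp only [e]
  exact hs2.tsum_ofReal_ne_top

/-- Layer cake formula for a single number. -/
theorem lintegral_rpow_indicator_lt {p : ℝ} (hp : 0 < p) (a : ℝ≥0∞) :
    ∫⁻ t in Ioi (0 : ℝ), (if ENNReal.ofReal t < a then ENNReal.ofReal (p * t ^ (p - 1)) else 0)
      = a ^ p := by
  have hfin : ∀ b : ℝ≥0, ∫⁻ t in Ioi (0 : ℝ),
      (if ENNReal.ofReal t < b then ENNReal.ofReal (p * t ^ (p - 1)) else 0) = (b : ℝ≥0∞) ^ p := by
    intro b
    have h1 : ∀ t ∈ Ioi (0 : ℝ),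
        (if ENNReal.ofReal t < b then ENNReal.ofReal (p * t ^ (p - 1)) else 0)
          = (Iio (b : ℝ)).indicator (fun t => ENNReal.ofReal (p * t ^ (p - 1))) t := by
      intro t ht
      have : ENNReal.ofReal t < b ↔ t < b := by
        rw [← ENNReal.ofReal_coe_nnreal, ENNReal.ofReal_lt_ofReal_iff_of_nonneg (le_of_lt ht)]
      simp only [indicator, mem_Iio, this]
    rw [setLIntegral_congr_fun measurableSet_Ioi h1, lintegral_indicator measurableSet_Iio,
      Measure.restrict_restrict measurableSet_Iio, Iio_inter_Ioi,
      setLIntegral_congr Ioo_ae_eq_Ioc, ← ofReal_integral_eq_lintegral_ofReal]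
    · rw [← intervalIntegral.integral_of_le b.coe_nonneg, intervalIntegral.integral_const_mul,
        integral_rpow (Or.inl (by linarith)), ← ENNReal.ofReal_coe_nnreal,
        ENNReal.ofReal_rpow_of_nonneg b.coe_nonneg hp.le]
      congr 1
      rw [sub_add_cancel, Real.zero_rpow hp.ne']
      field_simp
      simp
    · rw [← IntegrableOn, ← intervalIntegrable_iff_integrableOn_Ioc_of_le b.coe_nonneg]
      exact (intervalIntegral.intervalIntegrable_rpow' (by linarith)).const_mul _
    · filter_upwards [ae_restrict_mem measurableSet_Ioc] with t ht
      have := ht.1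
      positivity
  induction a with
  | coe b => exact hfin b
  | top =>
    rw [ENNReal.top_rpow_of_pos hp]
    refine ENNReal.eq_top_of_forall_nnreal_le fun b => ?_
    have h := hfin (b ^ (1 / p))
    rw [ENNReal.coe_rpow_of_nonneg _ (by positivity), ← ENNReal.rpow_mul,
      one_div_mul_cancel hp.ne', ENNReal.rpow_one] at h
    rw [← h]
    refine lintegral_mono fun t => ?_
    simp only [ENNReal.ofReal_lt_top, if_true]
    split_ifs <;> simp

end Inequalities

/-! ### The measure `dt/t` -/

/-- The measure `dt/t` on `(0, ∞)`. -/
def scaleMeasure : Measure ℝ :=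
  (volume.restrict (Ioi 0)).withDensity fun t => (ENNReal.ofReal t)⁻¹

instance : SFinite scaleMeasure := by unfold scaleMeasure; infer_instance

theorem ae_scaleMeasure_pos : ∀ᵐ t ∂scaleMeasure, 0 < t :=
  (withDensity_absolutelyContinuous _ _).ae_le (ae_restrict_mem measurableSet_Ioi)

theorem lintegral_scaleMeasure (f : ℝ → ℝ≥0∞) :
    ∫⁻ t, f t ∂scaleMeasure = ∫⁻ t in Ioi 0, f t / ENNReal.ofReal t := by
  have hm : Measurable fun t : ℝ => (ENNReal.ofReal t)⁻¹ := by fun_prop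
  unfold scaleMeasure
  rw [lintegral_withDensity_eq_lintegral_mul_non_measurable _ hm]
  · refine lintegral_congr fun t => ?_
    simp [div_eq_mul_inv, mul_comm]
  · filter_upwards [ae_restrict_mem measurableSet_Ioi] with t ht
    simpa using ht

/-- dt/t is the Haar measure of the multiplicative group. This invariance removes the change of
scale from t to at. -/
theorem measurePreserving_mul_scaleMeasure {a : ℝ} (ha : 0 < a) :
    MeasurePreserving (fun t => a * t) scaleMeasure scaleMeasure := by
  refine ⟨by fun_prop, ?_⟩
  ext s hs
  rw [Measure.map_apply (by fun_prop) hs]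
  have key : ∀ u : Set ℝ, MeasurableSet u → scaleMeasure u =
      ∫⁻ t, (Ioi 0 ∩ u).indicator (fun t => (ENNReal.ofReal t)⁻¹) t := fun u hu => by
    rw [scaleMeasure, withDensity_apply _ hu, Measure.restrict_restrict hu,
      lintegral_indicator (measurableSet_Ioi.inter hu), inter_comm]
  rw [key _ (hs.preimage (by fun_prop)), key _ hs]
  conv_rhs => rw [← Real.smul_map_volume_mul_left ha.ne']
  have hmeas : Measurable ((Ioi 0 ∩ s).indicator fun t : ℝ => (ENNReal.ofReal t)⁻¹) :=
    Measurable.indicator (by fun_prop) (measurableSet_Ioi.inter hs)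
  rw [lintegral_smul_measure, lintegral_map hmeas (by fun_prop), smul_eq_mul,
    ← lintegral_const_mul _ (by fun_prop)]
  refine lintegral_congr fun t => ?_
  by_cases h : 0 < t ∧ a * t ∈ s
  · rw [indicator_of_mem (by simpa using h), indicator_of_mem (by simpa [ha] using h),
      ENNReal.ofReal_mul ha.le, abs_of_pos ha, ENNReal.mul_inv (by simp [ha]) (by simp),
      ← mul_assoc, ENNReal.mul_inv_cancel (by simp [ha]) (by simp), one_mul]
  · rw [indicator_of_notMem (by simpa using h), indicator_of_notMem (by simpa [ha] using h),
      mul_zero]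

/-! ### Doubling measures and the maximal function -/

section Doubling

open Metric

variable {X : Type*} [PseudoMetricSpace X] [MeasurableSpace X]

/-- All balls have positive finite measure, and the measure is doubling with constant `D`. -/
structure IsDoubling (μ : Measure X) (D : ℝ≥0∞) : Prop where
  const_ne_top : D ≠ ∞
  ball_ne_zero : ∀ (x : X) (r : ℝ), 0 < r → μ (ball x r) ≠ 0
  ball_ne_top : ∀ (x : X) (r : ℝ), μ (ball x r) ≠ ∞
  ball_two_mul_le : ∀ (x : X) (r : ℝ), 0 < r → μ (ball x (2 * r)) ≤ D * μ (ball x r)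

theorem IsDoubling.ball_two_pow_mul_le {μ : Measure X} {D : ℝ≥0∞} (h : IsDoubling μ D) (x : X)
    {r : ℝ} (hr : 0 < r) (k : ℕ) : μ (ball x (2 ^ k * r)) ≤ D ^ k * μ (ball x r) := by
  induction k with
  | zero => simp
  | succ k ih =>
    calc μ (ball x (2 ^ (k + 1) * r)) = μ (ball x (2 * (2 ^ k * r))) := by ring_nf
      _ ≤ D * μ (ball x (2 ^ k * r)) := h.ball_two_mul_le _ _ (by positivity)
      _ ≤ D * (D ^ k * μ (ball x r)) := by gcongr
      _ = _ := by ring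

theorem IsDoubling.ball_le_of_mem {μ : Measure X} {D : ℝ≥0∞} (h : IsDoubling μ D) {x y : X}
    {r : ℝ} (hxy : y ∈ ball x r) : μ (ball x r) ≤ D * μ (ball y r) := by
  have hr : 0 < r := pos_of_mem_ball hxy
  refine (measure_mono (ball_subset_ball' ?_)).trans (h.ball_two_mul_le y r hr)
  rw [mem_ball'] at hxy
  linarith

theorem IsDoubling.sigmaFinite [SecondCountableTopology X] {μ : Measure X} {D : ℝ≥0∞}
    (h : IsDoubling μ D) : SigmaFinite μ := by
  have : IsLocallyFiniteMeasure μ :=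
    ⟨fun x => ⟨ball x 1, ball_mem_nhds x one_pos, (h.ball_ne_top x 1).lt_top⟩⟩
  infer_instance

/-- The average of `f` over a ball. -/
def ballAvg (μ : Measure X) (f : X → ℝ≥0∞) (c : X) (r : ℝ) : ℝ≥0∞ :=
  (∫⁻ y in ball c r, f y ∂μ) / μ (ball c r)

theorem ballAvg_mul_measure {μ : Measure X} {D : ℝ≥0∞} (h : IsDoubling μ D) (f : X → ℝ≥0∞) (c : X)
    {r : ℝ} (hr : 0 < r) : ballAvg μ f c r * μ (ball c r) = ∫⁻ y in ball c r, f y ∂μ :=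
  ENNReal.div_mul_cancel (h.ball_ne_zero c r hr) (h.ball_ne_top c r)

theorem ballAvg_mono {μ : Measure X} {f g : X → ℝ≥0∞} (h : ∀ x, f x ≤ g x) (c : X) (r : ℝ) :
    ballAvg μ f c r ≤ ballAvg μ g c r := by
  unfold ballAvg
  gcongr
  exact h _

theorem ballAvg_const_mul {μ : Measure X} {f : X → ℝ≥0∞} (hf : Measurable f) (a : ℝ≥0∞) (c : X)
    (r : ℝ) : ballAvg μ (fun x => a * f x) c r = a * ballAvg μ f c r := by
  unfold ballAvg
  rw [lintegral_const_mul _ hf, mul_div_assoc]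

/-- The uncentered Hardy–Littlewood maximal function. -/
def maxFn (μ : Measure X) (f : X → ℝ≥0∞) (x : X) : ℝ≥0∞ :=
  ⨆ (c : X) (r : ℝ) (_ : x ∈ ball c r), ballAvg μ f c r

theorem ballAvg_le_maxFn (μ : Measure X) (f : X → ℝ≥0∞) {x c : X} {r : ℝ} (hx : x ∈ ball c r) :
    ballAvg μ f c r ≤ maxFn μ f x :=
  le_iSup_of_le c (le_iSup_of_le r (le_iSup_of_le hx le_rfl))

theorem maxFn_le {μ : Measure X} {f : X → ℝ≥0∞} {x : X} {a : ℝ≥0∞}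
    (h : ∀ c r, x ∈ ball c r → ballAvg μ f c r ≤ a) : maxFn μ f x ≤ a :=
  iSup_le fun c => iSup_le fun r => iSup_le fun hx => h c r hx

theorem lt_maxFn_iff {μ : Measure X} {f : X → ℝ≥0∞} {x : X} {a : ℝ≥0∞} :
    a < maxFn μ f x ↔ ∃ c r, x ∈ ball c r ∧ a < ballAvg μ f c r := by
  simp [maxFn, lt_iSup_iff]

theorem setLIntegral_mul_maxFn_ge {μ : Measure X} (f : X → ℝ≥0∞) {x c : X} {r : ℝ}
    {D : ℝ≥0∞} (h : IsDoubling μ D) (hx : x ∈ ball c r) :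
    ∫⁻ y in ball c r, f y ∂μ ≤ maxFn μ f x * μ (ball c r) := by
  rw [← ballAvg_mul_measure h f c (pos_of_mem_ball hx)]
  gcongr
  exact ballAvg_le_maxFn μ f hx

theorem maxFn_le_add_const {μ : Measure X} {D : ℝ≥0∞} (h : IsDoubling μ D) {f g : X → ℝ≥0∞}
    {a : ℝ≥0∞} (hfg : ∀ x, f x ≤ g x + a) (x : X) : maxFn μ f x ≤ maxFn μ g x + a := by
  refine maxFn_le fun c r hx => ?_
  have hr := pos_of_mem_ball hx
  calc ballAvg μ f c r ≤ ballAvg μ (fun x => g x + a) c r := ballAvg_mono hfg c r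
    _ = ballAvg μ g c r + a := by
      unfold ballAvg
      rw [lintegral_add_right _ measurable_const, setLIntegral_const, ENNReal.add_div,
        ENNReal.mul_div_cancel_right (h.ball_ne_zero c r hr) (h.ball_ne_top c r)]
    _ ≤ _ := by
      gcongr
      exact ballAvg_le_maxFn μ g hx

/-- Countable sublinearity, needed for the series in the Rubio de Francia iteration. -/
theorem maxFn_tsum_le {μ : Measure X} (a : ℕ → ℝ≥0∞) {f : ℕ → X → ℝ≥0∞}
    (hf : ∀ i, Measurable (f i)) (x : X) :
    maxFn μ (fun y => ∑' i, a i * f i y) x ≤ ∑' i, a i * maxFn μ (f i) x := by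
  refine maxFn_le fun c r hx => ?_
  unfold ballAvg
  rw [lintegral_tsum fun i => ((hf i).const_mul _).aemeasurable, div_eq_mul_inv,
    ← ENNReal.tsum_mul_right]
  refine ENNReal.tsum_le_tsum fun i => ?_
  rw [lintegral_const_mul _ (hf i), mul_assoc, ← div_eq_mul_inv]
  gcongr
  exact ballAvg_le_maxFn μ (f i) hx

variable [BorelSpace X]

/-- The balls are uncentered and open, so superlevel sets are unions of balls, hence open. Nothing
is asked of f. -/
theorem measurable_maxFn (μ : Measure X) (f : X → ℝ≥0∞) : Measurable (maxFn μ f) := by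
  refine measurable_of_Ioi fun a => IsOpen.measurableSet ?_
  have : maxFn μ f ⁻¹' Ioi a = ⋃ (c : X) (r : ℝ) (_ : a < ballAvg μ f c r), ball c r := by
    ext x
    simp only [mem_preimage, mem_Ioi, lt_maxFn_iff, mem_iUnion, exists_prop]
    exact ⟨fun ⟨c, r, h1, h2⟩ => ⟨c, r, h2, h1⟩, fun ⟨c, r, h1, h2⟩ => ⟨c, r, h2, h1⟩⟩
  rw [this]
  exact isOpen_iUnion fun c => isOpen_iUnion fun r => isOpen_iUnion fun _ => isOpen_ball

/-! ### Boundedness of the maximal function -/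

variable [SecondCountableTopology X]

/-- The maximal function is of weak type `(1, 1)`. -/
theorem mul_measure_lt_maxFn_le {μ : Measure X} {D : ℝ≥0∞} (h : IsDoubling μ D)
    (f : X → ℝ≥0∞) (a : ℝ≥0∞) :
    a * μ {x | a < maxFn μ f x} ≤ D ^ 3 * ∫⁻ x, f x ∂μ := by
  -- The Vitali covering lemma needs bounded radii, so radii are capped at N and N tends to infinity
  -- by continuity from below.
  let t : ℕ → Set (X × ℝ) := fun N => {z | 0 < z.2 ∧ z.2 ≤ N ∧ a < ballAvg μ f z.1 z.2}
  let U : ℕ → Set X := fun N => ⋃ z ∈ t N, ball z.1 z.2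
  have hUmono : Monotone U := fun i j hij =>
    biUnion_subset_biUnion_left fun z hz => ⟨hz.1, hz.2.1.trans (by exact_mod_cast hij), hz.2.2⟩
  have hU : {x | a < maxFn μ f x} = ⋃ N, U N := by
    ext x
    simp only [mem_ofPred_eq, lt_maxFn_iff, mem_iUnion, U, t, exists_prop, Prod.exists]
    constructor
    · rintro ⟨c, r, hx, hr⟩
      obtain ⟨N, hN⟩ := exists_nat_ge r
      exact ⟨N, c, r, ⟨pos_of_mem_ball hx, hN, hr⟩, hx⟩
    · rintro ⟨N, c, r, ⟨_, _, hr⟩, hx⟩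
      exact ⟨c, r, hx, hr⟩
  rw [hU, hUmono.measure_iUnion, ENNReal.mul_iSup]
  refine iSup_le fun N => ?_
  obtain ⟨u, hut, hdisj, hcov⟩ := Vitali.exists_disjoint_subfamily_covering_enlargement_closedBall
    (t N) (fun z => z.1) (fun z => z.2) N (fun z hz => hz.2.1) 5 (by norm_num)
  have hdisj' : u.PairwiseDisjoint fun z => ball z.1 z.2 :=
    hdisj.mono_on fun z _ => ball_subset_closedBall
  have hcount : u.Countable := hdisj'.countable_of_isOpen (fun z _ => isOpen_ball)
    fun z hz => nonempty_ball.2 (hut hz).1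
  -- The Vitali enlargement factor 5 is rounded up to 2³, so three doublings suffice.
  have hsub : U N ⊆ ⋃ z ∈ u, ball z.1 (2 ^ 3 * z.2) := by
    refine iUnion₂_subset fun z hz => ?_
    obtain ⟨b, hb, hzb⟩ := hcov z hz
    have hb0 := (hut hb).1
    refine (ball_subset_closedBall.trans hzb).trans
      ((closedBall_subset_ball ?_).trans
        (subset_biUnion_of_mem (u := fun z : X × ℝ => ball z.1 (2 ^ 3 * z.2)) hb))
    show 5 * b.2 < 2 ^ 3 * b.2
    linarith
  have := hcount.to_subtype
  calc a * μ (U N) ≤ a * ∑' z : u, μ (ball z.1.1 (2 ^ 3 * z.1.2)) := by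
        gcongr
        exact (measure_mono hsub).trans (measure_biUnion_le μ hcount _)
    _ = ∑' z : u, a * μ (ball z.1.1 (2 ^ 3 * z.1.2)) := ENNReal.tsum_mul_left.symm
    _ ≤ ∑' z : u, D ^ 3 * ∫⁻ y in ball z.1.1 z.1.2, f y ∂μ := by
        refine ENNReal.tsum_le_tsum fun z => ?_
        have hz := hut z.2
        calc a * μ (ball z.1.1 (2 ^ 3 * z.1.2)) ≤ a * (D ^ 3 * μ (ball z.1.1 z.1.2)) := by
              gcongr
              exact h.ball_two_pow_mul_le _ hz.1 3
          _ = D ^ 3 * (a * μ (ball z.1.1 z.1.2)) := by ring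
          _ ≤ D ^ 3 * (ballAvg μ f z.1.1 z.1.2 * μ (ball z.1.1 z.1.2)) := by
              gcongr
              exact hz.2.2.le
          _ = _ := by rw [ballAvg_mul_measure h f _ hz.1]
    _ = D ^ 3 * ∫⁻ y in ⋃ z ∈ u, ball z.1 z.2, f y ∂μ := by
        rw [ENNReal.tsum_mul_left, lintegral_biUnion hcount (fun z _ => measurableSet_ball) hdisj']
    _ ≤ D ^ 3 * ∫⁻ y, f y ∂μ := by
        gcongr
        exact Measure.restrict_le_self

/-- The Hardy–Littlewood maximal theorem for doubling measures. -/
theorem lintegral_maxFn_rpow_le {μ : Measure X} {D : ℝ≥0∞} (h : IsDoubling μ D) {p : ℝ}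
    (hp : 1 < p) : ∃ K : ℝ≥0∞, K ≠ ∞ ∧ ∀ f : X → ℝ≥0∞, Measurable f →
      ∫⁻ x, maxFn μ f x ^ p ∂μ ≤ K * ∫⁻ x, f x ^ p ∂μ := by
  have := h.sigmaFinite
  have hp0 : 0 < p := by linarith
  have hp1 : 0 < p - 1 := by linarith
  refine ⟨2 * D ^ 3 * ENNReal.ofReal (p / (p - 1)) * 2 ^ (p - 1), ?_, fun f hf => ?_⟩
  · have := h.const_ne_top
    refine ENNReal.mul_ne_top (ENNReal.mul_ne_top (ENNReal.mul_ne_top (by simp) (by simp [this]))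
      (by simp)) (ENNReal.rpow_ne_top_of_nonneg hp1.le (by simp))
  have hM := measurable_maxFn μ f
  -- truncation of `f` at height `t / 2`
  let F : ℝ → X → ℝ≥0∞ := fun t x => if ENNReal.ofReal t < 2 * f x then f x else 0
  -- Since f ≤ F t + t/2, the set where Mf > t lies in the set where M(F t) > t/2. The weak type
  -- bound at height t/2 yields the factor 2.
  have hF : ∀ t, 0 < t → ENNReal.ofReal t * μ {x | ENNReal.ofReal t < maxFn μ f x}
      ≤ 2 * D ^ 3 * ∫⁻ x, F t x ∂μ := by
    intro t ht
    have h2 : ENNReal.ofReal t = 2 * ENNReal.ofReal (t / 2) := by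
      rw [← ENNReal.ofReal_ofNat, ← ENNReal.ofReal_mul (by norm_num)]
      congr 1
      ring
    have hsub : {x | ENNReal.ofReal t < maxFn μ f x}
        ⊆ {x | ENNReal.ofReal (t / 2) < maxFn μ (F t) x} := by
      intro x hx
      simp only [mem_ofPred_eq] at hx ⊢
      have hle := maxFn_le_add_const h (f := f) (g := F t) (a := ENNReal.ofReal (t / 2)) (by
        intro y
        by_cases hy : ENNReal.ofReal t < 2 * f y
        · simp [F, hy]
        · simp only [F, hy, if_false, zero_add]
          rw [not_lt, h2] at hy
          exact (ENNReal.mul_le_mul_iff_right (by simp) (by simp)).1 hy) x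
      by_contra hc
      rw [not_lt] at hc
      refine absurd (hx.trans_le hle) (not_lt.2 ?_)
      rw [h2, two_mul]
      gcongr
    calc _ ≤ ENNReal.ofReal t * μ {x | ENNReal.ofReal (t / 2) < maxFn μ (F t) x} := by gcongr
      _ = 2 * (ENNReal.ofReal (t / 2) * μ {x | ENNReal.ofReal (t / 2) < maxFn μ (F t) x}) := by
        rw [h2]; ring
      _ ≤ 2 * (D ^ 3 * ∫⁻ x, F t x ∂μ) := by
        exact mul_le_mul' le_rfl (mul_measure_lt_maxFn_le h (F t) _)
      _ = _ := by ring
  calc ∫⁻ x, maxFn μ f x ^ p ∂μ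
      = ∫⁻ x, (∫⁻ t in Ioi (0 : ℝ), (if ENNReal.ofReal t < maxFn μ f x then
          ENNReal.ofReal (p * t ^ (p - 1)) else 0)) ∂μ := by
        simp only [lintegral_rpow_indicator_lt hp0]
    _ = ∫⁻ t in Ioi (0 : ℝ), ∫⁻ x, (if ENNReal.ofReal t < maxFn μ f x then
          ENNReal.ofReal (p * t ^ (p - 1)) else 0) ∂μ := by
        refine lintegral_lintegral_swap (Measurable.aemeasurable ?_)
        refine Measurable.ite (measurableSet_lt (by fun_prop) (by fun_prop)) (by fun_prop)
          measurable_const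
    _ ≤ ∫⁻ t in Ioi (0 : ℝ), ∫⁻ x, 2 * D ^ 3 * ENNReal.ofReal (p / (p - 1)) *
          (f x * if ENNReal.ofReal t < 2 * f x then
            ENNReal.ofReal ((p - 1) * t ^ (p - 1 - 1)) else 0) ∂μ := by
        refine setLIntegral_mono' measurableSet_Ioi fun t ht => ?_
        have ht : 0 < t := ht
        have e1 : ∫⁻ x, (if ENNReal.ofReal t < maxFn μ f x then
            ENNReal.ofReal (p * t ^ (p - 1)) else 0) ∂μ
            = ENNReal.ofReal (p * t ^ (p - 1)) * μ {x | ENNReal.ofReal t < maxFn μ f x} := by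
          rw [← lintegral_indicator_const (measurableSet_lt measurable_const hM)]
          refine lintegral_congr fun x => ?_
          simp [indicator]
        -- One factor t is set aside for the weak type bound. The remaining density (p-1)t^{p-2}
        -- integrates over t < 2f to (2f)^{p-1}, by the layer cake formula with exponent p-1.
        have e2 : ENNReal.ofReal (p * t ^ (p - 1))
            = ENNReal.ofReal (p / (p - 1)) * ENNReal.ofReal ((p - 1) * t ^ (p - 1 - 1))
              * ENNReal.ofReal t := by
          rw [← ENNReal.ofReal_mul (by positivity), ← ENNReal.ofReal_mul (by positivity)]
          congr 1
          rw [Real.rpow_sub_one ht.ne' (p - 1)]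
          field_simp
        have e3 : ∀ x, (f x * if ENNReal.ofReal t < 2 * f x then
            ENNReal.ofReal ((p - 1) * t ^ (p - 1 - 1)) else 0)
            = ENNReal.ofReal ((p - 1) * t ^ (p - 1 - 1)) * F t x := fun x => by
          by_cases hx : ENNReal.ofReal t < 2 * f x <;> simp [F, mul_comm]
        have hFm : Measurable (F t) :=
          Measurable.ite (measurableSet_lt measurable_const (by fun_prop)) hf measurable_const
        simp only [e3]
        rw [e1, e2, lintegral_const_mul _ (hFm.const_mul _), lintegral_const_mul _ hFm, mul_assoc]
        calc _ ≤ ENNReal.ofReal (p / (p - 1)) * ENNReal.ofReal ((p - 1) * t ^ (p - 1 - 1))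
              * (2 * D ^ 3 * ∫⁻ x, F t x ∂μ) := mul_le_mul' le_rfl (hF t ht)
          _ = _ := by ring
    _ = ∫⁻ x, (∫⁻ t in Ioi (0 : ℝ), 2 * D ^ 3 * ENNReal.ofReal (p / (p - 1)) *
          (f x * if ENNReal.ofReal t < 2 * f x then
            ENNReal.ofReal ((p - 1) * t ^ (p - 1 - 1)) else 0)) ∂μ := by
        refine lintegral_lintegral_swap (Measurable.aemeasurable ?_)
        refine Measurable.const_mul (Measurable.mul (by fun_prop) ?_) _
        exact Measurable.ite (measurableSet_lt (by fun_prop) (by fun_prop)) (by fun_prop)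
          measurable_const
    _ = ∫⁻ x, 2 * D ^ 3 * ENNReal.ofReal (p / (p - 1)) * 2 ^ (p - 1) * f x ^ p ∂μ := by
        refine lintegral_congr fun x => ?_
        have hm : Measurable fun t : ℝ => if ENNReal.ofReal t < 2 * f x then
            ENNReal.ofReal ((p - 1) * t ^ (p - 1 - 1)) else 0 :=
          Measurable.ite (measurableSet_lt (by fun_prop) (by fun_prop)) (by fun_prop)
            measurable_const
        rw [lintegral_const_mul _ (hm.const_mul _), lintegral_const_mul _ hm,
          lintegral_rpow_indicator_lt hp1, ENNReal.mul_rpow_of_nonneg _ _ hp1.le]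
        have := ENNReal.rpow_add_of_nonneg (x := f x) 1 (p - 1) zero_le_one hp1.le
        rw [add_sub_cancel, ENNReal.rpow_one] at this
        rw [this]
        ring
    _ = _ := lintegral_const_mul _ (by fun_prop)

end Doubling

/-! ### Muckenhoupt weights -/

section Weights

open Metric

variable {X : Type*} [MeasurableSpace X]

/-- A measurable function with values in `(0, ∞)`. -/
structure IsPosFinite (v : X → ℝ≥0∞) : Prop where
  measurable : Measurable v
  ne_zero : ∀ x, v x ≠ 0
  ne_top : ∀ x, v x ≠ ∞

theorem IsPosFinite.rpow {v : X → ℝ≥0∞} (hv : IsPosFinite v) (s : ℝ) :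
    IsPosFinite fun x => v x ^ s where
  measurable := hv.measurable.pow_const s
  ne_zero x := by simp [hv.ne_zero, hv.ne_top]
  ne_top x := by simp [hv.ne_zero, hv.ne_top]

theorem IsPosFinite.rpow_add {v : X → ℝ≥0∞} (hv : IsPosFinite v) (x : X) (s t : ℝ) :
    v x ^ (s + t) = v x ^ s * v x ^ t :=
  ENNReal.rpow_add _ _ (hv.ne_zero x) (hv.ne_top x)

theorem lintegral_withDensity_mul {μ : Measure X} {v g : X → ℝ≥0∞} (hv : Measurable v)
    (hg : Measurable g) : ∫⁻ x, g x ∂(μ.withDensity v) = ∫⁻ x, g x * v x ∂μ := by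
  rw [lintegral_withDensity_eq_lintegral_mul μ hv hg]
  simp [mul_comm]

theorem setLIntegral_withDensity_mul {μ : Measure X} {v g : X → ℝ≥0∞} (hv : Measurable v)
    (hg : Measurable g) {s : Set X} (hs : MeasurableSet s) :
    ∫⁻ x in s, g x ∂(μ.withDensity v) = ∫⁻ x in s, g x * v x ∂μ := by
  rw [restrict_withDensity hs, lintegral_withDensity_mul hv hg]

theorem IsPosFinite.ae_withDensity_iff {μ : Measure X} {v : X → ℝ≥0∞} (hv : IsPosFinite v)
    {p : X → Prop} : (∀ᵐ x ∂(μ.withDensity v), p x) ↔ ∀ᵐ x ∂μ, p x := by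
  rw [MeasureTheory.ae_withDensity_iff hv.measurable]
  simp [hv.ne_zero]

variable [PseudoMetricSpace X]

/-- The `A_P(μ)` condition with constant `C`, `1 < P < ∞`. -/
def ApBound (μ : Measure X) (P : ℝ) (C : ℝ≥0∞) (v : X → ℝ≥0∞) : Prop :=
  ∀ (x : X) (r : ℝ), 0 < r →
    (∫⁻ y in ball x r, v y ∂μ) * (∫⁻ y in ball x r, v y ^ (-(1 / (P - 1))) ∂μ) ^ (P - 1)
      ≤ C * μ (ball x r) ^ P

/-- With σ = v^{1-P'}, this is the A_P inequality raised to the power 1/(P-1) = P'-1; the two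
integrals exchange roles. -/
theorem ApBound.dual {μ : Measure X} {P : ℝ} {C : ℝ≥0∞} {v : X → ℝ≥0∞} (hP : 1 < P)
    (h : ApBound μ P C v) :
    ApBound μ (P / (P - 1)) (C ^ (1 / (P - 1))) fun x => v x ^ (-(1 / (P - 1))) := by
  intro x r hr
  have hP1 : 0 < P - 1 := by linarith
  have e1 : P / (P - 1) - 1 = 1 / (P - 1) := by field_simp; ring
  have e2 : ∀ y, (v y ^ (-(1 / (P - 1)))) ^ (-(1 / (1 / (P - 1)))) = v y := fun y => by
    rw [← ENNReal.rpow_mul, show -(1 / (P - 1)) * -(1 / (1 / (P - 1))) = 1 by field_simp,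
      ENNReal.rpow_one]
  simp only [e1, e2]
  have := ENNReal.rpow_le_rpow (h x r hr) (z := 1 / (P - 1)) (by positivity)
  rw [ENNReal.mul_rpow_of_nonneg _ _ (by positivity), ENNReal.mul_rpow_of_nonneg _ _ (by positivity),
    ← ENNReal.rpow_mul, ← ENNReal.rpow_mul, mul_one_div_cancel hP1.ne', ENNReal.rpow_one,
    mul_one_div] at this
  rw [mul_comm]
  exact this

variable {μ : Measure X} {D : ℝ≥0∞}

/-- Hölder applied to 1 = v^{1/P} σ^{1/P'} on E, with σ = v^{-1/(P-1)}, after which the A_P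
condition absorbs the σ-integral. Taking for E a concentric ball of half the radius gives doubling
of v dμ. -/
theorem ApBound.measure_rpow_mul_le {P : ℝ} {C : ℝ≥0∞} {v : X → ℝ≥0∞} (hv : IsPosFinite v)
    (hP : 1 < P) (h : ApBound μ P C v) {x : X} {r : ℝ} (hr : 0 < r) {E : Set X}
    (hE : E ⊆ ball x r) :
    μ E ^ P * ∫⁻ y in ball x r, v y ∂μ ≤ C * μ (ball x r) ^ P * ∫⁻ y in E, v y ∂μ := by
  have hP0 : 0 < P := by linarith
  have hP1 : 0 < P - 1 := by linarith
  have e : ∀ y, v y ^ (1 / P) * (v y ^ (-(1 / (P - 1)))) ^ (1 - 1 / P) = 1 := fun y => by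
    rw [← ENNReal.rpow_mul, ← hv.rpow_add, show 1 / P + -(1 / (P - 1)) * (1 - 1 / P) = 0 by
      field_simp; ring, ENNReal.rpow_zero]
  have h1 := ENNReal.lintegral_mul_norm_pow_le (μ := μ.restrict E) (f := v)
    (g := fun y => v y ^ (-(1 / (P - 1)))) hv.measurable.aemeasurable
    (hv.measurable.pow_const _).aemeasurable (p := 1 / P) (q := 1 - 1 / P) (by positivity)
    (by rw [sub_nonneg, div_le_one hP0]; exact hP.le) (by ring)
  simp only [e, lintegral_one, Measure.restrict_apply_univ] at h1
  have h2 : μ E ^ P ≤ (∫⁻ y in E, v y ∂μ) * (∫⁻ y in E, v y ^ (-(1 / (P - 1))) ∂μ) ^ (P - 1) := by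
    refine (ENNReal.rpow_le_rpow h1 hP0.le).trans_eq ?_
    rw [ENNReal.mul_rpow_of_nonneg _ _ hP0.le, ← ENNReal.rpow_mul, ← ENNReal.rpow_mul,
      one_div_mul_cancel hP0.ne', ENNReal.rpow_one, show (1 - 1 / P) * P = P - 1 by field_simp]
  calc μ E ^ P * ∫⁻ y in ball x r, v y ∂μ
      ≤ ((∫⁻ y in E, v y ∂μ) * (∫⁻ y in ball x r, v y ^ (-(1 / (P - 1))) ∂μ) ^ (P - 1)) *
          ∫⁻ y in ball x r, v y ∂μ := by
        gcongr
        refine h2.trans ?_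
        gcongr
    _ = (∫⁻ y in E, v y ∂μ) * ((∫⁻ y in ball x r, v y ∂μ) *
          (∫⁻ y in ball x r, v y ^ (-(1 / (P - 1))) ∂μ) ^ (P - 1)) := by ring
    _ ≤ (∫⁻ y in E, v y ∂μ) * (C * μ (ball x r) ^ P) := by
        exact mul_le_mul' le_rfl (h x r hr)
    _ = _ := by ring

/-! ### Measures with an A_P density -/

variable [BorelSpace X]

theorem IsDoubling.setLIntegral_ne_zero (h : IsDoubling μ D) {v : X → ℝ≥0∞} (hv : IsPosFinite v)
    (x : X) {r : ℝ} (hr : 0 < r) : ∫⁻ y in ball x r, v y ∂μ ≠ 0 := by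
  rw [← withDensity_apply _ measurableSet_ball]
  intro h0
  refine h.ball_ne_zero x r hr ?_
  rw [withDensity_apply_eq_zero hv.measurable] at h0
  simpa [hv.ne_zero] using h0

/-- The σ-integral over a ball is positive, so an infinite integral of v would make the left side of
the A_P inequality infinite. -/
theorem ApBound.setLIntegral_ne_top {P : ℝ} {C : ℝ≥0∞} {v : X → ℝ≥0∞} (hμ : IsDoubling μ D)
    (hv : IsPosFinite v) (hP : 1 < P) (hC : C ≠ ∞) (h : ApBound μ P C v) (x : X) (r : ℝ) :
    ∫⁻ y in ball x r, v y ∂μ ≠ ∞ := by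
  rcases le_or_gt r 0 with hr | hr
  · simp [ball_eq_empty.2 hr]
  intro htop
  have := h x r hr
  rw [htop, ENNReal.top_mul, top_le_iff] at this
  · exact ENNReal.mul_ne_top hC
      (ENNReal.rpow_ne_top_of_nonneg (by linarith) (hμ.ball_ne_top x r)) this
  · have := hμ.setLIntegral_ne_zero (hv.rpow (-(1 / (P - 1)))) x hr
    intro h0
    rw [ENNReal.rpow_eq_zero_iff] at h0
    rcases h0 with h0 | h0
    · exact this h0.1
    · linarith [h0.2]

theorem ApBound.isDoubling {P : ℝ} {C : ℝ≥0∞} {v : X → ℝ≥0∞} (hμ : IsDoubling μ D)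
    (hv : IsPosFinite v) (hP : 1 < P) (hC : C ≠ ∞) (h : ApBound μ P C v) :
    IsDoubling (μ.withDensity v) (C * D ^ P) where
  const_ne_top :=
    ENNReal.mul_ne_top hC (ENNReal.rpow_ne_top_of_nonneg (by linarith) hμ.const_ne_top)
  ball_ne_zero x r hr := by
    rw [withDensity_apply _ measurableSet_ball]
    exact hμ.setLIntegral_ne_zero hv x hr
  ball_ne_top x r := by
    rw [withDensity_apply _ measurableSet_ball]
    exact h.setLIntegral_ne_top hμ hv hP hC x r
  ball_two_mul_le x r hr := by
    rw [withDensity_apply _ measurableSet_ball, withDensity_apply _ measurableSet_ball]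
    have h1 := h.measure_rpow_mul_le hv hP (x := x) (r := 2 * r) (by positivity)
      (ball_subset_ball (show r ≤ 2 * r by linarith))
    have h0 : μ (ball x r) ^ P ≠ 0 := by
      have := hμ.ball_ne_zero x r hr
      have := hμ.ball_ne_top x r
      simp [*]
    have ht : μ (ball x r) ^ P ≠ ∞ :=
      ENNReal.rpow_ne_top_of_nonneg (by linarith) (hμ.ball_ne_top x r)
    rw [← ENNReal.mul_le_mul_iff_right h0 ht]
    calc _ ≤ _ := h1
      _ ≤ C * (D * μ (ball x r)) ^ P * ∫⁻ y in ball x r, v y ∂μ := by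
        have := ENNReal.rpow_le_rpow (hμ.ball_two_mul_le x r hr) (z := P) (by linarith)
        gcongr
      _ = _ := by
        rw [ENNReal.mul_rpow_of_nonneg _ _ (by linarith)]
        ring

variable [SecondCountableTopology X]

/-- Muckenhoupt's theorem for a doubling measure. -/
theorem ApBound.lintegral_maxFn_rpow_mul_le {P : ℝ} {C : ℝ≥0∞} {v : X → ℝ≥0∞}
    (hμ : IsDoubling μ D) (hv : IsPosFinite v) (hP : 1 < P) (hC : C ≠ ∞) (h : ApBound μ P C v) :
    ∃ K : ℝ≥0∞, K ≠ ∞ ∧ ∀ f : X → ℝ≥0∞, Measurable f →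
      ∫⁻ x, maxFn μ f x ^ P * v x ∂μ ≤ K * ∫⁻ x, f x ^ P * v x ∂μ := by
  have hP0 : 0 < P := by linarith
  have hP1 : 0 < P - 1 := by linarith
  set Q := P / (P - 1) with hQ
  have hQ1 : 1 < Q := by rw [hQ, one_lt_div hP1]; linarith
  have hσ := hv.rpow (-(1 / (P - 1)))
  set ν := μ.withDensity v with hν
  set σ := μ.withDensity fun x => v x ^ (-(1 / (P - 1))) with hσdef
  have hνd : IsDoubling ν _ := h.isDoubling hμ hv hP hC
  have hσd : IsDoubling σ _ := (h.dual hP).isDoubling hμ hσ hQ1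
    (ENNReal.rpow_ne_top_of_nonneg (by positivity) hC)
  obtain ⟨K₁, hK₁, H₁⟩ := lintegral_maxFn_rpow_le hνd hQ1
  obtain ⟨K₂, hK₂, H₂⟩ := lintegral_maxFn_rpow_le hσd hP
  refine ⟨C ^ Q * K₁ * K₂, ENNReal.mul_ne_top (ENNReal.mul_ne_top
    (ENNReal.rpow_ne_top_of_nonneg (by linarith) hC) hK₁) hK₂, fun f hf => ?_⟩
  -- Lerner's argument: M_μ f is dominated by a composition of M_σ and M_ν, which are bounded on
  -- their own unweighted spaces because σ and ν are doubling. The function inside M_σ is f divided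
  -- by the density of σ.
  let G : X → ℝ≥0∞ := maxFn σ fun x => f x * v x ^ (1 / (P - 1))
  have hGm : Measurable G := measurable_maxFn _ _
  let ψ : X → ℝ≥0∞ := fun x => G x ^ (P - 1) * v x ^ (-1 : ℝ)
  have hψm : Measurable ψ := (hGm.pow_const _).mul (hv.measurable.pow_const _)
  have hfv : Measurable fun x => f x * v x ^ (1 / (P - 1)) :=
    hf.mul (hv.measurable.pow_const _)
  -- For a ball B containing x and every y in B, ∫_B f dμ ≤ σ(B) G(y). Raise this to the power P-1
  -- and integrate in y over B: ∫_B G^{P-1} dμ = ∫_B ψ dν is ν(B) times an average of ψ, and A_P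
  -- controls ν(B) σ(B)^{P-1}.
  have hpt : ∀ x, maxFn μ f x ^ (P - 1) ≤ C * maxFn ν ψ x := by
    intro x
    have hroot : ∀ a b : ℝ≥0∞, a ≤ b ^ (1 / (P - 1)) ↔ a ^ (P - 1) ≤ b := fun a b => by
      rw [one_div, ENNReal.le_rpow_inv_iff hP1]
    rw [← hroot]
    refine maxFn_le fun c r hx => ?_
    rw [hroot]
    have hr := pos_of_mem_ball hx
    have e1 : ∫⁻ y in ball c r, f y ∂μ = ∫⁻ y in ball c r, f y * v y ^ (1 / (P - 1)) ∂σ := by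
      rw [hσdef, setLIntegral_withDensity_mul hσ.measurable hfv measurableSet_ball]
      refine lintegral_congr fun y => ?_
      rw [mul_assoc, ← hv.rpow_add, add_neg_cancel, ENNReal.rpow_zero, mul_one]
    have e2 : (∫⁻ y in ball c r, f y ∂μ) ^ (P - 1) * μ (ball c r)
        ≤ σ (ball c r) ^ (P - 1) * ∫⁻ y in ball c r, G y ^ (P - 1) ∂μ := by
      rw [← setLIntegral_const, ← lintegral_const_mul _ (hGm.pow_const _)]
      refine setLIntegral_mono' measurableSet_ball fun y hy => ?_
      rw [← ENNReal.mul_rpow_of_nonneg _ _ hP1.le, e1, mul_comm]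
      gcongr
      exact setLIntegral_mul_maxFn_ge _ hσd hy
    have e3 : ∫⁻ y in ball c r, G y ^ (P - 1) ∂μ = ballAvg ν ψ c r * ν (ball c r) := by
      rw [ballAvg_mul_measure hνd _ _ hr, hν,
        setLIntegral_withDensity_mul hv.measurable hψm measurableSet_ball]
      refine lintegral_congr fun y => ?_
      have := hv.rpow_add y (-1) 1
      rw [neg_add_cancel, ENNReal.rpow_zero, ENNReal.rpow_one] at this
      rw [mul_assoc, ← this, mul_one]
    have hB0 := hμ.ball_ne_zero c r hr
    have hBt := hμ.ball_ne_top c r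
    have hBP0 : μ (ball c r) ^ P ≠ 0 := by simp [hB0, hBt]
    have hBPt : μ (ball c r) ^ P ≠ ∞ := ENNReal.rpow_ne_top_of_nonneg hP0.le hBt
    rw [← ENNReal.mul_le_mul_iff_left hBP0 hBPt]
    calc ballAvg μ f c r ^ (P - 1) * μ (ball c r) ^ P
        = (ballAvg μ f c r * μ (ball c r)) ^ (P - 1) * μ (ball c r) := by
          rw [ENNReal.mul_rpow_of_nonneg _ _ hP1.le, mul_assoc]
          congr 1
          conv_rhs => rw [← ENNReal.rpow_one (μ (ball c r)), ← ENNReal.rpow_mul,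
            ← ENNReal.rpow_add _ _ hB0 hBt]
          congr 1
          ring
      _ = (∫⁻ y in ball c r, f y ∂μ) ^ (P - 1) * μ (ball c r) := by
          rw [ballAvg_mul_measure hμ _ _ hr]
      _ ≤ σ (ball c r) ^ (P - 1) * (ballAvg ν ψ c r * ν (ball c r)) := by
          rw [← e3]
          exact e2
      _ = ballAvg ν ψ c r * (ν (ball c r) * σ (ball c r) ^ (P - 1)) := by ring
      _ ≤ maxFn ν ψ x * (C * μ (ball c r) ^ P) := by
          refine mul_le_mul' (ballAvg_le_maxFn _ _ hx) ?_
          rw [hν, hσdef, withDensity_apply _ measurableSet_ball,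
            withDensity_apply _ measurableSet_ball]
          exact h c r hr
      _ = _ := by ring
  have hPQ : (P - 1) * Q = P := by rw [hQ]; field_simp
  calc ∫⁻ x, maxFn μ f x ^ P * v x ∂μ = ∫⁻ x, maxFn μ f x ^ P ∂ν := by
        rw [hν, lintegral_withDensity_mul hv.measurable ((measurable_maxFn _ _).pow_const _)]
    _ ≤ ∫⁻ x, C ^ Q * maxFn ν ψ x ^ Q ∂ν := by
        refine lintegral_mono fun x => ?_
        rw [← ENNReal.mul_rpow_of_nonneg _ _ (by linarith), ← hPQ, ENNReal.rpow_mul]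
        gcongr
        exact hpt x
    _ = C ^ Q * ∫⁻ x, maxFn ν ψ x ^ Q ∂ν :=
        lintegral_const_mul _ ((measurable_maxFn _ _).pow_const _)
    _ ≤ C ^ Q * (K₁ * ∫⁻ x, ψ x ^ Q ∂ν) := by
        gcongr
        exact H₁ ψ hψm
    _ = C ^ Q * (K₁ * ∫⁻ x, G x ^ P ∂σ) := by
        rw [hν, hσdef, lintegral_withDensity_mul hv.measurable (hψm.pow_const _),
          lintegral_withDensity_mul hσ.measurable (hGm.pow_const _)]
        congr 2
        refine lintegral_congr fun x => ?_
        rw [ENNReal.mul_rpow_of_nonneg _ _ (by linarith), ← ENNReal.rpow_mul, ← ENNReal.rpow_mul,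
          hPQ, mul_assoc]
        congr 1
        conv_lhs => rw [← ENNReal.rpow_one (v x), ← ENNReal.rpow_mul, ← hv.rpow_add]
        -- Hence ψ^Q dν = G^P v^{1-Q} dμ = G^P dσ, ready for the bound of M_σ on L^P(σ).
        have hexp : -1 * Q + 1 = -(1 / (P - 1)) := by
          rw [hQ, eq_neg_iff_add_eq_zero]
          field_simp
          ring
        rw [one_mul, hexp]
    _ ≤ C ^ Q * (K₁ * (K₂ * ∫⁻ x, (f x * v x ^ (1 / (P - 1))) ^ P ∂σ)) := by
        gcongr
        exact H₂ _ hfv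
    _ = C ^ Q * (K₁ * (K₂ * ∫⁻ x, f x ^ P * v x ∂μ)) := by
        rw [hσdef, lintegral_withDensity_mul hσ.measurable (hfv.pow_const _)]
        congr 3
        refine lintegral_congr fun x => ?_
        rw [ENNReal.mul_rpow_of_nonneg _ _ hP0.le, mul_assoc, ← ENNReal.rpow_mul, ← hv.rpow_add,
          show 1 / (P - 1) * P + -(1 / (P - 1)) = 1 by field_simp; ring, ENNReal.rpow_one]
    _ = _ := by ring

/-- The Rubio de Francia iteration: every function in `L^ρ(ν)` has an `A₁(ν)` majorant. -/
theorem exists_maxFn_le_majorant {ν : Measure X} (hν : IsDoubling ν D) {ρ : ℝ} (hρ : 1 < ρ) :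
    ∃ K : ℝ≥0∞, K ≠ ∞ ∧ ∀ φ : X → ℝ≥0∞, Measurable φ → ∃ A : X → ℝ≥0∞, Measurable A ∧
      (∀ x, φ x ≤ A x) ∧ (∀ x, maxFn ν A x ≤ K * A x) ∧
      ∫⁻ x, A x ^ ρ ∂ν ≤ K * ∫⁻ x, φ x ^ ρ ∂ν := by
  have hρ0 : 0 < ρ := by linarith
  obtain ⟨K₀, hK₀, H₀⟩ := lintegral_maxFn_rpow_le hν hρ
  -- K ≥ 1 ensures (K^{-i})^ρ ≤ K^{-i} below.
  set K := max K₀ 1 with hKdef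
  have hK1 : 1 ≤ K := le_max_right _ _
  have hKt : K ≠ ∞ := by simp [hKdef, hK₀]
  have hK0 : K ≠ 0 := (zero_lt_one.trans_le hK1).ne'
  have H : ∀ f : X → ℝ≥0∞, Measurable f →
      ∫⁻ x, maxFn ν f x ^ ρ ∂ν ≤ K * ∫⁻ x, f x ^ ρ ∂ν := fun f hf =>
    (H₀ f hf).trans (by gcongr; exact le_max_left _ _)
  have h2ρ : (2 : ℝ≥0∞) ^ ρ ≠ ∞ := ENNReal.rpow_ne_top_of_nonneg hρ0.le (by simp)
  refine ⟨max (2 * K) (2 ^ ρ), by simp [ENNReal.mul_ne_top, hKt, h2ρ], fun φ hφ => ?_⟩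
  let f : ℕ → X → ℝ≥0∞ := fun i => (maxFn ν)^[i] φ
  have hfs : ∀ i, f (i + 1) = maxFn ν (f i) := fun i => Function.iterate_succ_apply' _ _ _
  have hfm : ∀ i, Measurable (f i) := fun i => by
    cases i with
    | zero => exact hφ
    | succ i => rw [hfs]; exact measurable_maxFn _ _
  have hfi : ∀ i, ∫⁻ x, f i x ^ ρ ∂ν ≤ K ^ i * ∫⁻ x, φ x ^ ρ ∂ν := by
    intro i
    induction i with
    | zero => simp [f]
    | succ i ih =>
      rw [hfs]
      refine (H _ (hfm i)).trans ?_
      rw [pow_succ', mul_assoc]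
      gcongr
  have h2K : 2 * K ≠ 0 := by simp [hK0]
  have h2Kt : 2 * K ≠ ∞ := ENNReal.mul_ne_top (by simp) hKt
  -- Applying the maximal operator shifts the series by one index, which costs the factor 2K; the
  -- zeroth term is φ.
  let A : X → ℝ≥0∞ := fun x => ∑' i, ((2 * K)⁻¹) ^ i * f i x
  refine ⟨A, Measurable.tsum fun i => (hfm i).const_mul _, fun x => ?_, fun x => ?_, ?_⟩
  · refine le_trans ?_ (ENNReal.le_tsum 0)
    simp [f]
  · refine le_trans (maxFn_tsum_le _ hfm x) ?_
    calc ∑' i, ((2 * K)⁻¹) ^ i * maxFn ν (f i) x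
        = ∑' i, 2 * K * (((2 * K)⁻¹) ^ (i + 1) * f (i + 1) x) := by
          refine tsum_congr fun i => ?_
          rw [hfs, pow_succ', ← mul_assoc, ← mul_assoc, ENNReal.mul_inv_cancel h2K h2Kt, one_mul]
      _ = 2 * K * ∑' i, ((2 * K)⁻¹) ^ (i + 1) * f (i + 1) x := ENNReal.tsum_mul_left
      _ ≤ max (2 * K) (2 ^ ρ) * A x := by
          gcongr
          · exact le_max_left _ _
          · exact ENNReal.tsum_comp_le_tsum_of_injective (add_left_injective 1)
              fun i => ((2 * K)⁻¹) ^ i * f i x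
  -- Convexity of the ρ-th power with weights 2^{-i} takes the place of Minkowski's inequality;
  -- K^{-i} absorbs the growth of the iterates.
  · have hgeo : ∑' i : ℕ, (2⁻¹ : ℝ≥0∞) ^ i = 2 := by
      rw [ENNReal.tsum_geometric, ENNReal.one_sub_inv_two, inv_inv]
    have e : ∀ x, A x = ∑' i, (2⁻¹ : ℝ≥0∞) ^ i * ((K⁻¹) ^ i * f i x) := fun x => by
      refine tsum_congr fun i => ?_
      rw [ENNReal.mul_inv (by simp) (by simp), mul_pow, mul_assoc]
    calc ∫⁻ x, A x ^ ρ ∂ν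
        ≤ ∫⁻ x, 2 ^ (ρ - 1) * ∑' i, (2⁻¹ : ℝ≥0∞) ^ i * ((K⁻¹) ^ i * f i x) ^ ρ ∂ν := by
          refine lintegral_mono fun x => ?_
          have := rpow_tsum_mul_le (fun i => (2⁻¹ : ℝ≥0∞) ^ i) (fun i => (K⁻¹) ^ i * f i x) hρ.le
          rwa [hgeo, ← e] at this
      _ = 2 ^ (ρ - 1) * ∑' i, (2⁻¹ : ℝ≥0∞) ^ i * ∫⁻ x, ((K⁻¹) ^ i * f i x) ^ ρ ∂ν := by
          have hm : ∀ i, Measurable fun x => ((K⁻¹) ^ i * f i x) ^ ρ :=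
            fun i => ((hfm i).const_mul _).pow_const _
          rw [lintegral_const_mul _ (Measurable.tsum fun i => (hm i).const_mul _),
            lintegral_tsum fun i => ((hm i).const_mul _).aemeasurable]
          congr 2
          ext i
          rw [lintegral_const_mul _ (hm i)]
      _ ≤ 2 ^ (ρ - 1) * ∑' i, (2⁻¹ : ℝ≥0∞) ^ i * ∫⁻ x, φ x ^ ρ ∂ν := by
          refine mul_le_mul' le_rfl (ENNReal.tsum_le_tsum fun i => mul_le_mul' le_rfl ?_)
          calc ∫⁻ x, ((K⁻¹) ^ i * f i x) ^ ρ ∂ν = ((K⁻¹) ^ i) ^ ρ * ∫⁻ x, f i x ^ ρ ∂ν := by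
                rw [← lintegral_const_mul _ ((hfm i).pow_const _)]
                simp only [ENNReal.mul_rpow_of_nonneg _ _ hρ0.le]
            _ ≤ (K⁻¹) ^ i * (K ^ i * ∫⁻ x, φ x ^ ρ ∂ν) := by
                gcongr
                · exact ENNReal.rpow_le_self_of_le_one
                    (pow_le_one₀ zero_le (ENNReal.inv_le_one.2 hK1)) hρ.le
                · exact hfi i
            _ = _ := by
                rw [← mul_assoc, ← mul_pow, ENNReal.inv_mul_cancel hK0 hKt, one_pow, one_mul]
      _ = 2 ^ ρ * ∫⁻ x, φ x ^ ρ ∂ν := by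
          rw [ENNReal.tsum_mul_right, hgeo, ← mul_assoc]
          congr 1
          have := ENNReal.rpow_add (x := 2) (ρ - 1) 1 (by simp) (by simp)
          rw [sub_add_cancel, ENNReal.rpow_one] at this
          exact this.symm
      _ ≤ _ := by
          gcongr
          exact le_max_right _ _

end Weights

/-! ### Averages over balls -/

section Averages

open Metric Function

variable {X : Type*} [MeasurableSpace X] [PseudoMetricSpace X]

theorem ballAvg_rpow_mul_rpow_le {μ : Measure X} {D : ℝ≥0∞} (hμ : IsDoubling μ D)
    {f g : X → ℝ≥0∞} (hf : Measurable f) (hg : Measurable g) {s t : ℝ} (hs : 0 ≤ s) (ht : 0 ≤ t)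
    (hst : s + t = 1) (c : X) {r : ℝ} (hr : 0 < r) :
    ballAvg μ (fun y => f y ^ s * g y ^ t) c r ≤ ballAvg μ f c r ^ s * ballAvg μ g c r ^ t := by
  have h0 := hμ.ball_ne_zero c r hr
  have h1 := hμ.ball_ne_top c r
  unfold ballAvg
  rw [ENNReal.div_rpow_of_nonneg _ _ hs, ENNReal.div_rpow_of_nonneg _ _ ht, div_eq_mul_inv,
    div_eq_mul_inv, div_eq_mul_inv, mul_mul_mul_comm, ← ENNReal.inv_rpow, ← ENNReal.inv_rpow,
    ← ENNReal.rpow_add _ _ (by simp [h1]) (by simp [h0]), hst, ENNReal.rpow_one]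
  gcongr
  exact ENNReal.lintegral_mul_norm_pow_le hf.aemeasurable hg.aemeasurable hs ht hst

theorem ballAvg_congr_ae {μ : Measure X} {f g : X → ℝ≥0∞} (h : f =ᵐ[μ] g) (c : X) (r : ℝ) :
    ballAvg μ f c r = ballAvg μ g c r := by
  unfold ballAvg
  rw [lintegral_congr_ae (ae_restrict_of_ae h)]

variable [BorelSpace X]

/-- The moving normalization μ(B(y,r)) is comparable to μ(B(x,r)) for y in B(x,r). -/
theorem setLIntegral_div_measure_ball_le {μ : Measure X} {D : ℝ≥0∞} (hμ : IsDoubling μ D)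
    {φ : X → ℝ≥0∞} (hφ : Measurable φ) (x : X) {r : ℝ} (hr : 0 < r) :
    ∫⁻ y in ball x r, φ y / μ (ball y r) ∂μ ≤ D * ballAvg μ φ x r := by
  have h0 := hμ.ball_ne_zero x r hr
  have h1 := hμ.ball_ne_top x r
  calc ∫⁻ y in ball x r, φ y / μ (ball y r) ∂μ
      ≤ ∫⁻ y in ball x r, D / μ (ball x r) * φ y ∂μ := by
        refine setLIntegral_mono' measurableSet_ball fun y hy => ?_
        rw [div_eq_mul_inv, mul_comm]
        gcongr
        rw [ENNReal.inv_le_iff_inv_le, ENNReal.inv_div (Or.inl h1) (Or.inl h0)]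
        exact ENNReal.div_le_of_le_mul' (hμ.ball_le_of_mem hy)
    _ = D * ballAvg μ φ x r := by
        rw [lintegral_const_mul _ hφ, ballAvg, div_eq_mul_inv, div_eq_mul_inv]
        ring

variable [SecondCountableTopology X]

theorem measurable_setLIntegral_ball {μ : Measure X} [SFinite μ] (R : ℝ) {f : X → ℝ → ℝ≥0∞}
    (hf : Measurable (uncurry f)) :
    Measurable fun z : X × ℝ => ∫⁻ y in ball z.1 (R * z.2), f y z.2 ∂μ := by
  have e : ∀ z : X × ℝ, ∫⁻ y in ball z.1 (R * z.2), f y z.2 ∂μ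
      = ∫⁻ y, (if dist y z.1 < R * z.2 then f y z.2 else 0) ∂μ := fun z => by
    rw [← lintegral_indicator measurableSet_ball]
    refine lintegral_congr fun y => ?_
    simp [indicator]
  simp only [e]
  refine Measurable.lintegral_prod_right' (f := fun q : (X × ℝ) × X =>
    if dist q.2 q.1.1 < R * q.1.2 then f q.2 q.1.2 else 0) ?_
  refine Measurable.ite (measurableSet_lt (by fun_prop) (by fun_prop)) ?_ measurable_const
  exact hf.comp (g := uncurry f) (f := fun q : (X × ℝ) × X => (q.2, q.1.2)) (by fun_prop)

theorem measurable_measure_ball {μ : Measure X} [SFinite μ] (R : ℝ) :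
    Measurable fun z : X × ℝ => μ (ball z.1 (R * z.2)) := by
  simpa using measurable_setLIntegral_ball (μ := μ) R (f := fun _ _ => 1) measurable_const

theorem measurable_ballAvg {μ : Measure X} [SFinite μ] (R : ℝ) {f : X → ℝ → ℝ≥0∞}
    (hf : Measurable (uncurry f)) :
    Measurable fun z : X × ℝ => ballAvg μ (fun y => f y z.2) z.1 (R * z.2) :=
  (measurable_setLIntegral_ball R hf).div (measurable_measure_ball R)

/-- Tonelli and the symmetry of the distance: this identifies the adjoint of averaging over balls of
radius R. -/
theorem lintegral_mul_ballAvg {μ : Measure X} [SFinite μ] {φ h : X → ℝ≥0∞} (hφ : Measurable φ)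
    (hh : Measurable h) (R : ℝ) :
    ∫⁻ x, φ x * ballAvg μ h x R ∂μ
      = ∫⁻ y, h y * ∫⁻ x in ball y R, φ x / μ (ball x R) ∂μ ∂μ := by
  have hb : Measurable fun x : X => μ (ball x R) := by
    have := (measurable_measure_ball (μ := μ) 1).comp (measurable_id.prodMk measurable_const :
      Measurable fun x : X => (x, R))
    simpa [comp_def] using this
  have e1 : ∀ x, φ x * ballAvg μ h x R
      = ∫⁻ y, (if dist x y < R then h y * (φ x / μ (ball x R)) else 0) ∂μ := fun x => by
    have : φ x * ballAvg μ h x R = ∫⁻ y in ball x R, h y * (φ x / μ (ball x R)) ∂μ := by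
      rw [lintegral_mul_const _ hh, ballAvg, div_eq_mul_inv, div_eq_mul_inv]
      ring
    rw [this, ← lintegral_indicator measurableSet_ball]
    refine lintegral_congr fun y => ?_
    simp [indicator, dist_comm]
  have e2 : ∀ y, h y * ∫⁻ x in ball y R, φ x / μ (ball x R) ∂μ
      = ∫⁻ x, (if dist x y < R then h y * (φ x / μ (ball x R)) else 0) ∂μ := fun y => by
    have hd : Measurable fun x => φ x / μ (ball x R) := hφ.div hb
    rw [← lintegral_const_mul _ hd, ← lintegral_indicator measurableSet_ball]
    refine lintegral_congr fun y => ?_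
    simp [indicator]
  simp only [e1, e2]
  refine lintegral_lintegral_swap (Measurable.aemeasurable ?_)
  refine Measurable.ite (measurableSet_lt (by fun_prop) (by fun_prop)) ?_ measurable_const
  exact (hh.comp measurable_snd).mul ((hφ.comp measurable_fst).div (hb.comp measurable_fst))

end Averages

/-! ### Square functions -/

section SquareFunctions

open Metric Function

variable {X : Type*} [MeasurableSpace X]

/-- The square of the vertical square function of `g`. -/
def verticalSq (g : X → ℝ → ℝ≥0∞) (x : X) : ℝ≥0∞ := ∫⁻ t, g x t ^ (2 : ℝ) ∂scaleMeasure

theorem measurable_verticalSq {g : X → ℝ → ℝ≥0∞} (hg : Measurable (uncurry g)) :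
    Measurable (verticalSq g) :=
  Measurable.lintegral_prod_right' (f := fun z : X × ℝ => g z.1 z.2 ^ (2 : ℝ))
    (Measurable.pow_const hg _)

/-- The coefficients of the off-diagonal bounds. -/
def tail (c : ℝ) (j : ℕ) : ℝ≥0∞ := ENNReal.ofReal (Real.exp (-(c * 4 ^ (j + 1))))

theorem tsum_tail_mul_pow_ne_top {c : ℝ} (hc : 0 < c) {K : ℝ≥0∞} (hK : K ≠ ∞) :
    ∑' j, tail c j * K ^ j ≠ ∞ :=
  tsum_exp_four_pow_mul_pow_ne_top hc hK

theorem tsum_tail_ne_top {c : ℝ} (hc : 0 < c) : ∑' j, tail c j ≠ ∞ := by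
  simpa using tsum_tail_mul_pow_ne_top hc (K := 1) (by simp)

variable [PseudoMetricSpace X]

/-- The square of the conical square function of `g`. -/
def conicalSq (μ : Measure X) (g : X → ℝ → ℝ≥0∞) (x : X) : ℝ≥0∞ :=
  ∫⁻ t, ∫⁻ y in ball x t, g y t ^ (2 : ℝ) / μ (ball y t) ∂μ ∂scaleMeasure

/-- The `L^r → L^s` off-diagonal bound, comparing scale `t` with scale `a * t`. -/
def ScaleOffDiagonal (μ : Measure X) (a r s : ℝ) (M : ℝ≥0∞) (c : ℝ) (g : X → ℝ → ℝ≥0∞) : Prop :=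
  ∀ᵐ t ∂scaleMeasure, ∀ x, ballAvg μ (fun y => g y t ^ s) x t ^ (1 / s) ≤
    M * ∑' j, tail c j * ballAvg μ (fun y => g y (a * t) ^ r) x (2 ^ (j + 2) * t) ^ (1 / r)

/-- Cauchy–Schwarz in j with the weights `tail c j` brings the square inside the sum. -/
theorem ScaleOffDiagonal.ballAvg_rpow_le {μ : Measure X} {a r s : ℝ} {M : ℝ≥0∞} {c : ℝ}
    {g : X → ℝ → ℝ≥0∞} (h : ScaleOffDiagonal μ a r s M c g) :
    ∀ᵐ t ∂scaleMeasure, ∀ x, ballAvg μ (fun y => g y t ^ s) x t ^ (2 / s) ≤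
      M ^ (2 : ℝ) * (∑' j, tail c j) * ∑' j, tail c j *
        ballAvg μ (fun y => g y (a * t) ^ r) x (2 ^ (j + 2) * t) ^ (2 / r) := by
  filter_upwards [h] with t ht x
  have h2 := ENNReal.rpow_le_rpow (ht x) (z := 2) (by norm_num)
  have h3 := rpow_tsum_mul_le (tail c)
    (fun j => ballAvg μ (fun y => g y (a * t) ^ r) x (2 ^ (j + 2) * t) ^ (1 / r))
    (ρ := 2) (by norm_num)
  rw [← ENNReal.rpow_mul, one_div_mul_eq_div, ENNReal.mul_rpow_of_nonneg _ _ (by norm_num)] at h2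
  simp only [← ENNReal.rpow_mul, one_div_mul_eq_div] at h3
  rw [show (2 : ℝ) - 1 = 1 by norm_num, ENNReal.rpow_one] at h3
  calc _ ≤ _ := h2
    _ ≤ _ := mul_le_mul' le_rfl h3
    _ = _ := by ring

variable [BorelSpace X] [SecondCountableTopology X]

theorem measurable_conicalSq {μ : Measure X} [SFinite μ] {g : X → ℝ → ℝ≥0∞}
    (hg : Measurable (uncurry g)) : Measurable (conicalSq μ g) := by
  have h1 : Measurable (uncurry fun y t => g y t ^ (2 : ℝ) / μ (ball y t)) := by
    have := measurable_measure_ball (μ := μ) 1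
    simp only [one_mul] at this
    exact (Measurable.pow_const hg _).div this
  have h2 := measurable_setLIntegral_ball (μ := μ) 1 h1
  simp only [one_mul] at h2
  exact h2.lintegral_prod_right'

variable {μ : Measure X} {D : ℝ≥0∞}

/-- The pairing of a conical average of `h` with `φ` is controlled by the maximal function
of `φ`. -/
theorem lintegral_tsum_ballAvg_mul_le [SFinite μ] (hμ : IsDoubling μ D) {a : ℝ} (ha : 0 < a)
    (c : ℝ) {h : X → ℝ → ℝ≥0∞} (hh : Measurable (uncurry h)) {φ : X → ℝ≥0∞} (hφ : Measurable φ) :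
    ∫⁻ x, (∑' j, tail c j * ∫⁻ t, ballAvg μ (fun y => h y (a * t)) x (2 ^ (j + 2) * t)
        ∂scaleMeasure) * φ x ∂μ
      ≤ D * (∑' j, tail c j) * ∫⁻ y, (∫⁻ t, h y t ∂scaleMeasure) * maxFn μ φ y ∂μ := by
  have hh' : Measurable (uncurry fun y t => h y (a * t)) :=
    hh.comp (f := fun z : X × ℝ => (z.1, a * z.2)) (by fun_prop)
  have hA : ∀ j : ℕ, Measurable fun z : X × ℝ =>
      ballAvg μ (fun y => h y (a * z.2)) z.1 (2 ^ (j + 2) * z.2) := fun j =>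
    measurable_ballAvg (μ := μ) _ hh'
  have hscale : ∀ y, ∫⁻ t, h y (a * t) ∂scaleMeasure = ∫⁻ t, h y t ∂scaleMeasure := fun y =>
    (measurePreserving_mul_scaleMeasure ha).lintegral_comp (hh.comp measurable_prodMk_left)
  have hMm := measurable_maxFn μ φ
  have hs1 : ∀ t, Measurable fun y => h y (a * t) := fun t => hh'.comp measurable_prodMk_right
  have hs2 : ∀ y, Measurable fun t => h y (a * t) := fun y => hh'.comp measurable_prodMk_left
  have hA' : ∀ (j : ℕ) x, Measurable fun t =>
      ballAvg μ (fun y => h y (a * t)) x (2 ^ (j + 2) * t) :=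
    fun j x => (hA j).comp measurable_prodMk_left
  have hV : Measurable fun y => ∫⁻ t, h y t ∂scaleMeasure :=
    hh.lintegral_prod_right' (f := uncurry h)
  -- The bound is the same for every j: the adjoint of averaging at any radius is at most D times
  -- the maximal function. Only summability of the coefficients matters here.
  have key : ∀ j : ℕ, ∫⁻ x, (∫⁻ t, ballAvg μ (fun y => h y (a * t)) x (2 ^ (j + 2) * t)
      ∂scaleMeasure) * φ x ∂μ ≤ D * ∫⁻ y, (∫⁻ t, h y t ∂scaleMeasure) * maxFn μ φ y ∂μ := by
    intro j
    calc _ = ∫⁻ x, ∫⁻ t, φ x * ballAvg μ (fun y => h y (a * t)) x (2 ^ (j + 2) * t)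
            ∂scaleMeasure ∂μ := by
          refine lintegral_congr fun x => ?_
          rw [mul_comm, lintegral_const_mul _ (hA' j x)]
      _ = ∫⁻ t, ∫⁻ x, φ x * ballAvg μ (fun y => h y (a * t)) x (2 ^ (j + 2) * t)
            ∂μ ∂scaleMeasure :=
          lintegral_lintegral_swap
            ((hφ.comp measurable_fst).mul (hA j)).aemeasurable
      _ ≤ ∫⁻ t, ∫⁻ y, h y (a * t) * (D * maxFn μ φ y) ∂μ ∂scaleMeasure := by
          refine lintegral_mono_ae ?_
          filter_upwards [ae_scaleMeasure_pos] with t ht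
          rw [lintegral_mul_ballAvg hφ (hs1 t)]
          have hR : 0 < 2 ^ (j + 2) * t := by positivity
          refine lintegral_mono fun y => mul_le_mul' le_rfl ?_
          refine (setLIntegral_div_measure_ball_le hμ hφ y hR).trans ?_
          gcongr
          exact ballAvg_le_maxFn μ φ (mem_ball_self hR)
      _ = ∫⁻ y, ∫⁻ t, h y (a * t) * (D * maxFn μ φ y) ∂scaleMeasure ∂μ :=
          (lintegral_lintegral_swap
            (hh'.mul ((hMm.comp measurable_fst).const_mul D)).aemeasurable).symm
      _ = ∫⁻ y, D * ((∫⁻ t, h y t ∂scaleMeasure) * maxFn μ φ y) ∂μ := by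
          refine lintegral_congr fun y => ?_
          rw [lintegral_mul_const _ (hs2 y), hscale]
          ring
      _ = _ := lintegral_const_mul _ (hV.mul hMm)
  have hAint : ∀ j : ℕ, Measurable fun x =>
      ∫⁻ t, ballAvg μ (fun y => h y (a * t)) x (2 ^ (j + 2) * t) ∂scaleMeasure :=
    fun j => (hA j).lintegral_prod_right'
  have hAφ : ∀ j : ℕ, Measurable fun x => (∫⁻ t, ballAvg μ (fun y => h y (a * t)) x
      (2 ^ (j + 2) * t) ∂scaleMeasure) * φ x := fun j => (hAint j).mul hφ
  calc _ = ∫⁻ x, ∑' j, tail c j * ((∫⁻ t, ballAvg μ (fun y => h y (a * t)) x (2 ^ (j + 2) * t)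
        ∂scaleMeasure) * φ x) ∂μ := by
        refine lintegral_congr fun x => ?_
        rw [← ENNReal.tsum_mul_right]
        simp only [mul_assoc]
    _ = ∑' j, tail c j * ∫⁻ x, (∫⁻ t, ballAvg μ (fun y => h y (a * t)) x (2 ^ (j + 2) * t)
        ∂scaleMeasure) * φ x ∂μ := by
        rw [lintegral_tsum fun j => ((hAφ j).const_mul _).aemeasurable]
        refine tsum_congr fun j => ?_
        rw [lintegral_const_mul _ (hAφ j)]
    _ ≤ ∑' j, tail c j * (D * ∫⁻ y, (∫⁻ t, h y t ∂scaleMeasure) * maxFn μ φ y ∂μ) := by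
        gcongr with j
        exact key j
    _ = _ := by rw [ENNReal.tsum_mul_right]; ring

end SquareFunctions

/-! ### The conical square function is controlled by the vertical one -/

section Conical

open Metric Function

variable {X : Type*} [MeasurableSpace X] {μ : Measure X} {D : ℝ≥0∞}

/-- The powers of V cancel when 0 < V < ∞. Where V = 0, g vanishes only for almost every t, so the
identity is proved for a.e. y and then a.e. t, and Fubini exchanges the order. -/
theorem ae_rpow_eq_rpow_mul_verticalSq_rpow [SFinite μ] {g : X → ℝ → ℝ≥0∞}
    (hg : Measurable (uncurry g)) {θ : ℝ} (hθ : 0 < θ) (hfin : ∀ᵐ y ∂μ, verticalSq g y ≠ ∞) :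
    ∀ᵐ t ∂scaleMeasure, ∀ᵐ y ∂μ, g y t ^ (2 * θ) =
      (g y t ^ (2 : ℝ) * verticalSq g y ^ (θ - 1)) ^ θ * (verticalSq g y ^ θ) ^ (1 - θ) := by
  have hV := measurable_verticalSq hg
  have hm : MeasurableSet {z : X × ℝ | g z.1 z.2 ^ (2 * θ) =
      (g z.1 z.2 ^ (2 : ℝ) * verticalSq g z.1 ^ (θ - 1)) ^ θ *
        (verticalSq g z.1 ^ θ) ^ (1 - θ)} := by
    have hg' : Measurable fun z : X × ℝ => g z.1 z.2 := hg
    exact measurableSet_eq_fun (by fun_prop) (by fun_prop)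
  rw [← Measure.ae_ae_comm hm]
  filter_upwards [hfin] with y hy
  by_cases h0 : verticalSq g y = 0
  · have hgy : Measurable fun t => g y t ^ (2 : ℝ) :=
      (hg.comp measurable_prodMk_left).pow_const _
    have := h0
    rw [verticalSq, lintegral_eq_zero_iff hgy] at this
    filter_upwards [this] with t ht
    have ht : g y t = 0 := by simpa using ht
    simp [ht, hθ]
  · refine Filter.Eventually.of_forall fun t => ?_
    rw [ENNReal.mul_rpow_of_nonneg _ _ hθ.le, ← ENNReal.rpow_mul, ← ENNReal.rpow_mul,
      ← ENNReal.rpow_mul, mul_assoc, ← ENNReal.rpow_add _ _ h0 hy,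
      show (θ - 1) * θ + θ * (1 - θ) = 0 by ring, ENNReal.rpow_zero, mul_one]

/-- V · V^{θ-1} = V^θ. In the degenerate cases V = 0 and V = ∞ the left side is 0 by convention, so
the inequality persists. -/
theorem lintegral_rpow_mul_verticalSq_rpow_le {g : X → ℝ → ℝ≥0∞}
    (hg : Measurable (uncurry g)) {θ : ℝ} (hθ : 0 < θ) (hθ1 : θ < 1) (y : X) :
    ∫⁻ t, g y t ^ (2 : ℝ) * verticalSq g y ^ (θ - 1) ∂scaleMeasure ≤ verticalSq g y ^ θ := by
  have hgy : Measurable fun t => g y t ^ (2 : ℝ) := (hg.comp measurable_prodMk_left).pow_const _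
  rw [lintegral_mul_const _ hgy]
  change verticalSq g y * _ ≤ _
  by_cases h0 : verticalSq g y = 0
  · simp [h0]
  by_cases ht : verticalSq g y = ∞
  · simp [ht, hθ, hθ1]
  · have := ENNReal.rpow_add 1 (θ - 1) h0 ht
    rw [add_sub_cancel, ENNReal.rpow_one] at this
    exact this.ge

variable [PseudoMetricSpace X] [BorelSpace X] [SecondCountableTopology X]

/-- The L^{p₀} averages enter with the power 2/p₀ > 1 and so cannot be integrated in t directly. The
factorization with θ = p₀/2 makes the t-dependent factor linear and leaves the rest to a maximal
function independent of t. -/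
theorem ScaleOffDiagonal.conicalSq_le [SFinite μ] (hμ : IsDoubling μ D) {p₀ : ℝ} (hp₀ : 0 < p₀)
    (hp₀2 : p₀ < 2) {a : ℝ} (ha : 0 < a) {c : ℝ} {M : ℝ≥0} {g : X → ℝ → ℝ≥0∞}
    (hg : Measurable (uncurry g)) (h : ScaleOffDiagonal μ a p₀ 2 M c g)
    (hfin : ∀ᵐ y ∂μ, verticalSq g y ≠ ∞) (x : X) :
    conicalSq μ g x ≤ D * (M ^ (2 : ℝ) * ∑' j, tail c j) *
      (maxFn μ (fun y => verticalSq g y ^ (p₀ / 2)) x ^ (2 / p₀ - 1) *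
        ∑' j, tail c j * ∫⁻ t, ballAvg μ
          (fun y => g y (a * t) ^ (2 : ℝ) * verticalSq g y ^ (p₀ / 2 - 1)) x (2 ^ (j + 2) * t)
            ∂scaleMeasure) := by
  set θ := p₀ / 2 with hθdef
  have hθ : 0 < θ := by positivity
  have hθ1 : θ < 1 := by rw [hθdef]; linarith
  have hV := measurable_verticalSq hg
  have hg' : Measurable fun z : X × ℝ => g z.1 z.2 := hg
  have hgt : ∀ t, Measurable fun y => g y t := fun t => hg.comp measurable_prodMk_right
  have hh : Measurable (uncurry fun y t => g y (a * t) ^ (2 : ℝ) * verticalSq g y ^ (θ - 1)) := by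
    have : Measurable fun z : X × ℝ => g z.1 (a * z.2) :=
      hg'.comp (f := fun z : X × ℝ => (z.1, a * z.2)) (by fun_prop)
    exact (this.pow_const _).mul ((hV.comp measurable_fst).pow_const _)
  have hB : ∀ j : ℕ, Measurable fun t => ballAvg μ
      (fun y => g y (a * t) ^ (2 : ℝ) * verticalSq g y ^ (θ - 1)) x (2 ^ (j + 2) * t) := fun j =>
    (measurable_ballAvg (μ := μ) _ hh).comp measurable_prodMk_left
  have hfac := (measurePreserving_mul_scaleMeasure ha).quasiMeasurePreserving.ae
    (ae_rpow_eq_rpow_mul_verticalSq_rpow hg hθ hfin)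
  set N := maxFn μ (fun y => verticalSq g y ^ θ) x with hN
  calc conicalSq μ g x
      ≤ ∫⁻ t, D * (M ^ (2 : ℝ) * ∑' j, tail c j) * (N ^ (2 / p₀ - 1) * ∑' j, tail c j * ballAvg μ
          (fun y => g y (a * t) ^ (2 : ℝ) * verticalSq g y ^ (θ - 1)) x (2 ^ (j + 2) * t))
            ∂scaleMeasure := by
        refine lintegral_mono_ae ?_
        filter_upwards [ae_scaleMeasure_pos, h.ballAvg_rpow_le, hfac] with t ht hod hfac
        refine (setLIntegral_div_measure_ball_le hμ ((hgt t).pow_const _) x ht).trans ?_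
        rw [mul_assoc]
        refine mul_le_mul' le_rfl ?_
        have h1 := hod x
        rw [div_self two_ne_zero, ENNReal.rpow_one] at h1
        refine h1.trans (mul_le_mul' le_rfl ?_)
        rw [← ENNReal.tsum_mul_left]
        refine ENNReal.tsum_le_tsum fun j => ?_
        rw [mul_left_comm]
        refine mul_le_mul' le_rfl ?_
        have hR : 0 < 2 ^ (j + 2) * t := by positivity
        have e1 : (fun y => g y (a * t) ^ p₀) =ᵐ[μ] fun y =>
            (g y (a * t) ^ (2 : ℝ) * verticalSq g y ^ (θ - 1)) ^ θ *
              (verticalSq g y ^ θ) ^ (1 - θ) := by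
          filter_upwards [hfac] with y hy
          rw [← hy, show 2 * θ = p₀ by rw [hθdef]; ring]
        rw [ballAvg_congr_ae e1]
        have hht : Measurable fun y => g y (a * t) ^ (2 : ℝ) * verticalSq g y ^ (θ - 1) :=
          ((hgt (a * t)).pow_const 2).mul (hV.pow_const (θ - 1))
        have h2 := ballAvg_rpow_mul_rpow_le hμ (s := θ) (t := 1 - θ) hht (hV.pow_const θ) hθ.le
          (by linarith) (by ring) x hR
        -- Since 2/p₀ = 1/θ, the average of g²V^{θ-1} appears to the first power and that of V^θ to
        -- the power 1/θ - 1.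
        refine (ENNReal.rpow_le_rpow h2 (z := 2 / p₀) (by positivity)).trans ?_
        rw [ENNReal.mul_rpow_of_nonneg _ _ (by positivity), ← ENNReal.rpow_mul,
          ← ENNReal.rpow_mul, show θ * (2 / p₀) = 1 by rw [hθdef]; field_simp, ENNReal.rpow_one,
          mul_comm, show (1 - θ) * (2 / p₀) = 2 / p₀ - 1 by rw [hθdef]; field_simp]
        gcongr
        · rw [sub_nonneg, one_le_div hp₀]; exact hp₀2.le
        · exact ballAvg_le_maxFn μ _ (mem_ball_self hR)
    _ = _ := by
        rw [lintegral_const_mul _ ((Measurable.tsum fun j => (hB j).const_mul _).const_mul _),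
          lintegral_const_mul _ (Measurable.tsum fun j => (hB j).const_mul _),
          lintegral_tsum fun j => ((hB j).const_mul _).aemeasurable]
        congr 3
        ext j
        rw [lintegral_const_mul _ (hB j)]

/-- The pairing of an `L^r(v)` function with a maximal function, for an `A_r` weight `v`. -/
theorem ApBound.lintegral_mul_maxFn_mul_le {r : ℝ} {C : ℝ≥0∞} {v : X → ℝ≥0∞}
    (hμ : IsDoubling μ D) (hv : IsPosFinite v) (hr : 1 < r) (hC : C ≠ ∞) (h : ApBound μ r C v) :
    ∃ K : ℝ≥0∞, K ≠ ∞ ∧ ∀ f φ : X → ℝ≥0∞, Measurable f → Measurable φ →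
      ∫⁻ x, f x * maxFn μ (fun y => φ y * v y) x ∂μ ≤
        K * (∫⁻ x, f x ^ r * v x ∂μ) ^ (1 / r) *
          (∫⁻ x, φ x ^ (r / (r - 1)) * v x ∂μ) ^ (1 / (r / (r - 1))) := by
  have hr0 : 0 < r := by linarith
  have hr1 : 0 < r - 1 := by linarith
  set q := r / (r - 1) with hq
  have hq1 : 1 < q := by rw [hq, one_lt_div hr1]; linarith
  have hq0 : 0 < q := by linarith
  have hσ := hv.rpow (-(1 / (r - 1)))
  obtain ⟨K, hK, H⟩ := (h.dual hr).lintegral_maxFn_rpow_mul_le hμ hσ hq1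
    (ENNReal.rpow_ne_top_of_nonneg (by positivity) hC)
  refine ⟨K ^ (1 / q), ENNReal.rpow_ne_top_of_nonneg (by positivity) hK, fun f φ hf hφ => ?_⟩
  have hφv : Measurable fun y => φ y * v y := hφ.mul hv.measurable
  have hM := measurable_maxFn μ fun y => φ y * v y
  -- Hölder with the weight split as v^{1/r} σ^{1/q} = 1, σ = v^{-1/(r-1)}. The maximal operator
  -- then acts on L^q(σ dμ), and σ is in A_q by duality.
  have e : ∀ x, f x * maxFn μ (fun y => φ y * v y) x = (f x ^ r * v x) ^ (1 / r) *
      (maxFn μ (fun y => φ y * v y) x ^ q * v x ^ (-(1 / (r - 1)))) ^ (1 / q) := fun x => by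
    rw [ENNReal.mul_rpow_of_nonneg _ _ (by positivity),
      ENNReal.mul_rpow_of_nonneg _ _ (by positivity), ← ENNReal.rpow_mul, ← ENNReal.rpow_mul,
      ← ENNReal.rpow_mul, mul_one_div_cancel hr0.ne', mul_one_div_cancel hq0.ne',
      ENNReal.rpow_one, ENNReal.rpow_one, mul_mul_mul_comm, ← hv.rpow_add]
    have : 1 / r + -(1 / (r - 1)) * (1 / q) = 0 := by rw [hq]; field_simp; ring
    rw [this, ENNReal.rpow_zero, mul_one]
  simp only [e]
  refine (ENNReal.lintegral_mul_norm_pow_le ((hf.pow_const _).mul hv.measurable).aemeasurable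
    ((hM.pow_const _).mul hσ.measurable).aemeasurable (by positivity) (by positivity)
    (by rw [hq]; field_simp; ring)).trans ?_
  rw [mul_comm (K ^ (1 / q)), mul_assoc]
  refine mul_le_mul' le_rfl ?_
  rw [← ENNReal.mul_rpow_of_nonneg _ _ (by positivity)]
  gcongr
  refine (H _ hφv).trans_eq ?_
  congr 1
  refine lintegral_congr fun x => ?_
  rw [ENNReal.mul_rpow_of_nonneg _ _ hq0.le, mul_assoc, ← hv.rpow_add]
  have : q + -(1 / (r - 1)) = 1 := by rw [hq]; field_simp; ring
  rw [this, ENNReal.rpow_one]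

theorem lintegral_conicalSq_rpow_le (hμ : IsDoubling μ D) {v : X → ℝ≥0∞} (hv : IsPosFinite v)
    {p₀ p : ℝ} (hp₀ : 0 < p₀) (hp₀2 : p₀ < 2) (hp : p₀ < p) {C : ℝ≥0∞} (hC : C ≠ ∞)
    (hA : ApBound μ (p / p₀) C v) {a : ℝ} (ha : 0 < a) (M : ℝ≥0) {c : ℝ} (hc : 0 < c) :
    ∃ K : ℝ≥0∞, K ≠ ∞ ∧ ∀ g : X → ℝ → ℝ≥0∞, Measurable (uncurry g) →
      ScaleOffDiagonal μ a p₀ 2 M c g →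
        ∫⁻ x, conicalSq μ g x ^ (p / 2) * v x ∂μ ≤ K * ∫⁻ x, verticalSq g x ^ (p / 2) * v x ∂μ := by
  have hp0 : 0 < p := hp₀.trans hp
  set r := p / p₀ with hrdef
  have hr : 1 < r := (one_lt_div hp₀).2 hp
  have hr0 : 0 < r := by linarith
  set θ := p₀ / 2 with hθdef
  have hθ : 0 < θ := by positivity
  have hθ1 : θ < 1 := by rw [hθdef]; linarith
  have hrθ : θ * r = p / 2 := by rw [hθdef, hrdef]; field_simp
  have hsf : SigmaFinite μ := hμ.sigmaFinite
  have hsf' : SigmaFinite (μ.withDensity v) := (hA.isDoubling hμ hv hr hC).sigmaFinite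
  obtain ⟨K₁, hK₁, H₁⟩ := hA.lintegral_maxFn_rpow_mul_le hμ hv hr hC
  obtain ⟨K₂, hK₂, H₂⟩ := hA.lintegral_mul_maxFn_mul_le hμ hv hr hC
  set E := ∑' j, tail c j with hE
  have hEt : E ≠ ∞ := tsum_tail_ne_top hc
  have hD := hμ.const_ne_top
  set L := D * (M ^ (2 : ℝ) * E) with hL
  have hLt : L ≠ ∞ := ENNReal.mul_ne_top hD (ENNReal.mul_ne_top
    (ENNReal.rpow_ne_top_of_nonneg (by norm_num) (by simp)) hEt)
  set K₃ := (D * E * K₂) ^ r with hK₃def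
  have hK₃ : K₃ ≠ ∞ := ENNReal.rpow_ne_top_of_nonneg hr0.le
    (ENNReal.mul_ne_top (ENNReal.mul_ne_top hD hEt) hK₂)
  clear_value L K₃
  set K := L ^ (p / 2) * (K₁ ^ (1 - θ) * K₃ ^ θ) with hKdef
  have hKt : K ≠ ∞ := ENNReal.mul_ne_top (ENNReal.rpow_ne_top_of_nonneg (by positivity) hLt)
    (ENNReal.mul_ne_top (ENNReal.rpow_ne_top_of_nonneg (by linarith) hK₁)
      (ENNReal.rpow_ne_top_of_nonneg hθ.le hK₃))
  -- The added 1 keeps the constant positive, so the bound is trivial when the right side is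
  -- infinite.
  refine ⟨K + 1, by simp [hKt], fun g hg hod => ?_⟩
  set I := ∫⁻ x, verticalSq g x ^ (p / 2) * v x ∂μ with hI
  by_cases hItop : I = ∞
  · rw [hItop, ENNReal.mul_top (by simp)]
    exact le_top
  have hV := measurable_verticalSq hg
  have hfin : ∀ᵐ y ∂μ, verticalSq g y ≠ ∞ := by
    filter_upwards [ae_lt_top ((hV.pow_const _).mul hv.measurable) hItop] with y hy hy'
    rw [Pi.mul_apply, hy', ENNReal.top_rpow_of_pos (by positivity),
      ENNReal.top_mul (hv.ne_zero y)] at hy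
    exact absurd hy (lt_irrefl _)
  let Φ : X → ℝ≥0∞ := fun y => verticalSq g y ^ θ
  have hΦ : Measurable Φ := hV.pow_const θ
  have hΦI : ∫⁻ x, Φ x ^ r * v x ∂μ = I := by
    simp only [Φ, ← ENNReal.rpow_mul, hrθ, hI]
  let h : X → ℝ → ℝ≥0∞ := fun y t => g y t ^ (2 : ℝ) * verticalSq g y ^ (θ - 1)
  have hh : Measurable (uncurry h) :=
    (Measurable.pow_const hg _).mul ((hV.comp measurable_fst).pow_const _)
  let Θ : X → ℝ≥0∞ := fun x => ∑' j, tail c j * ∫⁻ t, ballAvg μ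
    (fun y => g y (a * t) ^ (2 : ℝ) * verticalSq g y ^ (θ - 1)) x (2 ^ (j + 2) * t) ∂scaleMeasure
  have hΘ : Measurable Θ := by
    refine Measurable.tsum fun j => Measurable.const_mul ?_ _
    have : Measurable (uncurry fun y t => h y (a * t)) :=
      hh.comp (f := fun z : X × ℝ => (z.1, a * z.2)) (by fun_prop)
    have := measurable_ballAvg (μ := μ) (2 ^ (j + 2)) this
    exact this.lintegral_prod_right'
  -- Duality in L^r(v dμ): the averages in Θ pass to φv, the integral in t of the remaining factor
  -- is at most Φ, and Φ is paired with the maximal function of φv.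
  have hΘr : ∫⁻ x, Θ x ^ r * v x ∂μ ≤ K₃ * I := by
    have hconj : r.HolderConjugate (r / (r - 1)) := Real.HolderConjugate.conjExponent hr
    rw [← lintegral_withDensity_mul hv.measurable (hΘ.pow_const _)]
    refine (lintegral_rpow_le_of_forall_lintegral_mul_le hconj hΘ
      (K := D * E * K₂ * I ^ (1 / r)) fun φ hφ _ _ => ?_).trans_eq ?_
    · have hΘφ : Measurable fun x => Θ x * φ x := hΘ.mul hφ
      rw [lintegral_withDensity_mul hv.measurable hΘφ,
        lintegral_withDensity_mul hv.measurable (hφ.pow_const _)]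
      calc ∫⁻ x, Θ x * φ x * v x ∂μ = ∫⁻ x, Θ x * (φ x * v x) ∂μ := by simp only [mul_assoc]
        _ ≤ D * E * ∫⁻ y, (∫⁻ t, h y t ∂scaleMeasure) * maxFn μ (fun y => φ y * v y) y ∂μ :=
          lintegral_tsum_ballAvg_mul_le hμ ha c hh (hφ.mul hv.measurable)
        _ ≤ D * E * ∫⁻ y, Φ y * maxFn μ (fun y => φ y * v y) y ∂μ := by
          gcongr with y
          exact lintegral_rpow_mul_verticalSq_rpow_le hg hθ hθ1 y
        _ ≤ D * E * _ := mul_le_mul' le_rfl (H₂ Φ φ hΦ hφ)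
        _ = _ := by rw [hΦI]; ring
    · rw [ENNReal.mul_rpow_of_nonneg _ _ hr0.le, ← ENNReal.rpow_mul, one_div_mul_cancel hr0.ne',
        ENNReal.rpow_one, ← hK₃def]
  have hMm := measurable_maxFn μ Φ
  calc ∫⁻ x, conicalSq μ g x ^ (p / 2) * v x ∂μ
      ≤ ∫⁻ x, L ^ (p / 2) *
          ((maxFn μ Φ x ^ r * v x) ^ (1 - θ) * (Θ x ^ r * v x) ^ θ) ∂μ := by
        refine lintegral_mono fun x => ?_
        have h1 := ENNReal.rpow_le_rpow (hod.conicalSq_le hμ hp₀ hp₀2 ha hg hfin x)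
          (z := p / 2) (by positivity)
        rw [← hE, ← hL] at h1
        refine (mul_le_mul' h1 le_rfl).trans_eq ?_
        change (L * (maxFn μ Φ x ^ (2 / p₀ - 1) * Θ x)) ^ (p / 2) * v x = _
        rw [ENNReal.mul_rpow_of_nonneg _ _ (by positivity),
          ENNReal.mul_rpow_of_nonneg _ _ (by positivity),
          ENNReal.mul_rpow_of_nonneg _ _ (by linarith), ENNReal.mul_rpow_of_nonneg _ _ hθ.le,
          ← ENNReal.rpow_mul, ← ENNReal.rpow_mul, ← ENNReal.rpow_mul]
        have e1 : (2 / p₀ - 1) * (p / 2) = r * (1 - θ) := by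
          rw [hθdef, hrdef]; field_simp
        have e2 : v x = v x ^ (1 - θ) * v x ^ θ := by
          rw [← hv.rpow_add, sub_add_cancel, ENNReal.rpow_one]
        rw [e1, mul_comm r θ, hrθ]
        conv_lhs => rw [e2]
        ring
    _ = L ^ (p / 2) * ∫⁻ x, (maxFn μ Φ x ^ r * v x) ^ (1 - θ) * (Θ x ^ r * v x) ^ θ ∂μ := by
        have := hv.measurable
        exact lintegral_const_mul _ (by fun_prop)
    _ ≤ L ^ (p / 2) * ((∫⁻ x, maxFn μ Φ x ^ r * v x ∂μ) ^ (1 - θ) *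
          (∫⁻ x, Θ x ^ r * v x ∂μ) ^ θ) := by
        refine mul_le_mul' le_rfl (ENNReal.lintegral_mul_norm_pow_le
          ((hMm.pow_const _).mul hv.measurable).aemeasurable
          ((hΘ.pow_const _).mul hv.measurable).aemeasurable (by linarith) hθ.le (by ring))
    _ ≤ L ^ (p / 2) * ((K₁ * I) ^ (1 - θ) * (K₃ * I) ^ θ) := by
        have h1 := H₁ Φ hΦ
        rw [hΦI] at h1
        have : 0 ≤ 1 - θ := by linarith
        gcongr
    _ = K * I := by
        have e2 : I ^ (1 - θ) * I ^ θ = I := by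
          rw [← ENNReal.rpow_add_of_nonneg _ _ (by linarith) hθ.le, sub_add_cancel,
            ENNReal.rpow_one]
        rw [ENNReal.mul_rpow_of_nonneg _ _ (by linarith), ENNReal.mul_rpow_of_nonneg _ _ hθ.le,
          mul_mul_mul_comm (K₁ ^ (1 - θ)), e2, hKdef]
        ring
    _ ≤ _ := by gcongr; exact le_self_add

end Conical

/-! ### Weighted `L²` comparison of the square functions -/

section Vertical

open Metric Function

variable {X : Type*} [MeasurableSpace X] [PseudoMetricSpace X] {μ : Measure X} {D : ℝ≥0∞}

/-- The reverse Hölder condition with exponent `s` together with the doubling condition, with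
constants `C` and `E`. -/
structure IsReverseHolderDoubling (μ : Measure X) (s : ℝ) (C E : ℝ≥0∞) (W : X → ℝ≥0∞) : Prop where
  measurable : Measurable W
  ballAvg_rpow_le : ∀ (x : X) (r : ℝ), 0 < r →
    ballAvg μ (fun y => W y ^ s) x r ^ (1 / s) ≤ C * ballAvg μ W x r
  ball_two_mul_le : ∀ (x : X) (r : ℝ), 0 < r →
    ∫⁻ y in ball x (2 * r), W y ∂μ ≤ E * ∫⁻ y in ball x r, W y ∂μ

theorem IsReverseHolderDoubling.ball_two_pow_mul_le {s : ℝ} {C E : ℝ≥0∞} {W : X → ℝ≥0∞}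
    (h : IsReverseHolderDoubling μ s C E W) (x : X) {r : ℝ} (hr : 0 < r) (k : ℕ) :
    ∫⁻ y in ball x (2 ^ k * r), W y ∂μ ≤ E ^ k * ∫⁻ y in ball x r, W y ∂μ := by
  induction k with
  | zero => simp
  | succ k ih =>
    calc ∫⁻ y in ball x (2 ^ (k + 1) * r), W y ∂μ
        = ∫⁻ y in ball x (2 * (2 ^ k * r)), W y ∂μ := by ring_nf
      _ ≤ E * ∫⁻ y in ball x (2 ^ k * r), W y ∂μ := h.ball_two_mul_le _ _ (by positivity)
      _ ≤ E * (E ^ k * ∫⁻ y in ball x r, W y ∂μ) := by gcongr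
      _ = _ := by ring

variable [BorelSpace X]

/-- Doubling gives μ(B(x,r)) ≤ D μ(B(y,r)) for x in B(y,r): the lower counterpart of
`setLIntegral_div_measure_ball_le`. -/
theorem one_le_mul_setLIntegral_inv_measure_ball (hμ : IsDoubling μ D) (y : X) {r : ℝ}
    (hr : 0 < r) : 1 ≤ D * ∫⁻ x in ball y r, 1 / μ (ball x r) ∂μ := by
  have h0 := hμ.ball_ne_zero y r hr
  have ht := hμ.ball_ne_top y r
  have hD := hμ.const_ne_top
  have hD0 : D ≠ 0 := by
    rintro rfl
    have := hμ.ball_two_mul_le y r hr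
    rw [zero_mul, nonpos_iff_eq_zero] at this
    exact hμ.ball_ne_zero y (2 * r) (by positivity) this
  calc (1 : ℝ≥0∞) = D * ((D * μ (ball y r))⁻¹ * μ (ball y r)) := by
        rw [ENNReal.mul_inv (Or.inl hD0) (Or.inl hD), mul_assoc, ENNReal.inv_mul_cancel h0 ht,
          mul_one, ENNReal.mul_inv_cancel hD0 hD]
    _ = D * ∫⁻ x in ball y r, (D * μ (ball y r))⁻¹ ∂μ := by rw [setLIntegral_const]
    _ ≤ _ := by
        refine mul_le_mul' le_rfl (setLIntegral_mono' measurableSet_ball fun x hx => ?_)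
        rw [one_div]
        exact ENNReal.inv_le_inv.2 (hμ.ball_le_of_mem (mem_ball_comm.1 hx))

/-- For y within 2^{j+2}t of z, the averages of W over B(y,t) and B(z,at) differ by a bounded number
of doublings per unit of j. This geometric loss is later absorbed by `tail`. -/
theorem IsReverseHolderDoubling.setLIntegral_ballAvg_div_le (hμ : IsDoubling μ D)
    {s : ℝ} {C E : ℝ≥0∞} {W : X → ℝ≥0∞} (h : IsReverseHolderDoubling μ s C E W) {a : ℝ}
    (ha : 1 / 2 ≤ a) (ha1 : a ≤ 1) (j : ℕ) (z : X) {t : ℝ} (ht : 0 < t) :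
    ∫⁻ y in ball z (2 ^ (j + 2) * t), ballAvg μ W y t / μ (ball y (2 ^ (j + 2) * t)) ∂μ
      ≤ (E * D) ^ (j + 4) * ballAvg μ W z (a * t) := by
  have hat : 0 < a * t := by positivity
  have h2j : (4 : ℝ) ≤ 2 ^ (j + 2) := by
    have : (1 : ℝ) ≤ 2 ^ j := one_le_pow₀ (by norm_num)
    rw [pow_add]; linarith
  set R := 2 ^ (j + 2) * t with hR
  have hR0 : 0 < R := by positivity
  have htR : 4 * t ≤ R := by rw [hR]; gcongr
  set B := E ^ (j + 4) * D ^ (j + 3) * ballAvg μ W z (a * t) with hB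
  have hpt : ∀ y ∈ ball z R, ballAvg μ W y t ≤ B := by
    intro y hy
    have hyz : dist y z < R := hy
    have hatt : a * t ≤ t := by nlinarith
    -- B(y,t) lies in B(z,2R), and 2R ≤ 2^{j+4}at exactly because a ≥ 1/2.
    have h1 : ∫⁻ x in ball y t, W x ∂μ ≤ E ^ (j + 4) * ∫⁻ x in ball z (a * t), W x ∂μ := by
      refine le_trans (lintegral_mono_set (ball_subset_ball' ?_))
        (h.ball_two_pow_mul_le z hat (j + 4))
      have : R ≤ 2 ^ (j + 3) * (a * t) := by
        rw [hR, show (2 : ℝ) ^ (j + 3) = 2 ^ (j + 2) * 2 by ring]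
        nlinarith [mul_pos (show (0 : ℝ) < 2 ^ (j + 2) by positivity) ht]
      rw [show (2 : ℝ) ^ (j + 4) = 2 * 2 ^ (j + 3) by ring]
      linarith
    have h2 : μ (ball z (a * t)) ≤ D ^ (j + 3) * μ (ball y t) := by
      refine le_trans (measure_mono (ball_subset_ball' ?_)) (hμ.ball_two_pow_mul_le y ht (j + 3))
      rw [show (2 : ℝ) ^ (j + 3) * t = 2 * R by rw [hR]; ring, dist_comm]
      linarith
    have h3 : (μ (ball y t))⁻¹ ≤ D ^ (j + 3) / μ (ball z (a * t)) := by
      rw [ENNReal.inv_le_iff_inv_le, ENNReal.inv_div (Or.inl (hμ.ball_ne_top _ _))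
        (Or.inl (hμ.ball_ne_zero _ _ hat))]
      exact ENNReal.div_le_of_le_mul' h2
    calc ballAvg μ W y t = (∫⁻ x in ball y t, W x ∂μ) * (μ (ball y t))⁻¹ := rfl
      _ ≤ _ := mul_le_mul' h1 h3
      _ = B := by rw [hB, ballAvg, div_eq_mul_inv, div_eq_mul_inv]; ring
  calc _ ≤ ∫⁻ y in ball z R, B / μ (ball y R) ∂μ := by
        refine setLIntegral_mono' measurableSet_ball fun y hy => ?_
        gcongr
        exact hpt y hy
    _ ≤ D * ballAvg μ (fun _ => B) z R :=
        setLIntegral_div_measure_ball_le hμ measurable_const z hR0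
    _ = D * B := by
        rw [ballAvg, setLIntegral_const, ENNReal.mul_div_cancel_right (hμ.ball_ne_zero _ _ hR0)
          (hμ.ball_ne_top _ _)]
    _ = E ^ (j + 4) * D ^ (j + 4) * ballAvg μ W z (a * t) := by rw [hB]; ring
    _ = _ := by rw [mul_pow]

variable [SecondCountableTopology X]

/-- The adjoint of averaging, applied to the constant 1, is bounded below by 1/D. -/
theorem lintegral_le_mul_lintegral_ballAvg [SFinite μ] (hμ : IsDoubling μ D) {ψ : X → ℝ≥0∞}
    (hψ : Measurable ψ) {r : ℝ} (hr : 0 < r) :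
    ∫⁻ x, ψ x ∂μ ≤ D * ∫⁻ y, ballAvg μ ψ y r ∂μ := by
  have h := lintegral_mul_ballAvg (μ := μ) (φ := fun _ => 1) measurable_const hψ r
  simp only [one_mul] at h
  have hk : Measurable fun y => ∫⁻ x in ball y r, 1 / μ (ball x r) ∂μ := by
    have h1 : Measurable (uncurry fun (x : X) (t : ℝ) => 1 / μ (ball x (1 * t))) :=
      measurable_const.div (measurable_measure_ball 1)
    have h2 := measurable_setLIntegral_ball (μ := μ) 1 h1
    have := h2.comp (g := fun z : X × ℝ => _) (measurable_id.prodMk measurable_const :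
      Measurable fun x : X => (x, r))
    simpa [comp_def] using this
  have hψk : Measurable fun y => ψ y * ∫⁻ x in ball y r, 1 / μ (ball x r) ∂μ := hψ.mul hk
  rw [h, ← lintegral_const_mul _ hψk]
  refine lintegral_mono fun y => ?_
  simp only
  rw [mul_left_comm]
  exact le_mul_of_one_le_right' (one_le_mul_setLIntegral_inv_measure_ball hμ y hr)

theorem lintegral_mul_setLIntegral_ball [SFinite μ] {φ h : X → ℝ≥0∞} (hφ : Measurable φ)
    (hh : Measurable h) (R : ℝ) :
    ∫⁻ x, (∫⁻ y in ball x R, h y ∂μ) * φ x ∂μ = ∫⁻ y, h y * ∫⁻ x in ball y R, φ x ∂μ ∂μ := by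
  have e1 : ∀ x, (∫⁻ y in ball x R, h y ∂μ) * φ x
      = ∫⁻ y, (if dist x y < R then h y * φ x else 0) ∂μ := fun x => by
    rw [← lintegral_mul_const _ hh, ← lintegral_indicator measurableSet_ball]
    refine lintegral_congr fun y => ?_
    simp [indicator, dist_comm]
  have e2 : ∀ y, h y * ∫⁻ x in ball y R, φ x ∂μ
      = ∫⁻ x, (if dist x y < R then h y * φ x else 0) ∂μ := fun y => by
    rw [← lintegral_const_mul _ hφ, ← lintegral_indicator measurableSet_ball]
    refine lintegral_congr fun y => ?_
    simp [indicator]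
  simp only [e1, e2]
  refine lintegral_lintegral_swap (Measurable.aemeasurable ?_)
  exact Measurable.ite (measurableSet_lt (by fun_prop) (by fun_prop)) (by fun_prop)
    measurable_const

/-- Tonelli: integrating over the cones replaces W by its averages at scale t, so conical and
vertical integrals differ only in the weight. -/
theorem lintegral_conicalSq_mul [SFinite μ] {g : X → ℝ → ℝ≥0∞} (hg : Measurable (uncurry g))
    {W : X → ℝ≥0∞} (hW : Measurable W) :
    ∫⁻ x, conicalSq μ g x * W x ∂μ
      = ∫⁻ t, ∫⁻ y, g y t ^ (2 : ℝ) * ballAvg μ W y t ∂μ ∂scaleMeasure := by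
  have hg' : Measurable fun z : X × ℝ => g z.1 z.2 := hg
  have hb : Measurable fun z : X × ℝ => μ (ball z.1 z.2) := by
    simpa using measurable_measure_ball (μ := μ) (X := X) 1
  have h1 : Measurable (uncurry fun y t => g y t ^ (2 : ℝ) / μ (ball y t)) :=
    (hg'.pow_const _).div hb
  have h2 : Measurable fun z : X × ℝ =>
      ∫⁻ y in ball z.1 z.2, g y z.2 ^ (2 : ℝ) / μ (ball y z.2) ∂μ := by
    simpa using measurable_setLIntegral_ball (μ := μ) 1 h1
  have h3 : ∀ x, Measurable fun t => ∫⁻ y in ball x t, g y t ^ (2 : ℝ) / μ (ball y t) ∂μ :=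
    fun x => h2.comp measurable_prodMk_left
  have h4 : ∀ t, Measurable fun y => g y t ^ (2 : ℝ) / μ (ball y t) :=
    fun t => h1.comp measurable_prodMk_right
  calc ∫⁻ x, conicalSq μ g x * W x ∂μ
      = ∫⁻ x, ∫⁻ t, (∫⁻ y in ball x t, g y t ^ (2 : ℝ) / μ (ball y t) ∂μ) * W x
          ∂scaleMeasure ∂μ := by
        refine lintegral_congr fun x => ?_
        rw [lintegral_mul_const _ (h3 x)]
        rfl
    _ = ∫⁻ t, ∫⁻ x, (∫⁻ y in ball x t, g y t ^ (2 : ℝ) / μ (ball y t) ∂μ) * W x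
          ∂μ ∂scaleMeasure :=
        lintegral_lintegral_swap (h2.mul (hW.comp measurable_fst)).aemeasurable
    _ = _ := by
        refine lintegral_congr fun t => ?_
        rw [lintegral_mul_setLIntegral_ball hW (h4 t)]
        refine lintegral_congr fun y => ?_
        rw [ballAvg, div_eq_mul_inv, div_eq_mul_inv]
        ring

/-- The L² case. The constant depends on W only through its reverse Hölder and doubling constants,
which is what extrapolation requires. -/
theorem lintegral_verticalSq_mul_le (hμ : IsDoubling μ D) {q₀ : ℝ} (hq₀ : 2 < q₀) {a : ℝ}
    (ha : 1 / 2 ≤ a) (ha1 : a ≤ 1) (M : ℝ≥0) {c : ℝ} (hc : 0 < c) {C E : ℝ≥0∞} (hC : C ≠ ∞)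
    (hE : E ≠ ∞) : ∃ K : ℝ≥0∞, K ≠ ∞ ∧ ∀ W : X → ℝ≥0∞,
      IsReverseHolderDoubling μ (q₀ / (q₀ - 2)) C E W → ∀ g : X → ℝ → ℝ≥0∞,
        Measurable (uncurry g) → ScaleOffDiagonal μ a 2 q₀ M c g →
          ∫⁻ x, verticalSq g x * W x ∂μ ≤ K * ∫⁻ x, conicalSq μ g x * W x ∂μ := by
  have hsf : SigmaFinite μ := hμ.sigmaFinite
  have hD := hμ.const_ne_top
  have hq0 : 0 < q₀ := by linarith
  have hq2 : 0 < q₀ - 2 := by linarith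
  set s := q₀ / (q₀ - 2) with hs
  have hs0 : 0 < s := by positivity
  have ha0 : 0 < a := by linarith
  set B := D * (M ^ (2 : ℝ) * (∑' j, tail c j) * C) with hB
  have hBt : B ≠ ∞ := ENNReal.mul_ne_top hD (ENNReal.mul_ne_top (ENNReal.mul_ne_top
    (ENNReal.rpow_ne_top_of_nonneg (by norm_num) (by simp)) (tsum_tail_ne_top hc)) hC)
  set G := ∑' j, tail c j * (E * D) ^ (j + 4) with hG
  have hGt : G ≠ ∞ := by
    have : G = (E * D) ^ 4 * ∑' j, tail c j * (E * D) ^ j := by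
      rw [hG, ← ENNReal.tsum_mul_left]
      refine tsum_congr fun j => ?_
      ring
    rw [this]
    exact ENNReal.mul_ne_top (ENNReal.pow_ne_top (ENNReal.mul_ne_top hE hD))
      (tsum_tail_mul_pow_ne_top hc (ENNReal.mul_ne_top hE hD))
  refine ⟨B * G, ENNReal.mul_ne_top hBt hGt, fun W hW g hg hod => ?_⟩
  have hWm := hW.measurable
  have hg' : Measurable fun z : X × ℝ => g z.1 z.2 := hg
  have hgt : ∀ t, Measurable fun y => g y t := fun t => hg.comp measurable_prodMk_right
  have hgy : ∀ y, Measurable fun t => g y t ^ (2 : ℝ) :=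
    fun y => (hg.comp measurable_prodMk_left).pow_const _
  have hWavg : Measurable fun z : X × ℝ => ballAvg μ W z.1 z.2 := by
    simpa using measurable_ballAvg (μ := μ) 1 (f := fun y _ => W y) (hWm.comp measurable_fst)
  have hWavgt : ∀ t, Measurable fun y => ballAvg μ W y t :=
    fun t => hWavg.comp measurable_prodMk_right
  have hkm : Measurable fun z : X × ℝ => g z.1 z.2 ^ (2 : ℝ) * ballAvg μ W z.1 z.2 :=
    (hg'.pow_const _).mul hWavg
  have hkm' : Measurable fun t => ∫⁻ y, g y t ^ (2 : ℝ) * ballAvg μ W y t ∂μ :=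
    hkm.lintegral_prod_left'
  have hga : Measurable (uncurry fun y t => g y (a * t) ^ (2 : ℝ)) :=
    (hg'.comp (f := fun z : X × ℝ => (z.1, a * z.2)) (by fun_prop)).pow_const _
  -- At fixed t: pass to averages over B(y,t), separate g from W there, enlarge the g-average by the
  -- off-diagonal bound, and move the enlarged average back onto W. The outcome is the conical
  -- integrand at scale at.
  have hslice : ∀ᵐ t ∂scaleMeasure, ∫⁻ x, g x t ^ (2 : ℝ) * W x ∂μ ≤
      B * G * ∫⁻ y, g y (a * t) ^ (2 : ℝ) * ballAvg μ W y (a * t) ∂μ := by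
    filter_upwards [ae_scaleMeasure_pos, hod.ballAvg_rpow_le] with t ht hodt
    have hA : ∀ j : ℕ, Measurable fun y =>
        ballAvg μ (fun y => g y (a * t) ^ (2 : ℝ)) y (2 ^ (j + 2) * t) := fun j =>
      (measurable_ballAvg (μ := μ) (2 ^ (j + 2)) hga).comp measurable_prodMk_right
    have hpt : ∀ y, ballAvg μ (fun x => g x t ^ (2 : ℝ) * W x) y t ≤
        M ^ (2 : ℝ) * (∑' j, tail c j) * C * ∑' j, tail c j * (ballAvg μ W y t *
          ballAvg μ (fun y => g y (a * t) ^ (2 : ℝ)) y (2 ^ (j + 2) * t)) := by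
      intro y
      -- Hölder with 2/q₀ + 1/s = 1. The first factor is what the off-diagonal bound controls, the
      -- second what the reverse Hölder inequality controls.
      have h1 := ballAvg_rpow_mul_rpow_le hμ (f := fun x => g x t ^ q₀) (g := fun x => W x ^ s)
        (s := 2 / q₀) (t := 1 / s) ((hgt t).pow_const _) (hWm.pow_const _) (by positivity)
        (by positivity) (by rw [hs]; field_simp; ring) y ht
      simp only [← ENNReal.rpow_mul] at h1
      rw [mul_div_cancel₀ _ hq0.ne', mul_one_div_cancel hs0.ne'] at h1
      simp only [ENNReal.rpow_one] at h1
      have h2 := hodt y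
      simp only [div_self (two_ne_zero (α := ℝ)), ENNReal.rpow_one] at h2
      refine h1.trans ((mul_le_mul' h2 (hW.ballAvg_rpow_le y t ht)).trans_eq ?_)
      rw [mul_mul_mul_comm, ← ENNReal.tsum_mul_right]
      congr 1
      refine tsum_congr fun j => ?_
      ring
    calc ∫⁻ x, g x t ^ (2 : ℝ) * W x ∂μ
        ≤ D * ∫⁻ y, ballAvg μ (fun x => g x t ^ (2 : ℝ) * W x) y t ∂μ :=
          lintegral_le_mul_lintegral_ballAvg hμ (((hgt t).pow_const _).mul hWm) ht
      _ ≤ D * ∫⁻ y, M ^ (2 : ℝ) * (∑' j, tail c j) * C * ∑' j, tail c j * (ballAvg μ W y t *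
          ballAvg μ (fun y => g y (a * t) ^ (2 : ℝ)) y (2 ^ (j + 2) * t)) ∂μ := by
          gcongr with y
          exact hpt y
      _ = B * ∑' j, tail c j * ∫⁻ y, ballAvg μ W y t *
          ballAvg μ (fun y => g y (a * t) ^ (2 : ℝ)) y (2 ^ (j + 2) * t) ∂μ := by
          have hm : ∀ j : ℕ, Measurable fun y => ballAvg μ W y t *
              ballAvg μ (fun y => g y (a * t) ^ (2 : ℝ)) y (2 ^ (j + 2) * t) :=
            fun j => (hWavgt t).mul (hA j)
          rw [lintegral_const_mul _ (Measurable.tsum fun j => (hm j).const_mul _), ← mul_assoc, hB,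
            lintegral_tsum fun j => ((hm j).const_mul _).aemeasurable]
          congr 2
          ext j
          rw [lintegral_const_mul _ (hm j)]
      _ ≤ B * ∑' j, tail c j * ∫⁻ z, g z (a * t) ^ (2 : ℝ) *
          ((E * D) ^ (j + 4) * ballAvg μ W z (a * t)) ∂μ := by
          refine mul_le_mul' le_rfl (ENNReal.tsum_le_tsum fun j => mul_le_mul' le_rfl ?_)
          have hm : Measurable fun y => g y (a * t) ^ (2 : ℝ) := (hgt (a * t)).pow_const _
          rw [lintegral_mul_ballAvg (hWavgt t) hm]
          gcongr with z
          exact hW.setLIntegral_ballAvg_div_le hμ ha ha1 j z ht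
      _ = _ := by
          have hm : Measurable fun y => g y (a * t) ^ (2 : ℝ) * ballAvg μ W y (a * t) :=
            hkm.comp measurable_prodMk_right
          rw [mul_assoc B G, hG, ← ENNReal.tsum_mul_right]
          congr 2
          ext j
          rw [mul_assoc, ← lintegral_const_mul _ hm]
          congr 2
          ext z
          ring
  calc ∫⁻ x, verticalSq g x * W x ∂μ
      = ∫⁻ x, ∫⁻ t, g x t ^ (2 : ℝ) * W x ∂scaleMeasure ∂μ := by
        refine lintegral_congr fun x => ?_
        rw [lintegral_mul_const _ (hgy x)]
        rfl
    _ = ∫⁻ t, ∫⁻ x, g x t ^ (2 : ℝ) * W x ∂μ ∂scaleMeasure :=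
        lintegral_lintegral_swap
          ((hg'.pow_const _).mul (hWm.comp measurable_fst)).aemeasurable
    _ ≤ ∫⁻ t, B * G * ∫⁻ y, g y (a * t) ^ (2 : ℝ) * ballAvg μ W y (a * t) ∂μ ∂scaleMeasure :=
        lintegral_mono_ae hslice
    _ = B * G * ∫⁻ t, ∫⁻ y, g y (a * t) ^ (2 : ℝ) * ballAvg μ W y (a * t) ∂μ ∂scaleMeasure :=
        lintegral_const_mul _ (hkm'.comp (measurable_const_mul a))
    _ = B * G * ∫⁻ t, ∫⁻ y, g y t ^ (2 : ℝ) * ballAvg μ W y t ∂μ ∂scaleMeasure := by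
        rw [(measurePreserving_mul_scaleMeasure ha0).lintegral_comp hkm']
    _ = _ := by rw [lintegral_conicalSq_mul hg hWm]

end Vertical

/-! ### Weights built from `A₁` functions -/

section AOne

open Metric Function

variable {X : Type*} [MeasurableSpace X] [PseudoMetricSpace X] {μ : Measure X} {D : ℝ≥0∞}

/-- N(x,r) stands for the typical size on the ball of the A-factor of W, with W^s dμ comparable to
N^s dν. An upper bound for the L^s mass and a lower bound for the L¹ mass give the reverse Hölder
inequality; doubling of N, μ and ν then gives that of W. -/
theorem IsReverseHolderDoubling.of_bounds (hμ : IsDoubling μ D) {ν : Measure X} {D' : ℝ≥0∞}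
    (hν : IsDoubling ν D') {s : ℝ} (hs : 1 < s) {W : X → ℝ≥0∞} (hW : Measurable W)
    {N : X → ℝ → ℝ≥0∞} {C₁ C₂ C₃ : ℝ≥0∞}
    (h₁ : ∀ x r, 0 < r → ∫⁻ y in ball x r, W y ^ s ∂μ ≤ C₁ * N x r ^ s * ν (ball x r))
    (h₂ : ∀ x r, 0 < r → N x r * μ (ball x r) ^ (1 - 1 / s) * ν (ball x r) ^ (1 / s)
      ≤ C₂ * ∫⁻ y in ball x r, W y ∂μ)
    (h₃ : ∀ x r, 0 < r → N x (2 * r) ≤ C₃ * N x r) :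
    IsReverseHolderDoubling μ s (C₁ ^ (1 / s) * C₂)
      (C₁ ^ (1 / s) * C₃ * D ^ (1 - 1 / s) * D' ^ (1 / s) * C₂) W := by
  have hs0 : 0 < s := by linarith
  have hs1 : 0 ≤ 1 - 1 / s := by rw [sub_nonneg, div_le_one hs0]; exact hs.le
  have h₁' : ∀ x r, 0 < r → (∫⁻ y in ball x r, W y ^ s ∂μ) ^ (1 / s)
      ≤ C₁ ^ (1 / s) * N x r * ν (ball x r) ^ (1 / s) := fun x r hr => by
    refine (ENNReal.rpow_le_rpow (h₁ x r hr) (by positivity)).trans_eq ?_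
    rw [ENNReal.mul_rpow_of_nonneg _ _ (by positivity),
      ENNReal.mul_rpow_of_nonneg _ _ (by positivity), ← ENNReal.rpow_mul,
      mul_one_div_cancel hs0.ne', ENNReal.rpow_one]
  refine ⟨hW, fun x r hr => ?_, fun x r hr => ?_⟩
  · have h0 := hμ.ball_ne_zero x r hr
    have ht := hμ.ball_ne_top x r
    rw [← ENNReal.mul_le_mul_iff_left h0 ht, mul_assoc _ _ (μ (ball x r)),
      ballAvg_mul_measure hμ _ _ hr]
    calc _ = (∫⁻ y in ball x r, W y ^ s ∂μ) ^ (1 / s) * μ (ball x r) ^ (1 - 1 / s) := by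
          rw [ballAvg, ENNReal.div_rpow_of_nonneg _ _ (by positivity), div_eq_mul_inv, mul_assoc,
            ← ENNReal.rpow_neg]
          conv_lhs => rw [← ENNReal.rpow_one (μ (ball x r)), ← ENNReal.rpow_mul,
            ← ENNReal.rpow_add _ _ h0 ht]
          congr 2
          ring
      _ ≤ C₁ ^ (1 / s) * N x r * ν (ball x r) ^ (1 / s) * μ (ball x r) ^ (1 - 1 / s) :=
          mul_le_mul' (h₁' x r hr) le_rfl
      _ = C₁ ^ (1 / s) * (N x r * μ (ball x r) ^ (1 - 1 / s) * ν (ball x r) ^ (1 / s)) := by ring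
      _ ≤ C₁ ^ (1 / s) * (C₂ * ∫⁻ y in ball x r, W y ∂μ) := mul_le_mul' le_rfl (h₂ x r hr)
      _ = _ := by ring
  · have hr2 : 0 < 2 * r := by positivity
    have hH : ∫⁻ y in ball x (2 * r), W y ∂μ ≤
        (∫⁻ y in ball x (2 * r), W y ^ s ∂μ) ^ (1 / s) * μ (ball x (2 * r)) ^ (1 - 1 / s) := by
      have := ENNReal.rpow_le_rpow (rpow_setLIntegral_le (μ := μ) hW.aemeasurable hs.le
        (ball x (2 * r))) (z := 1 / s) (by positivity)
      rw [ENNReal.mul_rpow_of_nonneg _ _ (by positivity), ← ENNReal.rpow_mul, ← ENNReal.rpow_mul,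
        mul_one_div_cancel hs0.ne', ENNReal.rpow_one,
        show (s - 1) * (1 / s) = 1 - 1 / s by field_simp] at this
      exact this.trans_eq (mul_comm _ _)
    calc ∫⁻ y in ball x (2 * r), W y ∂μ ≤ _ := hH
      _ ≤ (C₁ ^ (1 / s) * N x (2 * r) * ν (ball x (2 * r)) ^ (1 / s)) *
            μ (ball x (2 * r)) ^ (1 - 1 / s) := mul_le_mul' (h₁' x _ hr2) le_rfl
      _ ≤ (C₁ ^ (1 / s) * (C₃ * N x r) * (D' * ν (ball x r)) ^ (1 / s)) *
            (D * μ (ball x r)) ^ (1 - 1 / s) := by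
          refine mul_le_mul' (mul_le_mul' (mul_le_mul' le_rfl (h₃ x r hr)) ?_) ?_
          · exact ENNReal.rpow_le_rpow (hν.ball_two_mul_le x r hr) (by positivity)
          · exact ENNReal.rpow_le_rpow (hμ.ball_two_mul_le x r hr) hs1
      _ = C₁ ^ (1 / s) * C₃ * D ^ (1 - 1 / s) * D' ^ (1 / s) *
            (N x r * μ (ball x r) ^ (1 - 1 / s) * ν (ball x r) ^ (1 / s)) := by
          rw [ENNReal.mul_rpow_of_nonneg _ _ (by positivity), ENNReal.mul_rpow_of_nonneg _ _ hs1]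
          ring
      _ ≤ C₁ ^ (1 / s) * C₃ * D ^ (1 - 1 / s) * D' ^ (1 / s) *
            (C₂ * ∫⁻ y in ball x r, W y ∂μ) := mul_le_mul' le_rfl (h₂ x r hr)
      _ = _ := by ring

/-- The `A₁(ν)` condition with constant `K`, in terms of the maximal function. -/
structure IsAOne (ν : Measure X) (K : ℝ≥0∞) (A : X → ℝ≥0∞) : Prop where
  measurable : Measurable A
  ne_zero : ∀ x, A x ≠ 0
  ae_ne_top : ∀ᵐ x ∂ν, A x ≠ ∞
  ballAvg_ne_top : ∀ x r, 0 < r → ballAvg ν A x r ≠ ∞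
  maxFn_le : ∀ x, maxFn ν A x ≤ K * A x

variable {ν : Measure X} {D' K : ℝ≥0∞} {A : X → ℝ≥0∞}

theorem IsAOne.ballAvg_le (hA : IsAOne ν K A) {x y : X} {r : ℝ} (hy : y ∈ ball x r) :
    ballAvg ν A x r ≤ K * A y :=
  (ballAvg_le_maxFn ν A hy).trans (hA.maxFn_le y)

theorem isAOne_one (hν : IsDoubling ν D') : IsAOne ν 1 fun _ => 1 where
  measurable := measurable_const
  ne_zero _ := one_ne_zero
  ae_ne_top := by simp
  ballAvg_ne_top x r hr := by
    simp [ballAvg, ENNReal.div_self (hν.ball_ne_zero x r hr) (hν.ball_ne_top x r)]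
  maxFn_le x := by
    refine SquareFn.maxFn_le fun c r hx => ?_
    simp [ballAvg, ENNReal.div_self_le_one]

theorem ballAvg_le_mul_ballAvg_two_mul (hν : IsDoubling ν D') (f : X → ℝ≥0∞) (x : X) {r : ℝ}
    (hr : 0 < r) : ballAvg ν f x r ≤ D' * ballAvg ν f x (2 * r) := by
  have h0 := hν.ball_ne_zero x r hr
  have ht := hν.ball_ne_top x r
  have hr2 : 0 < 2 * r := by positivity
  rw [← ENNReal.mul_le_mul_iff_left h0 ht, ballAvg_mul_measure hν _ _ hr]
  calc ∫⁻ y in ball x r, f y ∂ν ≤ ∫⁻ y in ball x (2 * r), f y ∂ν :=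
        lintegral_mono_set (ball_subset_ball (by linarith))
    _ = ballAvg ν f x (2 * r) * ν (ball x (2 * r)) := (ballAvg_mul_measure hν _ _ hr2).symm
    _ ≤ ballAvg ν f x (2 * r) * (D' * ν (ball x r)) :=
        mul_le_mul' le_rfl (hν.ball_two_mul_le x r hr)
    _ = _ := by ring

variable [BorelSpace X]

theorem IsAOne.ballAvg_ne_zero (hν : IsDoubling ν D') (hA : IsAOne ν K A) (x : X) {r : ℝ}
    (hr : 0 < r) : ballAvg ν A x r ≠ 0 := by
  rw [ballAvg, ENNReal.div_ne_zero]
  refine ⟨fun h0 => hν.ball_ne_zero x r hr ?_, hν.ball_ne_top x r⟩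
  rw [setLIntegral_eq_zero_iff measurableSet_ball hA.measurable] at h0
  rw [measure_eq_zero_iff_ae_notMem]
  filter_upwards [h0] with y hy hyB
  exact hA.ne_zero y (hy hyB)

/-- Every point y of the small ball also lies in the large one, so the large average is at most K
A(y); average this in y. -/
theorem IsAOne.ballAvg_two_mul_le (hν : IsDoubling ν D') (hA : IsAOne ν K A) (x : X) {r : ℝ}
    (hr : 0 < r) : ballAvg ν A x (2 * r) ≤ K * ballAvg ν A x r := by
  rw [← ballAvg_const_mul hA.measurable]
  change _ ≤ (∫⁻ y in ball x r, K * A y ∂ν) / ν (ball x r)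
  rw [ENNReal.le_div_iff_mul_le (Or.inl (hν.ball_ne_zero x r hr)) (Or.inl (hν.ball_ne_top x r)),
    ← setLIntegral_const]
  exact setLIntegral_mono' measurableSet_ball fun y hy =>
    hA.ballAvg_le (ball_subset_ball (by linarith) hy)

/-! ### Reverse Hölder inequalities for powers of A₁ functions times A_P weights -/

variable {V : X → ℝ≥0∞} {P : ℝ} {C : ℝ≥0∞}

/-- A lower bound for the integral of `A ^ (-η) * V ^ (1 / s)` over a ball, where `V` is an
`A_P(μ)` weight. -/
theorem ApBound.rpow_mul_rpow_le (hμ : IsDoubling μ D) (hV : IsPosFinite V) (hP : 1 < P)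
    (hC : C ≠ ∞) (hVP : ApBound μ P C V) (hA : IsAOne (μ.withDensity V) K A) {s η : ℝ}
    (hs : 1 < s) (hη : 0 ≤ η) (x : X) {r : ℝ} (hr : 0 < r) :
    μ (ball x r) ^ (1 - 1 / s) * μ.withDensity V (ball x r) ^ (1 / s) ≤
      C ^ (1 / s + η) * ballAvg (μ.withDensity V) A x r ^ η *
        ∫⁻ y in ball x r, A y ^ (-η) * V y ^ (1 / s) ∂μ := by
  have hs0 : 0 < s := by linarith
  have hP1 : 0 < P - 1 := by linarith
  have hν : IsDoubling (μ.withDensity V) _ := hVP.isDoubling hμ hV hP hC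
  set ν := μ.withDensity V with hνdef
  set b := μ (ball x r) with hb
  set N := ν (ball x r) with hN
  have hb0 : b ≠ 0 := hμ.ball_ne_zero x r hr
  have hbt : b ≠ ∞ := hμ.ball_ne_top x r
  have hN0 : N ≠ 0 := hν.ball_ne_zero x r hr
  have hNt : N ≠ ∞ := hν.ball_ne_top x r
  set m := ballAvg ν A x r with hm
  set J := ∫⁻ y in ball x r, A y ^ (-η) * V y ^ (1 / s) ∂μ with hJ
  set S := ∫⁻ y in ball x r, V y ^ (-(1 / (P - 1))) ∂μ with hS
  -- Z normalizes the Hölder exponents of the three functions A^{-η}V^{1/s}, AV and V^{-1/(P-1)}.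
  -- With relative exponents 1, η and (P-1)(1/s+η) their product is identically 1.
  set Z := 1 + η + (P - 1) * (1 / s + η) with hZ
  have hsη : 0 < 1 / s + η := by positivity
  have hZ0 : 0 < Z := by positivity
  have hAe : ∀ᵐ y ∂μ, A y ≠ ∞ := hV.ae_withDensity_iff.1 hA.ae_ne_top
  have hAm := hA.measurable
  have hVm := hV.measurable
  have hH : b ≤ J ^ (1 / Z) * (m * N) ^ (η / Z) * S ^ ((P - 1) * (1 / s + η) / Z) := by
    have h := ENNReal.lintegral_prod_norm_pow_le (μ := μ.restrict (ball x r))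
      (Finset.univ : Finset (Fin 3))
      (f := ![fun y => A y ^ (-η) * V y ^ (1 / s), fun y => A y * V y,
        fun y => V y ^ (-(1 / (P - 1)))])
      (p := ![1 / Z, η / Z, (P - 1) * (1 / s + η) / Z])
      (by
        intro i _
        fin_cases i
        · exact ((hAm.pow_const _).mul (hVm.pow_const _)).aemeasurable
        · exact (hAm.mul hVm).aemeasurable
        · exact (hVm.pow_const _).aemeasurable)
      (by
        simp only [Fin.sum_univ_three, Matrix.cons_val]
        rw [← add_div, ← add_div, ← hZ, div_self hZ0.ne'])
      (by
        intro i _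
        fin_cases i
        · exact (by positivity : 0 ≤ 1 / Z)
        · exact (by positivity : 0 ≤ η / Z)
        · exact (by positivity : 0 ≤ (P - 1) * (1 / s + η) / Z))
    simp only [Fin.prod_univ_three, Matrix.cons_val] at h
    have e : ∀ᵐ y ∂(μ.restrict (ball x r)),
        (A y ^ (-η) * V y ^ (1 / s)) ^ (1 / Z) * (A y * V y) ^ (η / Z) *
          (V y ^ (-(1 / (P - 1)))) ^ ((P - 1) * (1 / s + η) / Z) = 1 := by
      filter_upwards [ae_restrict_of_ae hAe] with y hy
      have hA0 := hA.ne_zero y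
      rw [ENNReal.mul_rpow_of_nonneg _ _ (by positivity),
        ENNReal.mul_rpow_of_nonneg _ _ (by positivity), ← ENNReal.rpow_mul, ← ENNReal.rpow_mul,
        ← ENNReal.rpow_mul, mul_mul_mul_comm, ← ENNReal.rpow_add _ _ hA0 hy, ← hV.rpow_add,
        mul_assoc, ← hV.rpow_add, show -η * (1 / Z) + η / Z = 0 by ring,
        show 1 / s * (1 / Z) + η / Z + -(1 / (P - 1)) * ((P - 1) * (1 / s + η) / Z) = 0 by
          field_simp
          ring, ENNReal.rpow_zero, ENNReal.rpow_zero, mul_one]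
    rw [lintegral_congr_ae e, lintegral_one, Measure.restrict_apply_univ] at h
    rwa [hm, hN, ballAvg_mul_measure hν _ _ hr, hνdef,
      setLIntegral_withDensity_mul hVm hAm measurableSet_ball]
  have hH2 : b ^ Z ≤ J * (m * N) ^ η * (S ^ (P - 1)) ^ (1 / s + η) := by
    refine (ENNReal.rpow_le_rpow hH hZ0.le).trans_eq ?_
    rw [ENNReal.mul_rpow_of_nonneg _ _ hZ0.le, ENNReal.mul_rpow_of_nonneg _ _ hZ0.le,
      ← ENNReal.rpow_mul, ← ENNReal.rpow_mul, ← ENNReal.rpow_mul, ← ENNReal.rpow_mul,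
      div_mul_cancel₀ _ hZ0.ne', div_mul_cancel₀ _ hZ0.ne', div_mul_cancel₀ _ hZ0.ne',
      ENNReal.rpow_one]
  have hAP : N * S ^ (P - 1) ≤ C * b ^ P := by
    have := hVP x r hr
    rwa [← withDensity_apply _ measurableSet_ball, ← hνdef] at this
  have hcancel0 : N ^ η * b ^ (P * (1 / s + η)) ≠ 0 := by
    simp [hN0, hNt, hb0, hbt]
  have hcancelt : N ^ η * b ^ (P * (1 / s + η)) ≠ ∞ := ENNReal.mul_ne_top
    (ENNReal.rpow_ne_top_of_nonneg hη hNt) (ENNReal.rpow_ne_top_of_nonneg (by positivity) hbt)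
  rw [← ENNReal.mul_le_mul_iff_left hcancel0 hcancelt]
  calc b ^ (1 - 1 / s) * N ^ (1 / s) * (N ^ η * b ^ (P * (1 / s + η)))
      = b ^ Z * N ^ (1 / s + η) := by
        rw [ENNReal.rpow_add _ _ hN0 hNt, show Z = (1 - 1 / s) + P * (1 / s + η) by rw [hZ]; ring,
          ENNReal.rpow_add _ _ hb0 hbt]
        ring
    _ ≤ (J * (m * N) ^ η * (S ^ (P - 1)) ^ (1 / s + η)) * N ^ (1 / s + η) :=
        mul_le_mul' hH2 le_rfl
    _ = J * (m * N) ^ η * (N * S ^ (P - 1)) ^ (1 / s + η) := by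
        rw [ENNReal.mul_rpow_of_nonneg N _ hsη.le]
        ring
    _ ≤ J * (m * N) ^ η * (C * b ^ P) ^ (1 / s + η) := by gcongr
    _ = _ := by
        rw [ENNReal.mul_rpow_of_nonneg _ _ hsη.le, ENNReal.mul_rpow_of_nonneg _ _ hη,
          ← ENNReal.rpow_mul]
        ring

/-- `(A V)^{1/s}` satisfies a reverse Hölder inequality when `A` is in `A₁(V dμ)`. -/
theorem IsAOne.isReverseHolderDoubling_rpow_mul (hμ : IsDoubling μ D) (hV : IsPosFinite V)
    (hP : 1 < P) (hC : C ≠ ∞) (hVP : ApBound μ P C V) (hK : K ≠ ∞) {s : ℝ} (hs : 1 < s) :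
    ∃ C' E' : ℝ≥0∞, C' ≠ ∞ ∧ E' ≠ ∞ ∧ ∀ A, IsAOne (μ.withDensity V) K A →
      IsReverseHolderDoubling μ s C' E' fun x => A x ^ (1 / s) * V x ^ (1 / s) := by
  have hs0 : 0 < s := by linarith
  have hs1 : 0 ≤ 1 - 1 / s := by rw [sub_nonneg, div_le_one hs0]; exact hs.le
  have hν : IsDoubling (μ.withDensity V) _ := hVP.isDoubling hμ hV hP hC
  set ν := μ.withDensity V with hνdef
  set D' := C * D ^ P
  have hD't : D' ≠ ∞ := hν.const_ne_top
  have hDt := hμ.const_ne_top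
  have h1s : 0 ≤ 1 / s := by positivity
  have hVm := hV.measurable
  have hne : ∀ {a : ℝ≥0∞} {t : ℝ}, 0 ≤ t → a ≠ ∞ → a ^ t ≠ ∞ :=
    fun ht ha => ENNReal.rpow_ne_top_of_nonneg ht ha
  refine ⟨1 ^ (1 / s) * (C ^ (1 / s) * K ^ (1 / s)),
    1 ^ (1 / s) * K ^ (1 / s) * D ^ (1 - 1 / s) * D' ^ (1 / s) * (C ^ (1 / s) * K ^ (1 / s)),
    ?_, ?_, fun A hA => ?_⟩
  · simp only [ENNReal.one_rpow, one_mul]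
    exact ENNReal.mul_ne_top (hne h1s hC) (hne h1s hK)
  · simp only [ENNReal.one_rpow, one_mul]
    exact ENNReal.mul_ne_top (ENNReal.mul_ne_top (ENNReal.mul_ne_top (hne h1s hK) (hne hs1 hDt))
      (hne h1s hD't)) (ENNReal.mul_ne_top (hne h1s hC) (hne h1s hK))
  have hAm := hA.measurable
  have hWm : Measurable fun x => A x ^ (1 / s) * V x ^ (1 / s) := by fun_prop
  refine IsReverseHolderDoubling.of_bounds hμ hν hs hWm
    (N := fun x r => ballAvg ν A x r ^ (1 / s))
    (fun x r hr => ?_) (fun x r hr => ?_) (fun x r hr => ?_)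
  · rw [← ENNReal.rpow_mul, one_div_mul_cancel hs0.ne', ENNReal.rpow_one, one_mul,
      ballAvg_mul_measure hν _ _ hr, hνdef, setLIntegral_withDensity_mul hVm hAm measurableSet_ball]
    refine le_of_eq (lintegral_congr fun y => ?_)
    rw [ENNReal.mul_rpow_of_nonneg _ _ hs0.le, ← ENNReal.rpow_mul, ← ENNReal.rpow_mul,
      one_div_mul_cancel hs0.ne', ENNReal.rpow_one, ENNReal.rpow_one]
  -- The lower bound for V^{1/s} alone, with the constant A₁ function and η = 0; afterwards A ≥ m/K
  -- on the ball, m the average of A, restores the A-factor.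
  · have h := hVP.rpow_mul_rpow_le hμ hV hP hC (isAOne_one hν) hs le_rfl x hr
    simp only [add_zero, ENNReal.rpow_zero, mul_one, ENNReal.one_rpow, one_mul] at h
    calc _ = ballAvg ν A x r ^ (1 / s) *
            (μ (ball x r) ^ (1 - 1 / s) * ν (ball x r) ^ (1 / s)) := by ring
      _ ≤ ballAvg ν A x r ^ (1 / s) * (C ^ (1 / s) * ∫⁻ y in ball x r, V y ^ (1 / s) ∂μ) := by
          refine mul_le_mul' le_rfl (h.trans_eq ?_)
          simp
      _ = C ^ (1 / s) * ∫⁻ y in ball x r, ballAvg ν A x r ^ (1 / s) * V y ^ (1 / s) ∂μ := by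
          rw [lintegral_const_mul _ (hVm.pow_const _)]
          ring
      _ ≤ C ^ (1 / s) * ∫⁻ y in ball x r, K ^ (1 / s) * (A y ^ (1 / s) * V y ^ (1 / s)) ∂μ := by
          refine mul_le_mul' le_rfl (setLIntegral_mono' measurableSet_ball fun y hy => ?_)
          rw [← mul_assoc, ← ENNReal.mul_rpow_of_nonneg K _ h1s]
          exact mul_le_mul' (ENNReal.rpow_le_rpow (hA.ballAvg_le hy) h1s) le_rfl
      _ = _ := by
          rw [lintegral_const_mul _ hWm]
          ring
  · rw [← ENNReal.mul_rpow_of_nonneg _ _ h1s]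
    exact ENNReal.rpow_le_rpow (hA.ballAvg_two_mul_le hν x hr) h1s

/-- `A^{-η} V^{1/s}` satisfies a reverse Hölder inequality when `A` is in `A₁(V dμ)`. -/
theorem IsAOne.isReverseHolderDoubling_rpow_neg_mul (hμ : IsDoubling μ D) (hV : IsPosFinite V)
    (hP : 1 < P) (hC : C ≠ ∞) (hVP : ApBound μ P C V) (hK : K ≠ ∞) {s : ℝ} (hs : 1 < s)
    {η : ℝ} (hη : 0 ≤ η) :
    ∃ C' E' : ℝ≥0∞, C' ≠ ∞ ∧ E' ≠ ∞ ∧ ∀ A, IsAOne (μ.withDensity V) K A →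
      IsReverseHolderDoubling μ s C' E' fun x => A x ^ (-η) * V x ^ (1 / s) := by
  have hs0 : 0 < s := by linarith
  have hs1 : 0 ≤ 1 - 1 / s := by rw [sub_nonneg, div_le_one hs0]; exact hs.le
  have hν : IsDoubling (μ.withDensity V) _ := hVP.isDoubling hμ hV hP hC
  set ν := μ.withDensity V with hνdef
  set D' := C * D ^ P
  have hD't : D' ≠ ∞ := hν.const_ne_top
  have hDt := hμ.const_ne_top
  have h1s : 0 ≤ 1 / s := by positivity
  have hηs : 0 ≤ η * s := by positivity
  have hVm := hV.measurable
  have hne : ∀ {a : ℝ≥0∞} {t : ℝ}, 0 ≤ t → a ≠ ∞ → a ^ t ≠ ∞ :=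
    fun ht ha => ENNReal.rpow_ne_top_of_nonneg ht ha
  -- Negative powers reverse inequalities: a lower bound for A by its average bounds A^{-η} from
  -- above, provided the average is positive and finite.
  have hneg : ∀ {a b c : ℝ≥0∞} {t : ℝ}, 0 ≤ t → c ≠ ∞ → b ≠ 0 → b ≠ ∞ → b ≤ c * a →
      a ^ (-t) ≤ c ^ t * b ^ (-t) := by
    intro a b c t ht hc hb0 hbt h
    rw [ENNReal.rpow_neg, ENNReal.inv_le_iff_inv_le, ENNReal.mul_inv
      (Or.inr (by simp [hb0, hbt])) (Or.inr (by simp [hb0, hbt])), ← ENNReal.rpow_neg,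
      ← ENNReal.rpow_neg, neg_neg, ENNReal.rpow_neg, mul_comm]
    refine ENNReal.div_le_of_le_mul ?_
    rw [mul_comm, ← ENNReal.mul_rpow_of_nonneg _ _ ht]
    gcongr
  refine ⟨(K ^ (η * s)) ^ (1 / s) * C ^ (1 / s + η),
    (K ^ (η * s)) ^ (1 / s) * D' ^ η * D ^ (1 - 1 / s) * D' ^ (1 / s) * C ^ (1 / s + η),
    ?_, ?_, fun A hA => ?_⟩
  · exact ENNReal.mul_ne_top (hne h1s (hne hηs hK)) (hne (by positivity) hC)
  · exact ENNReal.mul_ne_top (ENNReal.mul_ne_top (ENNReal.mul_ne_top (ENNReal.mul_ne_top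
      (hne h1s (hne hηs hK)) (hne hη hD't)) (hne hs1 hDt)) (hne h1s hD't))
      (hne (by positivity) hC)
  have hAm := hA.measurable
  have hWm : Measurable fun x => A x ^ (-η) * V x ^ (1 / s) := by fun_prop
  refine IsReverseHolderDoubling.of_bounds hμ hν hs hWm
    (N := fun x r => ballAvg ν A x r ^ (-η))
    (fun x r hr => ?_) (fun x r hr => ?_) (fun x r hr => ?_)
  · have hm0 := hA.ballAvg_ne_zero hν x hr
    have hmt := hA.ballAvg_ne_top x r hr
    rw [← ENNReal.rpow_mul, hνdef, withDensity_apply _ measurableSet_ball,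
      ← lintegral_const_mul _ hVm]
    refine setLIntegral_mono' measurableSet_ball fun y hy => ?_
    rw [ENNReal.mul_rpow_of_nonneg _ _ hs0.le, ← ENNReal.rpow_mul, ← ENNReal.rpow_mul,
      one_div_mul_cancel hs0.ne', ENNReal.rpow_one, neg_mul]
    gcongr
    exact hneg hηs hK hm0 hmt (hA.ballAvg_le hy)
  · have hm0 := hA.ballAvg_ne_zero hν x hr
    have hmt := hA.ballAvg_ne_top x r hr
    have h := hVP.rpow_mul_rpow_le hμ hV hP hC hA hs hη x hr
    calc _ = ballAvg ν A x r ^ (-η) *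
            (μ (ball x r) ^ (1 - 1 / s) * ν (ball x r) ^ (1 / s)) := by ring
      _ ≤ _ := mul_le_mul' le_rfl h
      _ = (ballAvg ν A x r ^ (-η) * ballAvg ν A x r ^ η) * (C ^ (1 / s + η) *
            ∫⁻ y in ball x r, A y ^ (-η) * V y ^ (1 / s) ∂μ) := by ring
      _ = _ := by
          rw [← ENNReal.rpow_add _ _ hm0 hmt, neg_add_cancel, ENNReal.rpow_zero, one_mul]
  · exact hneg hη hD't (hA.ballAvg_ne_zero hν x hr) (hA.ballAvg_ne_top x r hr)
      (ballAvg_le_mul_ballAvg_two_mul hν A x hr)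

/-- Powers of `A_r` weights that satisfy a reverse Hölder inequality. -/
theorem ApBound.rpow (hμ : IsDoubling μ D) {v : X → ℝ≥0∞} {r u : ℝ}
    {C₁ C₂ : ℝ≥0∞} (hr : 1 < r) (hu : 1 < u) (hv : ApBound μ r C₁ v)
    (hRH : ∀ x t, 0 < t → (∫⁻ y in ball x t, v y ^ u ∂μ) * μ (ball x t) ^ (u - 1)
      ≤ C₂ * (∫⁻ y in ball x t, v y ∂μ) ^ u) :
    ApBound μ (u * (r - 1) + 1) (C₂ * C₁ ^ u) fun y => v y ^ u := by
  intro x t ht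
  have hr1 : 0 < r - 1 := by linarith
  have hu0 : 0 < u := by linarith
  have h0 := hμ.ball_ne_zero x t ht
  have htop := hμ.ball_ne_top x t
  set b := μ (ball x t) with hb
  have hb0 : b ^ (u - 1) ≠ 0 := by simp [h0, htop]
  have hbt : b ^ (u - 1) ≠ ∞ := ENNReal.rpow_ne_top_of_nonneg (by linarith) htop
  have e : ∀ y, (v y ^ u) ^ (-(1 / (u * (r - 1)))) = v y ^ (-(1 / (r - 1))) := fun y => by
    rw [← ENNReal.rpow_mul]
    congr 1
    field_simp
  rw [add_sub_cancel_right]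
  simp only [e]
  set S := ∫⁻ y in ball x t, v y ^ (-(1 / (r - 1))) ∂μ with hS
  rw [← ENNReal.mul_le_mul_iff_left hb0 hbt]
  calc _ = ((∫⁻ y in ball x t, v y ^ u ∂μ) * b ^ (u - 1)) * S ^ (u * (r - 1)) := by ring
    _ ≤ (C₂ * (∫⁻ y in ball x t, v y ∂μ) ^ u) * S ^ (u * (r - 1)) :=
        mul_le_mul' (hRH x t ht) le_rfl
    _ = C₂ * ((∫⁻ y in ball x t, v y ∂μ) * S ^ (r - 1)) ^ u := by
        rw [ENNReal.mul_rpow_of_nonneg _ _ hu0.le, ← ENNReal.rpow_mul, mul_comm (r - 1) u]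
        ring
    _ ≤ C₂ * (C₁ * b ^ r) ^ u := by
        exact mul_le_mul' le_rfl (ENNReal.rpow_le_rpow (hv x t ht) hu0.le)
    _ = _ := by
        rw [ENNReal.mul_rpow_of_nonneg _ _ hu0.le, ← ENNReal.rpow_mul,
          show r * u = (u * (r - 1) + 1) + (u - 1) by ring, ENNReal.rpow_add _ _ h0 htop]
        ring

/-- If the maximal function vanishes at one point, φ vanishes a.e. on every ball about it, hence
a.e. -/
theorem maxFn_ne_zero (hν : IsDoubling ν D') {φ : X → ℝ≥0∞} (hφ : Measurable φ) {ρ : ℝ}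
    (hρ : 0 < ρ) (h : ∫⁻ x, φ x ^ ρ ∂ν ≠ 0) (x : X) : maxFn ν φ x ≠ 0 := by
  intro h0
  refine h ?_
  have hball : ∀ n : ℕ, ∀ᵐ y ∂ν, y ∈ ball x (n + 1) → φ y = 0 := by
    intro n
    have hx : x ∈ ball x (n + 1 : ℝ) := mem_ball_self (by positivity)
    have h1 := setLIntegral_mul_maxFn_ge φ hν hx
    rw [h0, zero_mul, nonpos_iff_eq_zero,
      setLIntegral_eq_zero_iff measurableSet_ball hφ] at h1
    exact h1
  rw [lintegral_eq_zero_iff (hφ.pow_const _)]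
  filter_upwards [ae_all_iff.2 hball] with y hy
  obtain ⟨n, hn⟩ := exists_nat_ge (dist y x)
  have : φ y = 0 := hy n (by rw [mem_ball]; linarith)
  simp [this, hρ]

variable [SecondCountableTopology X]

/-- The nonzero norm of φ makes the Rubio de Francia majorant positive everywhere; the finite norm
makes it finite a.e. and integrable on balls. -/
theorem exists_isAOne_majorant (hν : IsDoubling ν D') {ρ : ℝ} (hρ : 1 < ρ) :
    ∃ K : ℝ≥0∞, K ≠ ∞ ∧ ∀ φ : X → ℝ≥0∞, Measurable φ → ∫⁻ x, φ x ^ ρ ∂ν ≠ 0 →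
      ∫⁻ x, φ x ^ ρ ∂ν ≠ ∞ → ∃ A : X → ℝ≥0∞, IsAOne ν K A ∧ (∀ x, φ x ≤ A x) ∧
        ∫⁻ x, A x ^ ρ ∂ν ≤ K * ∫⁻ x, φ x ^ ρ ∂ν := by
  have hρ0 : 0 < ρ := by linarith
  obtain ⟨K, hK, H⟩ := exists_maxFn_le_majorant hν hρ
  refine ⟨K, hK, fun φ hφ h0 ht => ?_⟩
  obtain ⟨A, hAm, hφA, hMA, hAρ⟩ := H φ hφ
  have hAt : ∫⁻ x, A x ^ ρ ∂ν ≠ ∞ := ne_top_of_le_ne_top (ENNReal.mul_ne_top hK ht) hAρ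
  refine ⟨A, ⟨hAm, fun x hx => ?_, ?_, fun x r hr => ?_, hMA⟩, hφA, hAρ⟩
  · have h1 := hMA x
    rw [hx, mul_zero, nonpos_iff_eq_zero] at h1
    refine maxFn_ne_zero hν hφ hρ0 h0 x (le_antisymm ?_ zero_le)
    rw [← h1]
    exact maxFn_le fun c r hc => (ballAvg_mono hφA c r).trans (ballAvg_le_maxFn ν A hc)
  · filter_upwards [ae_lt_top (hAm.pow_const ρ) hAt] with x hx hx'
    rw [hx', ENNReal.top_rpow_of_pos hρ0] at hx
    exact lt_irrefl _ hx
  · have h2 : (∫⁻ y in ball x r, A y ∂ν) ^ ρ ≠ ∞ := by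
      refine ne_top_of_le_ne_top (ENNReal.mul_ne_top (ENNReal.rpow_ne_top_of_nonneg
        (by linarith : 0 ≤ ρ - 1) (hν.ball_ne_top x r)) hAt)
        ((rpow_setLIntegral_le hAm.aemeasurable hρ.le _).trans ?_)
      gcongr
      exact Measure.restrict_le_self
    refine ENNReal.div_ne_top (fun h3 => h2 ?_) (hν.ball_ne_zero x r hr)
    rw [h3, ENNReal.top_rpow_of_pos hρ0]

end AOne

/-! ### Extrapolation from `L²` and the bound of the vertical square function -/

section Extrapolation

open Metric Function

variable {X : Type*} [MeasurableSpace X] [PseudoMetricSpace X] [BorelSpace X]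
  [SecondCountableTopology X] {μ : Measure X} {D : ℝ≥0∞}

/-- Extrapolation to exponents below one. -/
theorem lintegral_rpow_mul_le_of_lt_one (hμ : IsDoubling μ D) {v : X → ℝ≥0∞} (hv : IsPosFinite v)
    {q s u P : ℝ} (hq : 0 < q) (hq1 : q < 1) (hs : 1 < s) (hu : 0 < u)
    (hqu : 1 - 1 / u = q * (1 - 1 / s)) (hP : 1 < P) {C : ℝ≥0∞} (hC : C ≠ ∞)
    (hA : ApBound μ P C fun x => v x ^ u) {R : (X → ℝ≥0∞) → (X → ℝ≥0∞) → Prop}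
    (hR : ∀ C E : ℝ≥0∞, C ≠ ∞ → E ≠ ∞ → ∃ K : ℝ≥0∞, K ≠ ∞ ∧ ∀ W, IsReverseHolderDoubling μ s C E W →
      ∀ f h, R f h → ∫⁻ x, f x * W x ∂μ ≤ K * ∫⁻ x, h x * W x ∂μ) :
    ∃ K : ℝ≥0∞, K ≠ ∞ ∧ ∀ f h, Measurable f → Measurable h → R f h →
      ∫⁻ x, f x ^ q * v x ∂μ ≤ K * ∫⁻ x, h x ^ q * v x ∂μ := by
  have hs0 : 0 < s := by linarith
  have hV := hv.rpow u
  have hν := hA.isDoubling hμ hV hP hC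
  obtain ⟨K₀, hK₀, hmaj⟩ := exists_isAOne_majorant hν one_lt_two
  -- The exponent η for which A^{2/q} A^{-η} = A².
  have hη : 0 ≤ 2 * (1 - q) / q := div_nonneg (by linarith) hq.le
  obtain ⟨C₁, E₁, hC₁, hE₁, hW₁⟩ :=
    IsAOne.isReverseHolderDoubling_rpow_mul hμ hV hP hC hA ENNReal.one_ne_top hs
  obtain ⟨C₂, E₂, hC₂, hE₂, hW₂⟩ :=
    IsAOne.isReverseHolderDoubling_rpow_neg_mul hμ hV hP hC hA hK₀ hs hη
  obtain ⟨K₁, hK₁, H₁⟩ := hR C₁ E₁ hC₁ hE₁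
  obtain ⟨K₂, hK₂, H₂⟩ := hR C₂ E₂ hC₂ hE₂
  refine ⟨K₂ ^ q * K₀ + 1, by finiteness, fun f h hf hh hfh => ?_⟩
  set I := ∫⁻ x, h x ^ q * v x ∂μ with hI
  have hvm := hv.measurable
  -- A majorant needs a nonzero norm. If I = 0 then h = 0 a.e., and the L² hypothesis with A = 1
  -- forces f = 0 a.e.
  rcases eq_or_ne I 0 with hI0 | hI0
  · rw [hI, lintegral_eq_zero_iff (by fun_prop)] at hI0
    have h1 := H₁ _ (hW₁ _ (isAOne_one hν)) f h hfh
    have h2 : ∫⁻ x, h x * ((1 : ℝ≥0∞) ^ (1 / s) * (v x ^ u) ^ (1 / s)) ∂μ = 0 := by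
      rw [lintegral_eq_zero_iff (by fun_prop)]
      filter_upwards [hI0] with x hx
      have : h x = 0 := by simpa [hv.ne_zero x, hq, hq.le, hq.not_gt] using hx
      simp [this]
    rw [h2, mul_zero, nonpos_iff_eq_zero, lintegral_eq_zero_iff (by fun_prop)] at h1
    have h3 : ∫⁻ x, f x ^ q * v x ∂μ = 0 := by
      rw [lintegral_eq_zero_iff (by fun_prop)]
      filter_upwards [h1] with x hx
      have : f x = 0 := by
        simpa [hv.ne_zero x, hv.ne_top x] using hx
      simp [this, hq]
    rw [h3]
    exact zero_le
  rcases eq_or_ne I ∞ with hIt | hIt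
  · rw [hIt, ENNReal.mul_top (by simp)]
    exact le_top
  -- Normalized so that φ² v^u = h^q v. The majorant A of φ yields W with hW ≤ A²v^u and f^q v =
  -- (fW)^q (A²v^u)^{1-q}, which is the form Hölder needs.
  set φ : X → ℝ≥0∞ := fun x => h x ^ (q / 2) * v x ^ ((1 - u) / 2) with hφ
  have hφm : Measurable φ := (hh.pow_const _).mul (hvm.pow_const _)
  have hφ2 : ∫⁻ x, φ x ^ (2 : ℝ) ∂(μ.withDensity fun x => v x ^ u) = I := by
    rw [lintegral_withDensity_mul (hvm.pow_const _) (hφm.pow_const _)]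
    refine lintegral_congr fun x => ?_
    rw [hφ, ENNReal.mul_rpow_of_nonneg _ _ zero_le_two, ← ENNReal.rpow_mul, ← ENNReal.rpow_mul,
      mul_assoc, ← hv.rpow_add, div_mul_cancel₀ _ two_ne_zero, div_mul_cancel₀ _ two_ne_zero,
      sub_add_cancel, ENNReal.rpow_one]
  obtain ⟨A, hAA, hφA, hAI⟩ := hmaj φ hφm (by rwa [hφ2]) (by rwa [hφ2])
  rw [hφ2, lintegral_withDensity_mul (hvm.pow_const _) (hAA.measurable.pow_const _)] at hAI
  have hAm := hAA.measurable
  have hAt : ∀ᵐ x ∂μ, A x ≠ ∞ := hV.ae_withDensity_iff.1 hAA.ae_ne_top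
  have e₁ : (u - 1) / q + u * (1 / s) = u := by
    field_simp at hqu ⊢
    linarith
  have e₂ : u * (1 / s) * q + u * (1 - q) = 1 := by
    field_simp at hqu ⊢
    linarith
  set W : X → ℝ≥0∞ := fun x => A x ^ (-(2 * (1 - q) / q)) * (v x ^ u) ^ (1 / s) with hW
  have hWm : Measurable W := (hAm.pow_const _).mul ((hvm.pow_const _).pow_const _)
  have hle : ∀ᵐ x ∂μ, h x * W x ≤ A x ^ (2 : ℝ) * v x ^ u := by
    filter_upwards [hAt] with x hx
    have hA0 := hAA.ne_zero x
    have h1 : h x ≤ A x ^ (2 / q) * v x ^ ((u - 1) / q) := by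
      calc h x = (φ x * v x ^ ((u - 1) / 2)) ^ (2 / q) := by
            rw [hφ, mul_assoc, ← hv.rpow_add, show (1 - u) / 2 + (u - 1) / 2 = 0 by ring,
              ENNReal.rpow_zero, mul_one, ← ENNReal.rpow_mul,
              show q / 2 * (2 / q) = 1 by field_simp, ENNReal.rpow_one]
        _ ≤ (A x * v x ^ ((u - 1) / 2)) ^ (2 / q) :=
            ENNReal.rpow_le_rpow (mul_le_mul' (hφA x) le_rfl) (by positivity)
        _ = _ := by
            rw [ENNReal.mul_rpow_of_nonneg _ _ (by positivity), ← ENNReal.rpow_mul]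
            congr 2
            field_simp
    calc _ ≤ (A x ^ (2 / q) * v x ^ ((u - 1) / q)) * W x := mul_le_mul' h1 le_rfl
      _ = (A x ^ (2 / q) * A x ^ (-(2 * (1 - q) / q))) *
            (v x ^ ((u - 1) / q) * (v x ^ u) ^ (1 / s)) := by rw [hW]; ring
      _ = _ := by
          rw [← ENNReal.rpow_add _ _ hA0 hx, ← ENNReal.rpow_mul, ← hv.rpow_add, e₁]
          congr 2
          field_simp
          ring
  have heq : ∀ᵐ x ∂μ, f x ^ q * v x = (f x * W x) ^ q * (A x ^ (2 : ℝ) * v x ^ u) ^ (1 - q) := by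
    filter_upwards [hAt] with x hx
    have hA0 := hAA.ne_zero x
    have hq1' : 0 ≤ 1 - q := by linarith
    rw [ENNReal.mul_rpow_of_nonneg _ _ hq.le, ENNReal.mul_rpow_of_nonneg _ _ hq1', hW,
      ENNReal.mul_rpow_of_nonneg _ _ hq.le]
    simp only [← ENNReal.rpow_mul]
    calc _ = f x ^ q * (A x ^ (0 : ℝ) * v x ^ (1 : ℝ)) := by simp
      _ = f x ^ q * (A x ^ (-(2 * (1 - q) / q) * q + 2 * (1 - q)) *
            v x ^ (u * (1 / s) * q + u * (1 - q))) := by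
          rw [e₂]
          congr 3
          field_simp
          ring
      _ = _ := by
          rw [ENNReal.rpow_add _ _ hA0 hx, hv.rpow_add]
          ring
  calc ∫⁻ x, f x ^ q * v x ∂μ
      = ∫⁻ x, (f x * W x) ^ q * (A x ^ (2 : ℝ) * v x ^ u) ^ (1 - q) ∂μ := lintegral_congr_ae heq
    _ ≤ (∫⁻ x, f x * W x ∂μ) ^ q * (∫⁻ x, A x ^ (2 : ℝ) * v x ^ u ∂μ) ^ (1 - q) :=
        ENNReal.lintegral_mul_norm_pow_le (by fun_prop) (by fun_prop) hq.le (by linarith) (by ring)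
    _ ≤ (K₂ * (K₀ * I)) ^ q * (K₀ * I) ^ (1 - q) := by
        refine mul_le_mul' (ENNReal.rpow_le_rpow ?_ hq.le) (ENNReal.rpow_le_rpow hAI (by linarith))
        exact (H₂ W (hW₂ A hAA) f h hfh).trans
          (mul_le_mul' le_rfl ((lintegral_mono_ae hle).trans hAI))
    _ = K₂ ^ q * (K₀ * I) := by
        rw [ENNReal.mul_rpow_of_nonneg _ _ hq.le, mul_assoc,
          ← ENNReal.rpow_add_of_nonneg _ _ hq.le (by linarith), add_sub_cancel, ENNReal.rpow_one]
    _ ≤ (K₂ ^ q * K₀ + 1) * I := by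
        rw [← mul_assoc]
        exact mul_le_mul' le_self_add le_rfl

/-- Extrapolation to exponents above one. -/
theorem lintegral_rpow_mul_le_of_one_lt (hμ : IsDoubling μ D) {v : X → ℝ≥0∞} (hv : IsPosFinite v)
    {D' : ℝ≥0∞} (hv' : IsDoubling (μ.withDensity v) D')
    {q s u P : ℝ} (hq1 : 1 < q) (hs : 1 < s) (hu : 0 < u)
    (hqu : 1 - 1 / u = q * (1 - 1 / s)) (hP : 1 < P) {C : ℝ≥0∞} (hC : C ≠ ∞)
    (hA : ApBound μ P C fun x => v x ^ u) {R : (X → ℝ≥0∞) → (X → ℝ≥0∞) → Prop}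
    (hR : ∀ C E : ℝ≥0∞, C ≠ ∞ → E ≠ ∞ → ∃ K : ℝ≥0∞, K ≠ ∞ ∧ ∀ W, IsReverseHolderDoubling μ s C E W →
      ∀ f h, R f h → ∫⁻ x, f x * W x ∂μ ≤ K * ∫⁻ x, h x * W x ∂μ) :
    ∃ K : ℝ≥0∞, K ≠ ∞ ∧ ∀ f h, Measurable f → Measurable h → R f h →
      ∫⁻ x, f x ^ q * v x ∂μ ≤ K * ∫⁻ x, h x ^ q * v x ∂μ := by
  have hs0 : 0 < s := by linarith
  have hq0 : 0 < q := by linarith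
  have hV := hv.rpow u
  have hν := hA.isDoubling hμ hV hP hC
  have hsf : SigmaFinite (μ.withDensity v) := hv'.sigmaFinite
  set q' := q / (q - 1) with hq'
  have hqq : q.HolderConjugate q' := Real.HolderConjugate.conjExponent hq1
  have hq'0 : 0 < q' := hqq.symm.pos
  have hinv : 1 / q' = 1 - 1 / q := by
    have := hqq.inv_add_inv_eq_one
    simp only [one_div]
    linarith
  -- The relation between q, s and u gives q(1 - 1/s) = 1 - 1/u < 1, that is, s < q', so a majorant
  -- exists in L^{q'/s}.
  have hρ : 1 < q' / s := by
    have hu1 : 0 < 1 / u := by positivity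
    have : 1 / q' < 1 / s := by
      rw [hinv]
      have h1 : 1 - 1 / s < 1 / q := by
        rw [lt_div_iff₀ hq0]
        linarith
      linarith
    rw [one_lt_div hs0]
    exact (one_div_lt_one_div hq'0 hs0).1 this
  obtain ⟨K₀, hK₀, hmaj⟩ := exists_isAOne_majorant hν hρ
  obtain ⟨C₁, E₁, hC₁, hE₁, hW₁⟩ := IsAOne.isReverseHolderDoubling_rpow_mul hμ hV hP hC hA hK₀ hs
  obtain ⟨K, hK, H⟩ := hR C₁ E₁ hC₁ hE₁
  refine ⟨(K * K₀ ^ (1 / q')) ^ q, by finiteness, fun f h hf hh hfh => ?_⟩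
  set I := ∫⁻ x, h x ^ q * v x ∂μ with hI
  have hvm := hv.measurable
  have hu' : u * (1 - q * (1 - 1 / s)) = 1 := by
    rw [← hqu]
    field_simp
    ring
  have e₁ : (s - u) * (q' / s) + u = 1 := by
    have hq1' : q - 1 ≠ 0 := by linarith
    rw [hq']
    field_simp at hu' ⊢
    linarith
  have e₂ : 1 / q + u * (1 / q') = u * (1 / s) := by
    rw [hinv]
    field_simp at hu' ⊢
    linarith
  have hIe : (I ^ (1 / q)) ^ q = I := by
    rw [← ENNReal.rpow_mul, one_div_mul_cancel hq0.ne', ENNReal.rpow_one]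
  have key : ∫⁻ x, f x ^ q ∂(μ.withDensity v) ≤ (K * K₀ ^ (1 / q') * I ^ (1 / q)) ^ q := by
    refine lintegral_rpow_le_of_forall_lintegral_mul_le hqq hf fun φ hφ h0 ht => ?_
    set J := ∫⁻ x, φ x ^ q' ∂(μ.withDensity v) with hJ
    -- Chosen so that (ψ v^u)^{1/s} = φv, while the L^{q'/s}(v^u dμ) integral of ψ equals the
    -- L^{q'}(v dμ) integral of φ.
    set ψ : X → ℝ≥0∞ := fun x => φ x ^ s * v x ^ (s - u) with hψ
    have hψm : Measurable ψ := (hφ.pow_const _).mul (hvm.pow_const _)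
    have hψJ : ∫⁻ x, ψ x ^ (q' / s) ∂(μ.withDensity fun x => v x ^ u) = J := by
      rw [lintegral_withDensity_mul (hvm.pow_const _) (hψm.pow_const _), hJ,
        lintegral_withDensity_mul hvm (hφ.pow_const _)]
      refine lintegral_congr fun x => ?_
      rw [hψ, ENNReal.mul_rpow_of_nonneg _ _ (by positivity), ← ENNReal.rpow_mul,
        ← ENNReal.rpow_mul, mul_assoc, ← hv.rpow_add, e₁, mul_div_cancel₀ _ hs0.ne',
        ENNReal.rpow_one]
    obtain ⟨A, hAA, hψA, hAJ⟩ := hmaj ψ hψm (by rwa [hψJ]) (by rwa [hψJ])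
    rw [hψJ, lintegral_withDensity_mul (hvm.pow_const _) (hAA.measurable.pow_const _)] at hAJ
    have hAm := hAA.measurable
    set W : X → ℝ≥0∞ := fun x => A x ^ (1 / s) * (v x ^ u) ^ (1 / s) with hW
    have hφW : ∀ x, φ x * v x ≤ W x := fun x => by
      rw [hW]
      refine le_trans (le_of_eq ?_) (mul_le_mul' (ENNReal.rpow_le_rpow (hψA x)
        (by positivity : 0 ≤ 1 / s)) le_rfl)
      rw [hψ, ENNReal.mul_rpow_of_nonneg _ _ (by positivity), ← ENNReal.rpow_mul,
        ← ENNReal.rpow_mul, ← ENNReal.rpow_mul, mul_assoc, ← hv.rpow_add,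
        mul_one_div_cancel hs0.ne', ENNReal.rpow_one,
        show (s - u) * (1 / s) + u * (1 / s) = 1 by field_simp; ring, ENNReal.rpow_one]
    have heq : ∀ x, h x * W x = (h x ^ q * v x) ^ (1 / q) *
        (A x ^ (q' / s) * v x ^ u) ^ (1 / q') := fun x => by
      have h1 : (0 : ℝ) ≤ 1 / q := by positivity
      have h2 : (0 : ℝ) ≤ 1 / q' := by positivity
      rw [hW, ENNReal.mul_rpow_of_nonneg _ _ h1, ENNReal.mul_rpow_of_nonneg _ _ h2]
      simp only [← ENNReal.rpow_mul]
      rw [← e₂, hv.rpow_add, mul_one_div_cancel hq0.ne', ENNReal.rpow_one,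
        show q' / s * (1 / q') = 1 / s by field_simp]
      ring
    calc ∫⁻ x, f x * φ x ∂(μ.withDensity v) = ∫⁻ x, f x * φ x * v x ∂μ :=
          lintegral_withDensity_mul hvm (hf.mul hφ)
      _ ≤ ∫⁻ x, f x * W x ∂μ := lintegral_mono fun x => by
          rw [mul_assoc]
          exact mul_le_mul' le_rfl (hφW x)
      _ ≤ K * ∫⁻ x, h x * W x ∂μ := H W (hW₁ A hAA) f h hfh
      _ ≤ K * (I ^ (1 / q) * (K₀ * J) ^ (1 / q')) := by
          refine mul_le_mul' le_rfl ?_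
          simp only [heq]
          refine (ENNReal.lintegral_mul_norm_pow_le (by fun_prop) (by fun_prop) (by positivity)
            (by positivity) (by rw [hinv]; ring)).trans ?_
          exact mul_le_mul' le_rfl (ENNReal.rpow_le_rpow hAJ (by positivity))
      _ = _ := by
          rw [ENNReal.mul_rpow_of_nonneg _ _ (by positivity)]
          ring
  rw [lintegral_withDensity_mul hvm (hf.pow_const _),
    ENNReal.mul_rpow_of_nonneg _ _ hq0.le, hIe] at key
  exact key

/-- The vertical square function is controlled by the conical one in `L^p(v dμ)`, `0 < p < q₀`,
for `v^u ∈ A_P(μ)`, `u = (q₀/p)'`. -/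
theorem lintegral_verticalSq_rpow_le (hμ : IsDoubling μ D) {v : X → ℝ≥0∞} (hv : IsPosFinite v)
    {D' : ℝ≥0∞} (hv' : IsDoubling (μ.withDensity v) D') {q₀ p P : ℝ} (hq₀ : 2 < q₀) (hp : 0 < p)
    (hpq : p < q₀) (hP : 1 < P) {C : ℝ≥0∞} (hC : C ≠ ∞)
    (hA : ApBound μ P C fun x => v x ^ (q₀ / (q₀ - p))) {a : ℝ} (ha : 1 / 2 ≤ a) (ha1 : a ≤ 1)
    (M : ℝ≥0) {c : ℝ} (hc : 0 < c) :
    ∃ K : ℝ≥0∞, K ≠ ∞ ∧ ∀ g : X → ℝ → ℝ≥0∞, Measurable (uncurry g) →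
      ScaleOffDiagonal μ a 2 q₀ M c g →
        ∫⁻ x, verticalSq g x ^ (p / 2) * v x ∂μ ≤ K * ∫⁻ x, conicalSq μ g x ^ (p / 2) * v x ∂μ := by
  have hsf : SigmaFinite μ := hμ.sigmaFinite
  have hq0 : 0 < q₀ := by linarith
  have hq2 : 0 < q₀ - 2 := by linarith
  have hqp : 0 < q₀ - p := by linarith
  have hs : 1 < q₀ / (q₀ - 2) := by rw [one_lt_div hq2]; linarith
  have hu : 0 < q₀ / (q₀ - p) := by positivity
  have hqu : 1 - 1 / (q₀ / (q₀ - p)) = p / 2 * (1 - 1 / (q₀ / (q₀ - 2))) := by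
    field_simp
    ring
  have hR : ∀ C E : ℝ≥0∞, C ≠ ∞ → E ≠ ∞ → ∃ K : ℝ≥0∞, K ≠ ∞ ∧
      ∀ W, IsReverseHolderDoubling μ (q₀ / (q₀ - 2)) C E W → ∀ f h,
        (∃ g : X → ℝ → ℝ≥0∞, Measurable (uncurry g) ∧ ScaleOffDiagonal μ a 2 q₀ M c g ∧
          f = verticalSq g ∧ h = conicalSq μ g) →
        ∫⁻ x, f x * W x ∂μ ≤ K * ∫⁻ x, h x * W x ∂μ := fun C E hC hE => by
    obtain ⟨K, hK, H⟩ := lintegral_verticalSq_mul_le hμ hq₀ ha ha1 M hc hC hE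
    refine ⟨K, hK, ?_⟩
    rintro W hW _ _ ⟨g, hg, hgo, rfl, rfl⟩
    exact H W hW g hg hgo
  rcases lt_trichotomy (p / 2) 1 with h1 | h1 | h1
  · obtain ⟨K, hK, H⟩ := lintegral_rpow_mul_le_of_lt_one hμ hv (by positivity) h1 hs hu hqu hP hC
      hA hR
    exact ⟨K, hK, fun g hg hgo => H _ _ (measurable_verticalSq hg) (measurable_conicalSq hg)
      ⟨g, hg, hgo, rfl, rfl⟩⟩
  -- For p = 2, u = s, so the weight built from the constant A₁ function is v itself.
  · have hV := hv.rpow (q₀ / (q₀ - p))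
    have hν := hA.isDoubling hμ hV hP hC
    obtain ⟨C₁, E₁, hC₁, hE₁, hW₁⟩ :=
      IsAOne.isReverseHolderDoubling_rpow_mul hμ hV hP hC hA ENNReal.one_ne_top hs
    obtain ⟨K, hK, H⟩ := hR C₁ E₁ hC₁ hE₁
    have hp2 : p = 2 := by linarith
    refine ⟨K, hK, fun g hg hgo => ?_⟩
    have := H _ (hW₁ _ (isAOne_one hν)) _ _ ⟨g, hg, hgo, rfl, rfl⟩
    have hus : q₀ / (q₀ - p) * (1 / (q₀ / (q₀ - 2))) = 1 := by
      rw [hp2]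
      field_simp
    simpa only [← ENNReal.rpow_mul, hus, ENNReal.rpow_one, ENNReal.one_rpow, one_mul, h1] using this
  · obtain ⟨K, hK, H⟩ := lintegral_rpow_mul_le_of_one_lt hμ hv hv' h1 hs hu hqu hP hC hA hR
    exact ⟨K, hK, fun g hg hgo => H _ _ (measurable_verticalSq hg) (measurable_conicalSq hg)
      ⟨g, hg, hgo, rfl, rfl⟩⟩

end Extrapolation

/-! ### Weights on `ℝⁿ` -/

section EuclideanWeights

open Metric Function

variable {n : ℕ}

theorem isDoubling_volume (n : ℕ) :
    IsDoubling (volume : Measure (Rn n)) (ENNReal.ofReal (2 ^ n)) where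
  const_ne_top := ENNReal.ofReal_ne_top
  ball_ne_zero x r hr := (measure_ball_pos _ x hr).ne'
  ball_ne_top x r := measure_ball_lt_top.ne
  ball_two_mul_le x r hr := by
    rw [Measure.addHaar_ball_of_pos _ x hr,
      Measure.addHaar_ball_of_pos _ x (by positivity : 0 < 2 * r),
      ← mul_assoc, ← ENNReal.ofReal_mul (by positivity), mul_pow]
    simp

variable {μ : Measure (Rn n)} {D : ℝ≥0∞} {v : Rn n → ℝ} {v' : Rn n → ℝ≥0∞}

/-- Changing v on a null set to the value 1 makes it positive and finite everywhere, so its powers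
can be multiplied freely at every point. -/
theorem IsWeight.exists_isPosFinite (h : IsWeight μ v) :
    ∃ v' : Rn n → ℝ≥0∞, IsPosFinite v' ∧ (fun x => ENNReal.ofReal (v x)) =ᵐ[μ] v' := by
  have hm := h.locallyIntegrable.aestronglyMeasurable.aemeasurable
  have hu : Measurable (hm.mk v) := hm.measurable_mk
  refine ⟨fun x => if 0 < hm.mk v x then ENNReal.ofReal (hm.mk v x) else 1,
    ⟨Measurable.ite (measurableSet_lt measurable_const hu) hu.ennreal_ofReal measurable_const,
      fun x => ?_, fun x => ?_⟩, ?_⟩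
  · split_ifs with hx
    · simpa using hx
    · simp
  · split_ifs <;> simp
  · filter_upwards [hm.ae_eq_mk, h.pos] with x h1 h2
    rw [← h1, if_pos h2]

theorem weighted_eq_withDensity (h : (fun x => ENNReal.ofReal (v x)) =ᵐ[μ] v') :
    weighted μ v = μ.withDensity v' :=
  withDensity_congr_ae h

theorem setLAverage_ball_congr (h : (fun x => ENNReal.ofReal (v x)) =ᵐ[μ] v') (s : ℝ) (x : Rn n)
    (r : ℝ) :
    ⨍⁻ y in ball x r, ENNReal.ofReal (v y) ^ s ∂μ = ballAvg μ (fun y => v' y ^ s) x r := by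
  rw [setLAverage_eq, ballAvg]
  congr 1
  refine lintegral_congr_ae (ae_restrict_of_ae ?_)
  filter_upwards [h] with y hy
  rw [hy]

theorem setLAverage_ball_congr' (h : (fun x => ENNReal.ofReal (v x)) =ᵐ[μ] v') (x : Rn n) (r : ℝ) :
    ⨍⁻ y in ball x r, ENNReal.ofReal (v y) ∂μ = ballAvg μ v' x r := by
  simpa using setLAverage_ball_congr h 1 x r

theorem apBound_apConst (hμ : IsDoubling μ D) (h : (fun x => ENNReal.ofReal (v x)) =ᵐ[μ] v')
    {p : ℝ} (hp : 1 < p) : ApBound μ p (apConst μ p v) v' := by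
  intro x r hr
  have h0 := hμ.ball_ne_zero x r hr
  have ht := hμ.ball_ne_top x r
  have hp1 : 0 < p - 1 := by linarith
  have key : ballAvg μ v' x r * ballAvg μ (fun y => v' y ^ (-(1 / (p - 1)))) x r ^ (p - 1) ≤
      apConst μ p v := by
    have e : 1 - p.conjExponent = -(1 / (p - 1)) := by
      rw [Real.conjExponent]
      field_simp
      ring
    rw [← setLAverage_ball_congr h, ← setLAverage_ball_congr' h, apConst, if_neg hp.ne', e]
    exact le_iSup_of_le x (le_iSup_of_le r (le_iSup_of_le hr le_rfl))
  rw [← ballAvg_mul_measure hμ v' x hr, ← ballAvg_mul_measure hμ _ x hr,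
    ENNReal.mul_rpow_of_nonneg _ _ hp1.le]
  calc _ = ballAvg μ v' x r * ballAvg μ (fun y => v' y ^ (-(1 / (p - 1)))) x r ^ (p - 1) *
        (μ (ball x r) ^ (1 : ℝ) * μ (ball x r) ^ (p - 1)) := by rw [ENNReal.rpow_one]; ring
    _ ≤ _ := by
      rw [← ENNReal.rpow_add _ _ h0 ht, add_sub_cancel]
      exact mul_le_mul' key le_rfl

/-- A₁ is contained in A₂, because 1/v is at most its essential supremum on the ball. This brings
the endpoint of A_∞ into the range P > 1. -/
theorem apBound_two_apConst_one (hμ : IsDoubling μ D)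
    (h : (fun x => ENNReal.ofReal (v x)) =ᵐ[μ] v') : ApBound μ 2 (apConst μ 1 v) v' := by
  intro x r hr
  have key : ballAvg μ v' x r * essSup (fun y => (v' y)⁻¹) (μ.restrict (ball x r)) ≤
      apConst μ 1 v := by
    have e : essSup (fun y => (v' y)⁻¹) (μ.restrict (ball x r)) =
        essSup (fun y => (ENNReal.ofReal (v y))⁻¹) (μ.restrict (ball x r)) := by
      refine essSup_congr_ae (ae_restrict_of_ae ?_)
      filter_upwards [h] with y hy
      rw [hy]
    rw [e, ← setLAverage_ball_congr' h, apConst, if_pos rfl]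
    exact le_iSup_of_le x (le_iSup_of_le r (le_iSup_of_le hr le_rfl))
  have h2 : ∫⁻ y in ball x r, v' y ^ (-(1 / ((2 : ℝ) - 1))) ∂μ ≤
      essSup (fun y => (v' y)⁻¹) (μ.restrict (ball x r)) * μ (ball x r) := by
    rw [← setLIntegral_const]
    refine lintegral_mono_ae ?_
    filter_upwards [ENNReal.ae_le_essSup (μ := μ.restrict (ball x r)) fun y => (v' y)⁻¹] with y hy
    rwa [show -(1 / ((2 : ℝ) - 1)) = -1 by norm_num, ENNReal.rpow_neg_one]
  rw [show (2 : ℝ) - 1 = 1 by norm_num] at h2 ⊢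
  rw [ENNReal.rpow_one, ENNReal.rpow_two, ← ballAvg_mul_measure hμ v' x hr]
  calc _ ≤ ballAvg μ v' x r * μ (ball x r) *
        (essSup (fun y => (v' y)⁻¹) (μ.restrict (ball x r)) * μ (ball x r)) := mul_le_mul' le_rfl h2
    _ = ballAvg μ v' x r * essSup (fun y => (v' y)⁻¹) (μ.restrict (ball x r)) *
        μ (ball x r) ^ 2 := by ring
    _ ≤ _ := mul_le_mul' key le_rfl

theorem MemAinfty.exists_apBound (hμ : IsDoubling μ D) (hv : MemAinfty μ v)
    (h : (fun x => ENNReal.ofReal (v x)) =ᵐ[μ] v') :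
    ∃ P C, 1 < P ∧ C ≠ ∞ ∧ ApBound μ P C v' := by
  obtain ⟨p, hp, -, hC⟩ := hv
  rcases hp.eq_or_lt with rfl | hp
  · exact ⟨2, _, one_lt_two, hC.ne, apBound_two_apConst_one hμ h⟩
  · exact ⟨p, _, hp, hC.ne, apBound_apConst hμ h hp⟩

theorem MemAinfty.isWeight (hv : MemAinfty μ v) : IsWeight μ v := by
  obtain ⟨p, -, hv, -⟩ := hv
  exact hv

theorem setLIntegral_rpow_mul_le_rhConst (hμ : IsDoubling μ D)
    {D' : ℝ≥0∞} (hμv : IsDoubling (μ.withDensity v') D') (hv' : IsPosFinite v')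
    (h : (fun x => ENNReal.ofReal (v x)) =ᵐ[μ] v') {u : ℝ} (hu : 1 < u) (x : Rn n) {r : ℝ}
    (hr : 0 < r) :
    (∫⁻ y in ball x r, v' y ^ u ∂μ) * μ (ball x r) ^ (u - 1) ≤
      rhConst μ u v ^ u * (∫⁻ y in ball x r, v' y ∂μ) ^ u := by
  have hu0 : 0 < u := by linarith
  have h0 := hμ.ball_ne_zero x r hr
  have ht := hμ.ball_ne_top x r
  have hI0 := hμ.setLIntegral_ne_zero hv' x hr
  have hIt := hμv.ball_ne_top x r
  rw [withDensity_apply _ measurableSet_ball] at hIt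
  have key : ballAvg μ (fun y => v' y ^ u) x r ^ (1 / u) ≤ rhConst μ u v * ballAvg μ v' x r := by
    have hb0 : ballAvg μ v' x r ≠ 0 := by simp [ballAvg, hI0, ht]
    have hbt : ballAvg μ v' x r ≠ ∞ := ENNReal.div_ne_top hIt h0
    rw [mul_comm, ← ENNReal.inv_mul_le_iff hb0 hbt, ← setLAverage_ball_congr h,
      ← setLAverage_ball_congr' h]
    exact le_iSup_of_le x (le_iSup_of_le r (le_iSup_of_le hr le_rfl))
  have key2 := ENNReal.rpow_le_rpow key hu0.le
  rw [← ENNReal.rpow_mul, one_div_mul_cancel hu0.ne', ENNReal.rpow_one,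
    ENNReal.mul_rpow_of_nonneg _ _ hu0.le] at key2
  rw [← ballAvg_mul_measure hμ v' x hr, ← ballAvg_mul_measure hμ _ x hr,
    ENNReal.mul_rpow_of_nonneg _ _ hu0.le]
  calc _ = ballAvg μ (fun y => v' y ^ u) x r *
        (μ (ball x r) ^ (1 : ℝ) * μ (ball x r) ^ (u - 1)) := by rw [ENNReal.rpow_one]; ring
    _ ≤ rhConst μ u v ^ u * ballAvg μ v' x r ^ u * μ (ball x r) ^ u := by
      rw [← ENNReal.rpow_add _ _ h0 ht, add_sub_cancel]
      exact mul_le_mul' key2 le_rfl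
    _ = _ := by ring

end EuclideanWeights

/-! ### Reduction to measurable square functions -/

section Reduction

open Metric Function

variable {n : ℕ}

/-- A Borel representative agrees a.e. on the half-space. Fubini gives both orders of "almost
every": the vertical function needs y first, the conical one t first. -/
theorem Admissible.exists_measurable_enorm {D : Submodule ℂ (Rn n → ℂ)}
    {T : ℝ → (Rn n → ℂ) → (Rn n → ℂ)} {F : Rn n → ℝ → ℂ} (h : Admissible D T F) :
    ∃ g : Rn n → ℝ → ℝ≥0∞, Measurable (uncurry g) ∧
      (∀ᵐ y, ∀ᵐ t ∂scaleMeasure, ‖T (t ^ 2) (fun z => F z t) y‖ₑ = g y t) ∧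
      ∀ᵐ t ∂scaleMeasure, ∀ᵐ y, ‖T (t ^ 2) (fun z => F z t) y‖ₑ = g y t := by
  have hm := h.measurable_TF
  have hs : scaleMeasure ≪ volume.restrict (Ioi (0 : ℝ)) := withDensity_absolutelyContinuous _ _
  have hprod : halfSpace n = (volume : Measure (Rn n)).prod (volume.restrict (Ioi 0)) := by
    rw [halfSpace, Measure.volume_eq_prod, ← Measure.prod_restrict, Measure.restrict_univ]
  have hae : ∀ᵐ z ∂(volume : Measure (Rn n)).prod (volume.restrict (Ioi (0 : ℝ))),
      ‖T (z.2 ^ 2) (fun y => F y z.2) z.1‖ₑ = ‖hm.mk _ z‖ₑ := by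
    rw [← hprod]
    filter_upwards [hm.ae_eq_mk] with z hz
    rw [← hz]
  refine ⟨fun y t => ‖hm.mk _ (y, t)‖ₑ, hm.stronglyMeasurable_mk.measurable.enorm, ?_, ?_⟩
  · filter_upwards [Measure.ae_ae_of_ae_prod hae] with y hy
    exact hs.ae_le hy
  · refine hs.ae_le ?_
    have := (Measure.measurePreserving_swap.quasiMeasurePreserving).ae hae
    exact Measure.ae_ae_of_ae_prod this

theorem vertical_ae_eq {T : ℝ → (Rn n → ℂ) → (Rn n → ℂ)} {F : Rn n → ℝ → ℂ}
    {g : Rn n → ℝ → ℝ≥0∞} {μ : Measure (Rn n)}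
    (h : ∀ᵐ y ∂μ, ∀ᵐ t ∂scaleMeasure, ‖T (t ^ 2) (fun z => F z t) y‖ₑ = g y t) :
    vertical T F =ᵐ[μ] fun x => verticalSq g x ^ (1 / 2 : ℝ) := by
  filter_upwards [h] with x hx
  rw [vertical, ← lintegral_scaleMeasure, verticalSq]
  congr 1
  refine lintegral_congr_ae ?_
  filter_upwards [hx] with t ht
  rw [ht, ENNReal.rpow_two]

theorem conical_eq {w : Rn n → ℝ} {T : ℝ → (Rn n → ℂ) → (Rn n → ℂ)} {F : Rn n → ℝ → ℂ}
    {g : Rn n → ℝ → ℝ≥0∞}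
    (h : ∀ᵐ t ∂scaleMeasure, ∀ᵐ y ∂(weighted volume w), ‖T (t ^ 2) (fun z => F z t) y‖ₑ = g y t)
    (x : Rn n) : conical w T F x = conicalSq (weighted volume w) g x ^ (1 / 2 : ℝ) := by
  have e : ∫⁻ t in Ioi (0 : ℝ), ∫⁻ y in Metric.ball x t,
      ‖T (t ^ 2) (fun z => F z t) y‖ₑ ^ 2 /
        (ENNReal.ofReal t * weighted volume w (Metric.ball y t)) ∂(weighted volume w) =
      ∫⁻ t in Ioi (0 : ℝ), (∫⁻ y in Metric.ball x t, ‖T (t ^ 2) (fun z => F z t) y‖ₑ ^ 2 /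
        weighted volume w (Metric.ball y t) ∂(weighted volume w)) / ENNReal.ofReal t := by
    refine setLIntegral_congr_fun measurableSet_Ioi fun t ht => ?_
    have ht0 : ENNReal.ofReal t ≠ 0 := by simpa using ht
    simp only [div_eq_mul_inv]
    rw [← lintegral_mul_const' _ _ (by simpa using ht)]
    refine lintegral_congr fun y => ?_
    rw [ENNReal.mul_inv (Or.inl ht0) (Or.inl ENNReal.ofReal_ne_top)]
    ring
  rw [conical, e, ← lintegral_scaleMeasure, conicalSq]
  congr 1
  refine lintegral_congr_ae ?_
  filter_upwards [h] with t ht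
  refine lintegral_congr_ae (ae_restrict_of_ae ?_)
  filter_upwards [ht] with y hy
  rw [hy, ENNReal.rpow_two]

theorem rpow_neg_mul_eLpNorm_indicator_ball (μ : Measure (Rn n)) {s : ℝ} (hs : 0 < s)
    (f : Rn n → ℂ) (x : Rn n) (r : ℝ) :
    μ (ball x r) ^ (-(1 / s)) * eLpNorm ((ball x r).indicator f) (ENNReal.ofReal s) μ =
      ballAvg μ (fun y => ‖f y‖ₑ ^ s) x r ^ (1 / s) := by
  rw [eLpNorm_indicator_eq_eLpNorm_restrict measurableSet_ball,
    eLpNorm_eq_lintegral_rpow_enorm_toReal (by simpa using hs) ENNReal.ofReal_ne_top,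
    ENNReal.toReal_ofReal hs.le, ballAvg, ENNReal.div_rpow_of_nonneg _ _ (by positivity),
    ENNReal.rpow_neg, mul_comm, ← div_eq_mul_inv]

/-- With τ = t/√2 one has t²/2 = τ² and F(·,t) = κ(√2)F(·,τ). Sublinearity enters only through
|T(af)| = |a||Tf|, which extracts κ(√2) into the constant. -/
theorem OffDiagonal.scaleOffDiagonal {w : Rn n → ℝ} {D : Submodule ℂ (Rn n → ℂ)}
    {T : ℝ → (Rn n → ℂ) → (Rn n → ℂ)} {F : Rn n → ℝ → ℂ} {κ : ℝ → ℝ} {r s : ℝ} (hr : 0 < r)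
    (hs : 0 < s) {M : ℝ≥0} {c : ℝ} (hA : Admissible D T F) (hκ : IsScaleHomogeneous κ F)
    (h : OffDiagonal w r s M c T F) {g : Rn n → ℝ → ℝ≥0∞} (hg : Measurable (uncurry g))
    (hgT : ∀ᵐ t ∂scaleMeasure, ∀ᵐ y, ‖T (t ^ 2) (fun z => F z t) y‖ₑ = g y t) :
    ScaleOffDiagonal (weighted volume w) (1 / √2) r s ((M * (κ √2).toNNReal : ℝ≥0) : ℝ≥0∞) c g := by
  have hac : weighted volume w ≪ volume := withDensity_absolutelyContinuous _ _
  have h2 : 0 < √2 := by positivity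
  have ha : 0 < 1 / √2 := by positivity
  obtain ⟨hκ0, hκF⟩ := hκ √2 h2
  have hκe : ‖(κ √2 : ℂ)‖ₑ = ((κ √2).toNNReal : ℝ≥0∞) := by
    rw [← ofReal_norm, Complex.norm_real, Real.norm_of_nonneg hκ0.le]
    rfl
  filter_upwards [hgT, (measurePreserving_mul_scaleMeasure ha).quasiMeasurePreserving.ae hgT,
    ae_scaleMeasure_pos] with t ht hat ht0 x
  set τ := 1 / √2 * t with hτ
  have hτ0 : 0 < τ := by positivity
  have hτt : √2 * τ = t := by rw [hτ]; field_simp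
  have hτ2 : t ^ 2 / 2 = τ ^ 2 := by
    rw [← hτt, mul_pow, Real.sq_sqrt (by norm_num)]
    ring
  have hF : (fun y => F y t) = (κ √2 : ℂ) • fun y => F y τ := by
    funext y
    rw [← hτt, hκF y τ hτ0]
    rfl
  have hT : ∀ᵐ y ∂(weighted volume w),
      ‖T (t ^ 2 / 2) (fun y => F y t) y‖ₑ = (κ √2).toNNReal * g y τ := by
    filter_upwards [hac.ae_le ((hA.sublinear (τ ^ 2) (by positivity)).smul_eq (κ √2 : ℂ) _
      (hA.mem_domain τ hτ0)), hac.ae_le hat] with y h1 h3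
    rw [hτ2, hF, ← h3, ← hκe, ← enorm_norm, h1, enorm_mul, enorm_norm, enorm_norm]
  have hgm : Measurable fun y => g y τ ^ r :=
    (hg.comp (measurable_id.prodMk measurable_const)).pow_const r
  have h3 := h x t ht0
  simp only [rpow_neg_mul_eLpNorm_indicator_ball _ hs,
    rpow_neg_mul_eLpNorm_indicator_ball _ hr] at h3
  have e1 : ballAvg (weighted volume w) (fun y => ‖T (t ^ 2) (fun y => F y t) y‖ₑ ^ s) x t =
      ballAvg (weighted volume w) (fun y => g y t ^ s) x t := by
    refine ballAvg_congr_ae ?_ _ _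
    filter_upwards [hac.ae_le ht] with y hy
    rw [hy]
  have e2 : ∀ R,
      ballAvg (weighted volume w) (fun y => ‖T (t ^ 2 / 2) (fun y => F y t) y‖ₑ ^ r) x R ^ (1 / r) =
        (κ √2).toNNReal * ballAvg (weighted volume w) (fun y => g y τ ^ r) x R ^ (1 / r) := by
    intro R
    have : ballAvg (weighted volume w) (fun y => ‖T (t ^ 2 / 2) (fun y => F y t) y‖ₑ ^ r) x R =
        ballAvg (weighted volume w) (fun y => ((κ √2).toNNReal : ℝ≥0∞) ^ r * g y τ ^ r) x R := by
      refine ballAvg_congr_ae ?_ _ _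
      filter_upwards [hT] with y hy
      rw [hy, ENNReal.mul_rpow_of_nonneg _ _ hr.le]
    rw [this, ballAvg_const_mul hgm, ENNReal.mul_rpow_of_nonneg _ _ (by positivity),
      ← ENNReal.rpow_mul, mul_one_div_cancel hr.ne', ENNReal.rpow_one]
  rw [e1] at h3
  simp only [e2] at h3
  refine h3.trans_eq ?_
  rw [ENNReal.coe_mul, mul_assoc]
  congr 1
  rw [← ENNReal.tsum_mul_left]
  refine tsum_congr fun j => ?_
  rw [tail]
  ring

theorem normLp_eq {w v : Rn n → ℝ} {v' : Rn n → ℝ≥0∞} (hv' : Measurable v')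
    (hv : (fun x => ENNReal.ofReal (v x)) =ᵐ[weighted volume w] v') {p : ℝ} (hp : 0 < p)
    {f h : Rn n → ℝ≥0∞} (hh : Measurable h)
    (hfh : f =ᵐ[weighted volume w] fun x => h x ^ (1 / 2 : ℝ)) :
    normLp w v p f = (∫⁻ x, h x ^ (p / 2) * v' x ∂(weighted volume w)) ^ (1 / p) := by
  have hac : (weighted volume w).withDensity v' ≪ weighted volume w :=
    withDensity_absolutelyContinuous _ _
  rw [normLp, weighted_eq_withDensity hv, eLpNorm_congr_ae (hac.ae_eq hfh),
    eLpNorm_eq_lintegral_rpow_enorm_toReal (by simpa using hp) ENNReal.ofReal_ne_top,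
    ENNReal.toReal_ofReal hp.le, ← lintegral_withDensity_mul hv' (hh.pow_const _)]
  simp only [enorm_eq_self, ← ENNReal.rpow_mul, one_div_mul_eq_div]

/-! ### The estimates for operator families -/

theorem rpow_one_div_le_of_le_mul {a b K : ℝ≥0∞} (hK : K ≠ ∞) {p : ℝ} (hp : 0 < p)
    (h : a ≤ K * b) : a ^ (1 / p) ≤ (K ^ (1 / p)).toNNReal * b ^ (1 / p) := by
  have hp' : 0 ≤ 1 / p := by positivity
  rw [ENNReal.coe_toNNReal (ENNReal.rpow_ne_top_of_nonneg hp' hK),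
    ← ENNReal.mul_rpow_of_nonneg _ _ hp']
  exact ENNReal.rpow_le_rpow h hp'

theorem exists_normLp_conical_le {w v : Rn n → ℝ} (hw : MemAinfty volume w)
    (hv : MemAinfty (weighted volume w) v) {p₀ : ℝ} (hp₀ : 0 < p₀) (hp₀2 : p₀ < 2)
    (κ : ℝ → ℝ) (M : ℝ≥0) {c : ℝ} (hc : 0 < c) {p : ℝ} (hp : p ∈ exponents w v p₀ ∞) :
    ∃ C : ℝ≥0, ∀ (D : Submodule ℂ (Rn n → ℂ)) (T : ℝ → (Rn n → ℂ) → (Rn n → ℂ))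
      (F : Rn n → ℝ → ℂ), Admissible D T F → IsScaleHomogeneous κ F →
        OffDiagonal w p₀ 2 M c T F →
        normLp w v p (conical w T F) ≤ C * normLp w v p (vertical T F) := by
  obtain ⟨hpp₀, -, hvA, -⟩ := hp
  have hp0 : 0 < p := hp₀.trans hpp₀
  obtain ⟨-, -, hC⟩ := hvA hp₀.ne'
  obtain ⟨w', hw', hww'⟩ := hw.isWeight.exists_isPosFinite
  obtain ⟨v', hv', hvv'⟩ := hv.isWeight.exists_isPosFinite
  obtain ⟨P, C₀, hP, hC₀, hwP⟩ := hw.exists_apBound (isDoubling_volume n) hww'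
  have hμ := hwP.isDoubling (isDoubling_volume n) hw' hP hC₀
  rw [← weighted_eq_withDensity hww'] at hμ
  have hsf : SigmaFinite (weighted volume w) := hμ.sigmaFinite
  have hac : weighted volume w ≪ volume := withDensity_absolutelyContinuous _ _
  obtain ⟨K, hK, H⟩ := lintegral_conicalSq_rpow_le hμ hv' hp₀ hp₀2 hpp₀ hC.ne
    (apBound_apConst hμ hvv' ((one_lt_div hp₀).2 hpp₀)) (a := 1 / √2) (by positivity)
    (M * (κ √2).toNNReal) hc
  refine ⟨(K ^ (1 / p)).toNNReal, fun D T F hA hκ hoff => ?_⟩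
  obtain ⟨g, hg, hg₁, hg₂⟩ := hA.exists_measurable_enorm
  have hg₂' := hg₂.mono fun t ht => hac.ae_le ht
  rw [normLp_eq hv'.measurable hvv' hp0 (measurable_conicalSq hg)
    (Filter.Eventually.of_forall (conical_eq hg₂')),
    normLp_eq hv'.measurable hvv' hp0 (measurable_verticalSq hg)
    (vertical_ae_eq (hac.ae_le hg₁))]
  exact rpow_one_div_le_of_le_mul hK hp0
    (H g hg (hoff.scaleOffDiagonal hp₀ two_pos hA hκ hg hg₂))

theorem exists_normLp_vertical_le {w v : Rn n → ℝ} (hw : MemAinfty volume w)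
    (hv : MemAinfty (weighted volume w) v) {q₀ : ℝ} (hq₀ : 2 < q₀)
    (κ : ℝ → ℝ) (M : ℝ≥0) {c : ℝ} (hc : 0 < c) {p : ℝ}
    (hp : p ∈ exponents w v 0 (ENNReal.ofReal q₀)) :
    ∃ C : ℝ≥0, ∀ (D : Submodule ℂ (Rn n → ℂ)) (T : ℝ → (Rn n → ℂ) → (Rn n → ℂ))
      (F : Rn n → ℝ → ℂ), Admissible D T F → IsScaleHomogeneous κ F →
        OffDiagonal w 2 q₀ M c T F →
        normLp w v p (vertical T F) ≤ C * normLp w v p (conical w T F) := by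
  obtain ⟨hp0, hpq, -, hvRH⟩ := hp
  have hq0 : 0 < q₀ := by linarith
  rw [ENNReal.ofReal_lt_ofReal_iff hq0] at hpq
  have hqp : 0 < q₀ - p := by linarith
  have hu : (q₀ / p).conjExponent = q₀ / (q₀ - p) := by
    rw [Real.conjExponent]
    field_simp
  obtain ⟨hu1, -, hR⟩ := hvRH ENNReal.ofReal_ne_top
  rw [ENNReal.toReal_ofReal hq0.le, hu] at hR hu1
  obtain ⟨w', hw', hww'⟩ := hw.isWeight.exists_isPosFinite
  obtain ⟨v', hv', hvv'⟩ := hv.isWeight.exists_isPosFinite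
  obtain ⟨P, C₀, hP, hC₀, hwP⟩ := hw.exists_apBound (isDoubling_volume n) hww'
  have hμ := hwP.isDoubling (isDoubling_volume n) hw' hP hC₀
  rw [← weighted_eq_withDensity hww'] at hμ
  have hsf : SigmaFinite (weighted volume w) := hμ.sigmaFinite
  have hac : weighted volume w ≪ volume := withDensity_absolutelyContinuous _ _
  obtain ⟨Q, C₁, hQ, hC₁, hvQ⟩ := hv.exists_apBound hμ hvv'
  have hμv := hvQ.isDoubling hμ hv' hQ hC₁
  -- v lies in A_Q(μ) for some Q > 1 because it is in A_∞, and in RH_u with u = (q₀/p)'; together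
  -- these give v^u in A_{u(Q-1)+1}.
  have hV := ApBound.rpow hμ hQ hu1 hvQ fun x r hr =>
    setLIntegral_rpow_mul_le_rhConst hμ hμv hv' hvv' hu1 x hr
  have hu0 : 0 < q₀ / (q₀ - p) := by positivity
  have hQ' : 1 < q₀ / (q₀ - p) * (Q - 1) + 1 := by
    have : 0 < q₀ / (q₀ - p) * (Q - 1) := mul_pos hu0 (by linarith)
    linarith
  have h12 : 1 / 2 ≤ 1 / √2 := by
    refine one_div_le_one_div_of_le (by positivity) ?_
    rw [Real.sqrt_le_left (by norm_num)]
    norm_num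
  have h11 : 1 / √2 ≤ 1 := by
    rw [div_le_one (by positivity), Real.one_le_sqrt]
    norm_num
  have hRt := hR.ne
  obtain ⟨K, hK, H⟩ := lintegral_verticalSq_rpow_le hμ hv' hμv hq₀ hp0 hpq hQ'
    (ENNReal.mul_ne_top (ENNReal.rpow_ne_top_of_nonneg hu0.le hRt)
      (ENNReal.rpow_ne_top_of_nonneg hu0.le hC₁)) hV h12 h11 (M * (κ √2).toNNReal) hc
  refine ⟨(K ^ (1 / p)).toNNReal, fun D T F hA hκ hoff => ?_⟩
  obtain ⟨g, hg, hg₁, hg₂⟩ := hA.exists_measurable_enorm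
  have hg₂' := hg₂.mono fun t ht => hac.ae_le ht
  rw [normLp_eq hv'.measurable hvv' hp0 (measurable_conicalSq hg)
    (Filter.Eventually.of_forall (conical_eq hg₂')),
    normLp_eq hv'.measurable hvv' hp0 (measurable_verticalSq hg)
    (vertical_ae_eq (hac.ae_le hg₁))]
  exact rpow_one_div_le_of_le_mul hK hp0
    (H g hg (hoff.scaleOffDiagonal two_pos hq0 hA hκ hg hg₂))

end Reduction

end SquareFn

end

/-! ### Assembly of the two one-sided estimates -/

theorem mainTheorem9 (n : ℕ) (hn : 2 ≤ n) (w v : SquareFn.Rn n → ℝ)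
    (hw : SquareFn.MemAinfty volume w)
    (hv : SquareFn.MemAinfty (SquareFn.weighted volume w) v)
    (p₀ q₀ : ℝ) (hp₀ : 0 < p₀) (hp₀2 : p₀ < 2) (hq₀ : 2 < q₀)
    (κ : ℝ → ℝ) (M : ℝ≥0) (c : ℝ) (hc : 0 < c) :
    (∀ p ∈ SquareFn.exponents w v p₀ ∞, ∃ C : ℝ≥0,
      ∀ (D : Submodule ℂ (SquareFn.Rn n → ℂ))
        (T : ℝ → (SquareFn.Rn n → ℂ) → (SquareFn.Rn n → ℂ)) (F : SquareFn.Rn n → ℝ → ℂ),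
        SquareFn.Admissible D T F → SquareFn.IsScaleHomogeneous κ F →
        SquareFn.OffDiagonal w p₀ 2 M c T F →
        SquareFn.normLp w v p (SquareFn.conical w T F) ≤
          C * SquareFn.normLp w v p (SquareFn.vertical T F)) ∧
    (∀ p ∈ SquareFn.exponents w v 0 (ENNReal.ofReal q₀), ∃ C : ℝ≥0,
      ∀ (D : Submodule ℂ (SquareFn.Rn n → ℂ))
        (T : ℝ → (SquareFn.Rn n → ℂ) → (SquareFn.Rn n → ℂ)) (F : SquareFn.Rn n → ℝ → ℂ),
        SquareFn.Admissible D T F → SquareFn.IsScaleHomogeneous κ F →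
        SquareFn.OffDiagonal w 2 q₀ M c T F →
        SquareFn.normLp w v p (SquareFn.vertical T F) ≤
          C * SquareFn.normLp w v p (SquareFn.conical w T F)) ∧
    (∀ p ∈ SquareFn.exponents w v p₀ (ENNReal.ofReal q₀), ∃ C : ℝ≥0,
      ∀ (D : Submodule ℂ (SquareFn.Rn n → ℂ))
        (T : ℝ → (SquareFn.Rn n → ℂ) → (SquareFn.Rn n → ℂ)) (F : SquareFn.Rn n → ℝ → ℂ),
        SquareFn.Admissible D T F → SquareFn.IsScaleHomogeneous κ F →
        SquareFn.OffDiagonal w p₀ 2 M c T F → SquareFn.OffDiagonal w 2 q₀ M c T F →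
        SquareFn.normLp w v p (SquareFn.vertical T F) ≤
            C * SquareFn.normLp w v p (SquareFn.conical w T F) ∧
          SquareFn.normLp w v p (SquareFn.conical w T F) ≤
            C * SquareFn.normLp w v p (SquareFn.vertical T F)) := by 
  have hC := fun p hp => SquareFn.exists_normLp_conical_le hw hv hp₀ hp₀2 κ M hc (p := p) hp
  have hV := fun p hp => SquareFn.exists_normLp_vertical_le hw hv hq₀ κ M hc (p := p) hp
  refine ⟨hC, hV, fun p hp => ?_⟩
  obtain ⟨h1, h2, h3, h4⟩ := hp
  -- The exponent set for (p₀,q₀) lies in both larger ones: at q₀ = ∞ the reverse Hölder condition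
  -- is void, and at p₀ = 0 the Muckenhoupt condition is.
  obtain ⟨C₁, H₁⟩ := hC p ⟨h1, ENNReal.ofReal_lt_top, h3, fun h => absurd rfl h⟩
  obtain ⟨C₂, H₂⟩ := hV p ⟨hp₀.trans h1, h2, fun h => absurd rfl h, h4⟩
  refine ⟨max C₁ C₂, fun D T F hA hκ hoff hoff' =>
    ⟨(H₂ D T F hA hκ hoff').trans ?_, (H₁ D T F hA hκ hoff).trans ?_⟩⟩
  · gcongr
    exact le_max_right _ _
  · gcongr
    exact le_max_left _ _
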